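/- **Maps.** A rooted planar map is a connected graph (loops and multiple edges allowed) drawn on the sphere without crossings, with one distinguished oriented edge, up to orientation-preserving homeomorphism. Each edge is cut into two half-edges; $\tau$ exchanges the two halves of every edge, $\sigma(h)$ is the half-edge following $h$ in clockwise order around the same vertex, and the root half-edge $h_r$ is the half of the root edge at its origin. (Equivalently: a finite set of half-edges with a permutation $\sigma$ and a fixed-point-free involution $\tau$ generating a transitive group, and with #orbits$(\sigma)$ + #orbits$(\sigma\tau)$ = #orbits$(\tau)+2$, up to isomorphism preserving the root half-edge.) The map is bridgeless if deleting any single edge leaves it connected. Let $\mathcal B_n$ be the set of rooted bridgeless planar maps with $n$ edges. **Sticky trees.** Plane trees are drawn with the root on top; the root has depth $0$, and the prefix order lists a node before its sub-trees, which are taken from left to right. A sticky tree is a plane tree with a labelling $\ell$ of its nodes by natural numbers such that, for every node $u$, of depth $d$ and with sub-tree $S_u$ rooted at $u$: (1) $\ell(u)\le d$; (2) if $d>0$, some node $v$ of $S_u$ (possibly $u$) has $\ell(v)<d$; (3) if $v\in S_u$ has $\ell(v)=d$, then every node of $S_u$ that precedes $v$ in prefix order has label at least $d$. Let $\mathcal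 S_n$ be the set of sticky trees with $n$ edges. **The map $\mathrm S$.** Exploring a half-edge $h$ means: mark $h$ and $\tau(h)$ as visited; put $h'=\sigma(\tau(h))$; as long as $h'$ is not visited, explore $h'$ and then replace $h'$ by $\sigma(h')$. Given a rooted map $M$, start with $h'=h_r$ and nothing visited and, as long as $h'$ is not visited, explore $h'$ and then replace $h'$ by $\sigma(h')$. The exploration tree has a root node, which is a copy of the root vertex, and one node for each explored half-edge $h$, which is a copy of the vertex at $\tau(h)$; its parent is the node from which $h$ was explored, and the children of a node are placed from right to left (that is, clockwise) in the order of their exploration. Label each node by the depth of the first visited node that is a copy of the same vertex. The resulting labelled plane tree is $\mathrm S(M)$. **The map $\mathrm R$.** Given a labelled plane tree $T$, attach to each node a plug on its left, so that clockwise around a node one meets its plug, the half-edge to its parent (if any), and the half-edges to its children from right to left. For the nodes $u$ whose label equals their depth, in increasing order of depth, glue the plugs of $u=u_0$ and of the descendants $u_1,\dots,u_k$ of $u$ with the same label as $u$, in prefix order: if the half-edges clockwise after the plug of $u_i$ form the sequence $A_i$, the vertices $u_0,\dots,u_k$ are merged into one vertex with clockwise cyclic order $A_0,A_1,\dots,A_k$,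 without plugs. The process fails if at such a step the plugs to be glued are not all in the same face. If it succeeds and no plug is left, the result, rooted at the right-most edge of the root node pointing away from it, is $\mathrm R(T)$. **Theorem.** For every $n\ge 1$: $\mathrm S$ is a bijection from $\mathcal B_n$ to $\mathcal S_n$ (in particular $\mathrm S(B)\in\mathcal S_n$ for every $B\in\mathcal B_n$); for every $T\in\mathcal S_n$, the map $\mathrm R(T)$ is defined and belongs to $\mathcal B_n$; and $\mathrm R$ is the inverse of $\mathrm S$, that is, $\mathrm R(\mathrm S(B))=B$ for all $B\in\mathcal B_n$ and $\mathrm S(\mathrm R(T))=T$ for all $T\in\mathcal S_n$. -/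

import Mathlib

/-! ## Plane trees -/

/-- Plane trees whose nodes carry an element of `α`; the list of children is read from left to
right. -/
inductive PlaneTree (α : Type) : Type
  | node (a : α) (children : List (PlaneTree α)) : PlaneTree α

namespace PlaneTree

variable {α β γ : Type}

mutual
/-- The nodes of a plane tree in prefix order.  A node is recorded as a pair: its address (the list
of indices of the children chosen, from left to right and counted from `0`, on the way down from the
root) and the element of `α` it carries.  So the root has address `[]`, the depth of a node is the
length of its address, and `v` lies in the sub-tree rooted at `u` iff the address of `u` is an
initial segment of that of `v`. -/
def nodes : PlaneTree α → List (List ℕ × α)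
  | node a cs => ([], a) :: forestNodes 0 cs
/-- The nodes of the trees of a forest, whose first tree is the `i`-th child of a common parent;
addresses are relative to that parent. -/
def forestNodes : ℕ → List (PlaneTree α) → List (List ℕ × α)
  | _, [] => []
  | i, t :: ts => (nodes t).map (fun x => (i :: x.1, x.2)) ++ forestNodes (i + 1) ts
end

mutual
/-- Change what the nodes carry, keeping the shape. -/
def map (f : α → β) : PlaneTree α → PlaneTree β
  | node a cs => node (f a) (mapForest f cs)
/-- The same for forests. -/
def mapForest (f : α → β) : List (PlaneTree α) → List (PlaneTree β)
  | [] => []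
  | t :: ts => map f t :: mapForest f ts
end

mutual
/-- Exchange left and right everywhere. -/
def mirror : PlaneTree α → PlaneTree α
  | node a cs => node a (mirrorForest cs)
/-- The same for forests. -/
def mirrorForest : List (PlaneTree α) → List (PlaneTree α)
  | [] => []
  | t :: ts => mirrorForest ts ++ [mirror t]
end

/-- The number of edges: every node but the root has an edge to its parent. -/
def numEdges (T : PlaneTree α) : ℕ := T.nodes.length - 1

mutual
theorem nodes_map (f : α → β) : ∀ T : PlaneTree α,
    (T.map f).nodes = T.nodes.map (fun x => (x.1, f x.2))
  | node a cs => by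
      simp only [map, nodes, List.map_cons, forestNodes_map f cs 0]
theorem forestNodes_map (f : α → β) : ∀ (ts : List (PlaneTree α)) (i : ℕ),
    forestNodes i (mapForest f ts) = (forestNodes i ts).map (fun x => (x.1, f x.2))
  | [], _ => by simp [mapForest, forestNodes]
  | t :: ts, i => by
      simp [mapForest, forestNodes, nodes_map f t, forestNodes_map f ts (i + 1)]
end

mutual
theorem map_map (f : α → β) (g : β → γ) : ∀ T : PlaneTree α, (T.map f).map g = T.map (g ∘ f)
  | node a cs => by simp only [map, mapForest_mapForest f g cs, Function.comp]
theorem mapForest_mapForest (f : α → β) (g : β → γ) : ∀ ts : List (PlaneTree α),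
    mapForest g (mapForest f ts) = mapForest (g ∘ f) ts
  | [] => by simp only [mapForest]
  | t :: ts => by simp only [mapForest, map_map f g t, mapForest_mapForest f g ts]
end

mutual
/-- The listing `nodes` runs through the addresses in increasing lexicographic order, so on
addresses the prefix order is the order `<` of `List ℕ`. -/
theorem pairwise_nodes : ∀ T : PlaneTree α, T.nodes.Pairwise (fun x y => x.1 < y.1)
  | node a cs => by
      rw [nodes, List.pairwise_cons]
      refine ⟨fun y hy => ?_, (pairwise_forestNodes cs 0).1⟩
      obtain ⟨j, l, h, -⟩ := (pairwise_forestNodes cs 0).2 y hy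
      rw [h]
      exact List.nil_lt_cons j l
theorem pairwise_forestNodes : ∀ (ts : List (PlaneTree α)) (i : ℕ),
    (forestNodes i ts).Pairwise (fun x y => x.1 < y.1) ∧
      ∀ y ∈ forestNodes i ts, ∃ j l, y.1 = j :: l ∧ i ≤ j
  | [], _ => by simp [forestNodes]
  | t :: ts, i => by
      have h1 := pairwise_nodes t
      have h2 := pairwise_forestNodes ts (i + 1)
      constructor
      · rw [forestNodes, List.pairwise_append]
        refine ⟨?_, h2.1, ?_⟩
        · rw [List.pairwise_map]
          exact h1.imp fun h => List.cons_lt_cons_iff.2 (Or.inr ⟨rfl, h⟩)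
        · intro x hx y hy
          obtain ⟨z, -, rfl⟩ := List.mem_map.1 hx
          obtain ⟨j, l, h, hj⟩ := h2.2 y hy
          rw [h]
          exact List.cons_lt_cons_iff.2 (Or.inl hj)
      · intro y hy
        rw [forestNodes, List.mem_append] at hy
        rcases hy with hy | hy
        · obtain ⟨z, -, rfl⟩ := List.mem_map.1 hy
          exact ⟨i, z.1, rfl, le_rfl⟩
        · obtain ⟨j, l, h, hj⟩ := h2.2 y hy
          exact ⟨j, l, h, by omega⟩
end

/-- Sticky trees: the elements carried by the nodes are their labels, and `u.1.length` is the depth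
of the node `u`. -/
structure IsSticky (T : PlaneTree ℕ) : Prop where
  label_le_depth : ∀ u ∈ T.nodes, u.2 ≤ u.1.length
  exists_label_lt : ∀ u ∈ T.nodes, 0 < u.1.length →
    ∃ v ∈ T.nodes, u.1 <+: v.1 ∧ v.2 < u.1.length
  depth_le_of_before : ∀ u ∈ T.nodes, ∀ v ∈ T.nodes, u.1 <+: v.1 → v.2 = u.1.length →
    ∀ w ∈ T.nodes, u.1 <+: w.1 → w.1 < v.1 → u.1.length ≤ w.2

end PlaneTree

/-- The sticky trees with `n` edges. -/
def stickyTrees (n : ℕ) : Set (PlaneTree ℕ) := {T | T.IsSticky ∧ T.numEdges = n}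

/-! ## Rooted maps -/

/-- Finitely many half-edges with the permutation `σ` (the next half-edge in clockwise order around
the same vertex), the fixed-point-free involution `τ` (the other half of the same edge) and a root
half-edge.  Vertices, edges and faces are the orbits of `σ`, `τ` and `σ * τ`. -/
structure RotationSystem where
  D : Type
  [instFintype : Fintype D]
  [instDecidableEq : DecidableEq D]
  σ : Equiv.Perm D
  τ : Equiv.Perm D
  root : D
  τ_τ : ∀ h, τ (τ h) = h
  τ_ne : ∀ h, τ h ≠ h

namespace RotationSystem

attribute [instance] instFintype instDecidableEq

/-- The number of orbits of a permutation. -/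
noncomputable def numOrbits {D : Type} (f : Equiv.Perm D) : ℕ :=
  Nat.card (Quotient (Equiv.Perm.SameCycle.setoid f))

noncomputable def numVertices (M : RotationSystem) : ℕ := numOrbits M.σ

noncomputable def numEdges (M : RotationSystem) : ℕ := numOrbits M.τ

noncomputable def numFaces (M : RotationSystem) : ℕ := numOrbits (M.σ * M.τ)

/-- The graph with all the vertices of `M`, but only the edges whose half-edges are in `A`, is
connected. -/
def ConnectedBy (M : RotationSystem) (A : Set M.D) : Prop :=
  ∀ x y : M.D, Relation.EqvGen (fun a b => M.σ.SameCycle a b ∨ (a ∈ A ∧ b = M.τ a)) x y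

/-- Rooted planar maps: connected, and drawn on the sphere (Euler characteristic `2`). -/
structure IsPlanarMap (M : RotationSystem) : Prop where
  connected : M.ConnectedBy Set.univ
  euler : M.numVertices + M.numFaces = M.numEdges + 2

/-- The edge of the half-edge `h` is a bridge: its deletion disconnects the map. -/
def IsBridge (M : RotationSystem) (h : M.D) : Prop := ¬ M.ConnectedBy {h, M.τ h}ᶜ

structure IsBridgelessPlanarMap (M : RotationSystem) : Prop extends M.IsPlanarMap where
  bridgeless : ∀ h, ¬ M.IsBridge h

/-- Isomorphism of rooted maps (orientation-preserving homeomorphism of drawings). -/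
def Iso (M M' : RotationSystem) : Prop :=
  ∃ e : M.D ≃ M'.D, (∀ h, e (M.σ h) = M'.σ (e h)) ∧ (∀ h, e (M.τ h) = M'.τ (e h)) ∧
    e M.root = M'.root

instance setoid : Setoid RotationSystem where
  r := Iso
  iseqv :=
    { refl := fun M => ⟨Equiv.refl _, fun _ => rfl, fun _ => rfl, rfl⟩
      symm := by
        rintro M M' ⟨e, h1, h2, h3⟩
        refine ⟨e.symm, fun h => ?_, fun h => ?_, ?_⟩
        · rw [Equiv.symm_apply_eq, h1, Equiv.apply_symm_apply]
        · rw [Equiv.symm_apply_eq, h2, Equiv.apply_symm_apply]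
        · rw [Equiv.symm_apply_eq, h3]
      trans := by
        rintro M M' M'' ⟨e, h1, h2, h3⟩ ⟨f, g1, g2, g3⟩
        refine ⟨e.trans f, fun h => ?_, fun h => ?_, ?_⟩
        · simp [h1, g1]
        · simp [h2, g2]
        · simp [h3, g3] }

end RotationSystem

/-- Rooted maps up to isomorphism. -/
abbrev RootedMap : Type 1 := Quotient RotationSystem.setoid

/-- The rooted bridgeless planar maps with `n` edges. -/
def bridgelessMaps (n : ℕ) : Set RootedMap :=
  {B | ∃ M : RotationSystem, M.IsBridgelessPlanarMap ∧ M.numEdges = n ∧ B = ⟦M⟧}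

/-! ## The exploration -/

/-- The loop `while h is not visited: Explore(h); h ← σ(h)`, started with the set `V` of visited
half-edges, where `Explore(h)` marks `h` and `τ(h)` as visited and then runs the same loop from
`σ(τ(h))`.  Returns the exploration trees of the successive `h`, in the order of exploration, and
the set of visited half-edges at the end.  The node reached through `h` carries `τ(h)`, a half-edge
adjacent to the vertex it is a copy of. -/
def exploreAux {D : Type} [Fintype D] [DecidableEq D] (σ τ : Equiv.Perm D) (V : Finset D) (h : D) :
    {r : List (PlaneTree D) × Finset D // V ⊆ r.2} :=
  if _hV : h ∈ V then ⟨([], V), Finset.Subset.refl V⟩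
  else
    let below := exploreAux σ τ (insert h (insert (τ h) V)) (σ (τ h))
    let next := exploreAux σ τ below.1.2 (σ h)
    ⟨(PlaneTree.node (τ h) below.1.1 :: next.1.1, next.1.2), fun _ hx =>
      next.2 (below.2 (Finset.mem_insert_of_mem (Finset.mem_insert_of_mem hx)))⟩
termination_by Vᶜ.card
decreasing_by
  · refine Finset.card_lt_card (Finset.ssubset_iff_of_subset ?_ |>.2 ⟨h, ?_, ?_⟩)
    · intro x hx
      simp only [Finset.mem_compl, Finset.mem_insert, not_or] at hx ⊢
      exact hx.2.2
    · simpa using _hV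
    · simp
  · have hb := below.2
    refine Finset.card_lt_card (Finset.ssubset_iff_of_subset ?_ |>.2 ⟨h, ?_, ?_⟩)
    · intro x hx
      simp only [Finset.mem_compl] at hx ⊢
      exact fun hx' => hx (hb (Finset.mem_insert_of_mem (Finset.mem_insert_of_mem hx')))
    · simpa using _hV
    · simpa using hb (Finset.mem_insert_self _ _)

/-- The result of `exploreAux`, without the proof that visited half-edges stay visited; see
`explore_of_mem` and `explore_of_notMem` for its defining equations. -/
def explore {D : Type} [Fintype D] [DecidableEq D] (σ τ : Equiv.Perm D) (V : Finset D) (h : D) :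
    List (PlaneTree D) × Finset D :=
  (exploreAux σ τ V h).1

theorem subset_explore {D : Type} [Fintype D] [DecidableEq D] (σ τ : Equiv.Perm D) (V : Finset D)
    (h : D) : V ⊆ (explore σ τ V h).2 :=
  (exploreAux σ τ V h).2

theorem explore_of_mem {D : Type} [Fintype D] [DecidableEq D] (σ τ : Equiv.Perm D) {V : Finset D}
    {h : D} (hV : h ∈ V) : explore σ τ V h = ([], V) := by
  rw [explore, exploreAux, dif_pos hV]

theorem explore_of_notMem {D : Type} [Fintype D] [DecidableEq D] (σ τ : Equiv.Perm D)
    {V : Finset D} {h : D} (hV : h ∉ V) :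
    explore σ τ V h =
      (PlaneTree.node (τ h) (explore σ τ (insert h (insert (τ h) V)) (σ (τ h))).1 ::
        (explore σ τ (explore σ τ (insert h (insert (τ h) V)) (σ (τ h))).2 (σ h)).1,
       (explore σ τ (explore σ τ (insert h (insert (τ h) V)) (σ (τ h))).2 (σ h)).2) := by
  rw [explore, exploreAux, dif_neg hV]
  rfl

namespace RotationSystem

/-- The exploration tree: the root node is a copy of the root vertex, from which the half-edges are
inspected in clockwise order, beginning with the root half-edge.  Here the children of a node are
listed in the order of their exploration, so `nodes` lists the nodes in the order of the visits. -/
def searchTree (M : RotationSystem) : PlaneTree M.D :=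
  .node M.root (explore M.σ M.τ ∅ M.root).1

/-- The label of the vertex adjacent to `h`: the depth of the node of its first visit. -/
def vertexLabel (M : RotationSystem) (h : M.D) : ℕ :=
  ((M.searchTree.nodes.find? (fun x => decide (M.σ.SameCycle x.2 h))).map
    (fun x => x.1.length)).getD 0

/-- The labelled exploration tree.  The tree is drawn with its root on top, so the clockwise order
in which the children of a node are explored, starting from the edge to its parent, is the order
from right to left, whence the `mirror`. -/
def labelledTree (M : RotationSystem) : PlaneTree ℕ :=
  (M.searchTree.map M.vertexLabel).mirror

theorem explore_equivariant {D D' : Type} [Fintype D] [DecidableEq D] [Fintype D'] [DecidableEq D']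
    (σ τ : Equiv.Perm D) (σ' τ' : Equiv.Perm D') (e : D ≃ D') (hσ : ∀ h, e (σ h) = σ' (e h))
    (hτ : ∀ h, e (τ h) = τ' (e h)) (n : ℕ) :
    ∀ (V : Finset D) (h : D), Vᶜ.card ≤ n →
      explore σ' τ' (V.map e.toEmbedding) (e h) =
        (PlaneTree.mapForest e (explore σ τ V h).1,
          (explore σ τ V h).2.map e.toEmbedding) := by
  induction n using Nat.strong_induction_on with
  | _ n ih =>
    intro V h hn
    by_cases hV : h ∈ V
    · have hV' : e h ∈ V.map e.toEmbedding := by simpa using hV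
      simp [explore_of_mem _ _ hV, explore_of_mem _ _ hV', PlaneTree.mapForest]
    · have hV' : e h ∉ V.map e.toEmbedding := by simpa using hV
      have key : ∀ W : Finset D, V ⊆ W → h ∈ W → Wᶜ.card < n := by
        intro W hW hh
        refine lt_of_lt_of_le (Finset.card_lt_card
          (Finset.ssubset_iff_of_subset ?_ |>.2 ⟨h, ?_, ?_⟩)) hn
        · exact Finset.compl_subset_compl.2 hW
        · simpa using hV
        · simpa using hh
      have hsub := subset_explore σ τ (insert h (insert (τ h) V)) (σ (τ h))
      have h1 := ih _ (key (insert h (insert (τ h) V))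
        (fun x hx => Finset.mem_insert_of_mem (Finset.mem_insert_of_mem hx))
        (Finset.mem_insert_self _ _)) (insert h (insert (τ h) V)) (σ (τ h)) le_rfl
      have h2 := ih _ (key (explore σ τ (insert h (insert (τ h) V)) (σ (τ h))).2
        (fun x hx => hsub (Finset.mem_insert_of_mem (Finset.mem_insert_of_mem hx)))
        (hsub (Finset.mem_insert_self _ _)))
        (explore σ τ (insert h (insert (τ h) V)) (σ (τ h))).2 (σ h) le_rfl
      have e1 : (insert h (insert (τ h) V)).map e.toEmbedding
          = insert (e h) (insert (τ' (e h)) (V.map e.toEmbedding)) := by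
        simp [Finset.map_insert, hτ]
      rw [e1, hσ, hτ] at h1
      rw [hσ] at h2
      rw [explore_of_notMem _ _ hV, explore_of_notMem _ _ hV']
      simp only [h1, h2, PlaneTree.mapForest, PlaneTree.map, hτ]

theorem labelledTree_eq_of_iso {M M' : RotationSystem} (h : Iso M M') :
    M.labelledTree = M'.labelledTree := by
  obtain ⟨e, hσ, hτ, hr⟩ := h
  have hE : M'.searchTree = M.searchTree.map e := by
    have := explore_equivariant M.σ M.τ M'.σ M'.τ e hσ hτ _ ∅ M.root le_rfl
    rw [Finset.map_empty, hr] at this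
    rw [searchTree, searchTree, this, PlaneTree.map, hr]
  have hcyc : ∀ x y, M'.σ.SameCycle (e x) (e y) ↔ M.σ.SameCycle x y := by
    intro x y
    have hc : M'.σ = (e.symm.trans M.σ).trans e := by
      ext z; simp [hσ]
    have hz : ∀ (k : ℤ) (z : M.D), (M'.σ ^ k) (e z) = e ((M.σ ^ k) z) := by
      intro k z
      have : M'.σ = e.permCongr M.σ := by rw [hc]; rfl
      rw [this, ← Equiv.permCongrHom_coe, ← map_zpow]
      simp [Equiv.permCongr_apply]
    simp [Equiv.Perm.SameCycle, hz]
  have hL : ∀ x, M'.vertexLabel (e x) = M.vertexLabel x := by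
    intro x
    rw [vertexLabel, vertexLabel, hE, PlaneTree.nodes_map, List.find?_map]
    simp only [Function.comp_def, hcyc, Option.map_map]
  rw [labelledTree, labelledTree, hE, PlaneTree.map_map]
  congr 2
  funext x
  exact (hL x).symm

end RotationSystem

/-- The labelled exploration tree of a rooted map. -/
def mapToTree : RootedMap → PlaneTree ℕ :=
  Quotient.lift RotationSystem.labelledTree fun _ _ h => RotationSystem.labelledTree_eq_of_iso h

/-! ## Gluing plugs -/

namespace PlaneTree

variable (T : PlaneTree ℕ)

/-- The non-root nodes in prefix order; they stand also for the edges to their parents. -/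
def nonRootNodes : List (List ℕ × ℕ) := T.nodes.filter (fun x => decide (x.1 ≠ []))

abbrev Node : Type := {x // x ∈ T.nodes}

abbrev Edge : Type := {x // x ∈ T.nonRootNodes}

/-- `(v, false)` is the half at `v` of the edge from `v` to its parent, `(v, true)` is the half at
the parent. -/
abbrev HalfEdge : Type := T.Edge × Bool

/-- Half-edges, and one plug for every node. -/
abbrev Dart : Type := T.HalfEdge ⊕ T.Node

/-- Exchange the two halves of every edge. -/
def flip : Equiv.Perm T.HalfEdge := (Equiv.refl T.Edge).prodCongr Equiv.boolNot

/-- The edges to the children of `u`, from left to right. -/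
def childEdges (u : List ℕ) : List T.Edge :=
  T.nonRootNodes.attach.filter (fun v => decide (v.1.1.dropLast = u))

/-- What is attached to the node `u`, in clockwise order: its plug (on the left of `u`), the
half-edge to its parent unless `u` is the root, and the half-edges to its children from right to
left. -/
def around (u : T.Node) : List T.Dart :=
  Sum.inr u ::
    ((if h : u.1 ∈ T.nonRootNodes then [Sum.inl (⟨u.1, h⟩, false)] else []) ++
      (T.childEdges u.1.1).reverse.map (fun v => Sum.inl (v, true)))

/-- The clockwise rotation around the nodes of the tree with its plugs. -/
def initialRotation : Equiv.Perm T.Dart :=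
  (T.nodes.attach.map (fun u => (T.around u).formPerm)).prod

/-- With clockwise rotation `σ`, the plugs `p` and `q` are in the same face.  Plugs are dangling:
the contour of a face passes by them. -/
def SameFace (σ : Equiv.Perm T.Dart) (p q : T.Node) : Prop :=
  (σ * Equiv.Perm.sumCongr T.flip 1).SameCycle (Sum.inr p) (Sum.inr q)

/-- The nodes in the sub-tree rooted at `u` (including `u`) with the label of `u`, in prefix
order. -/
def glueClass (u : T.Node) : List T.Node :=
  T.nodes.attach.filter (fun v => decide (u.1.1 <+: v.1.1 ∧ v.1.2 = u.1.2))

/-- Remove a plug from its vertex. -/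
def removePlug (σ : Equiv.Perm T.Dart) (p : T.Node) : Equiv.Perm T.Dart :=
  Equiv.swap (Sum.inr p) (σ (Sum.inr p)) * σ

/-- Merge the vertices that carry the plugs `p₀, …, pₖ`: if in clockwise order these vertices are
`(p₀, A₀), …, (pₖ, Aₖ)`, they become one vertex `(p₀, A₀, …, pₖ, Aₖ)`, from which the plugs are then
removed. -/
def mergePlugs (σ : Equiv.Perm T.Dart) (ps : List T.Node) : Equiv.Perm T.Dart :=
  ps.foldl T.removePlug ((ps.map Sum.inr).formPerm * σ)

open Classical in
/-- Glue the plugs of `u` and of its descendants with the same label; this fails if they are not all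
in the same face. -/
noncomputable def glue (σ : Equiv.Perm T.Dart) (u : T.Node) : Option (Equiv.Perm T.Dart) :=
  if ∀ p ∈ T.glueClass u, ∀ q ∈ T.glueClass u, T.SameFace σ p q then
    some (T.mergePlugs σ (T.glueClass u))
  else none

/-- The nodes that are not derived (the label equals the depth), in increasing order of depth. -/
def gluingOrder : List T.Node :=
  (List.range T.nodes.length).flatMap fun d =>
    T.nodes.attach.filter (fun u => decide (u.1.1.length = d ∧ u.1.2 = d))

/-- The rotation after all gluings, if none of them fails. -/
noncomputable def finalRotation : Option (Equiv.Perm T.Dart) :=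
  T.gluingOrder.foldlM T.glue T.initialRotation

/-- A rotation for which no plug is left next to a half-edge, as a permutation of half-edges. -/
noncomputable def restrictRotation (σ : Equiv.Perm T.Dart)
    (h : ∀ x : T.HalfEdge, (σ (Sum.inl x)).isLeft) : Equiv.Perm T.HalfEdge :=
  Equiv.ofBijective (fun x => (σ (Sum.inl x)).getLeft (h x)) <|
    Finite.injective_iff_bijective.1 fun x y hxy => by
      have h' : σ (Sum.inl x) = σ (Sum.inl y) := by
        rw [← Sum.inl_getLeft _ (h x), ← Sum.inl_getLeft _ (h y)]
        exact congrArg Sum.inl hxy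
      exact Sum.inl_injective (σ.injective h')

/-- The rooted map with half-edges those of `T`, clockwise rotation `σ` and root half-edge `r`. -/
def toRotationSystem (σ : Equiv.Perm T.HalfEdge) (r : T.HalfEdge) : RotationSystem where
  D := T.HalfEdge
  σ := σ
  τ := T.flip
  root := r
  τ_τ := fun h => by
    obtain ⟨v, b⟩ := h
    simp [flip]
  τ_ne := fun h hh => by
    have := congrArg Prod.snd hh
    simp [flip] at this

end PlaneTree

open Classical in
/-- The map obtained from a labelled tree by gluing plugs, if the gluings succeed and use up all
plugs.  The root is the right-most edge of the root node, pointing away from it. -/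
noncomputable def treeToMap (T : PlaneTree ℕ) : Option RootedMap :=
  T.finalRotation.bind fun σ =>
    (T.childEdges []).getLast?.bind fun v =>
      if h : ∀ x : T.HalfEdge, (σ (Sum.inl x)).isLeft then
        some ⟦T.toRotationSystem (T.restrictRotation σ h) (v, true)⟧
      else none

/-!
A labelled plane tree `T` is turned into a map by gluing its nodes along a permutation `π` of the
nodes: the half-edges around `u` are followed by those around `π u`.  Each half-edge belongs to one
node, so the vertices of the glued map are the cycles of `π`, and its edges are those of `T`.

Number the nodes in prefix order.  Multiplying a permutation by a transposition changes its number
of cycles by one, so merging plugs in the same face creates a face and merging plugs in different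
faces destroys one.  It follows that Euler's relation holds for the glued map exactly when the
cycles of `π` form a non-crossing partition of the nodes and each of them is traversed in the
increasing cyclic order.  Such a `π` is determined by its cycles.

For a sticky tree, each node `v` has an ancestor `rep v` whose depth is the label of `v`; nodes are
glued when they have the same `rep`.  Condition (3) says that these classes do not cross, so that
the gluings succeed and give a planar map.  Condition (2) says that each sub-tree has a node that is
glued to a node above the sub-tree, so that no edge is a bridge.

Conversely, the exploration of a connected map cuts it open along its vertices into a tree, and the
map is recovered by gluing along a permutation `π` for which `π u` is an ancestor of `u` (or `u`
itself) or comes after `u` in prefix order.  With the non-crossing property, this puts an ancestor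
of all the nodes of a cycle of `π` in that cycle, and the label of the nodes is its depth.  Hence
the labels determine the cycles of `π`, and therefore `π`.
-/

open Equiv.Perm

/-! ## Counting the orbits of a permutation -/

namespace RotationSystem

section SameCycle

variable {X Y : Type*} [Finite X] {f : Equiv.Perm X} {a b : X}

theorem sameCycle_apply_self {X : Type*} (f : Equiv.Perm X) (x : X) : f.SameCycle x (f x) :=
  SameCycle.rfl.apply_right

theorem sameCycle_induction {S : X → Prop} (hS : ∀ x, S x → S (f x)) {x y : X}
    (hxy : f.SameCycle x y) (hx : S x) : S y := by
  obtain ⟨n, rfl⟩ := hxy.exists_nat_pow_eq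
  clear hxy
  induction n with
  | zero => simpa using hx
  | succ n ih => rw [pow_succ', Equiv.Perm.mul_apply]; exact hS _ ih

theorem of_apply_of_forall_imp {S : X → Prop} (hS : ∀ x, S x → S (f x)) {x : X} (hx : S (f x)) :
    S x :=
  sameCycle_induction hS (sameCycle_apply_self f x).symm hx

theorem sameCycle_map {g : Equiv.Perm Y} (r : X → Y) (hr : ∀ x, g.SameCycle (r x) (r (f x)))
    {x y : X} (hxy : f.SameCycle x y) : g.SameCycle (r x) (r y) :=
  sameCycle_induction (S := fun z => g.SameCycle (r x) (r z)) (fun z hz => hz.trans (hr z)) hxy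
    SameCycle.rfl

theorem sameCycle_iff_of_retract [Finite Y] {g : Equiv.Perm Y} (i : Y → X) (r : X → Y)
    (hi : ∀ y, f.SameCycle (i y) (i (g y))) (hr : ∀ x, g.SameCycle (r x) (r (f x)))
    (hir : ∀ x, f.SameCycle (i (r x)) x) (x y : X) :
    f.SameCycle x y ↔ g.SameCycle (r x) (r y) :=
  ⟨sameCycle_map r hr, fun h => ((hir x).symm.trans (sameCycle_map i hi h)).trans (hir y)⟩

variable [DecidableEq X]

theorem sameCycle_swap_mul_of_not_sameCycle (hab : ¬ f.SameCycle a b) :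
    (Equiv.swap a b * f).SameCycle a b := by
  set g := Equiv.swap a b * f with hg
  have hlast : g.SameCycle (f.symm a) b := by
    simpa [hg] using sameCycle_apply_self g (f.symm a)
  by_contra hcon
  -- As long as the `g`-walk from `a` has not met `b`, it follows the `f`-cycle of `a`.
  have hwalk : ∀ x, f.SameCycle a x ∧ g.SameCycle a x → f.SameCycle a (f x) ∧
      g.SameCycle a (f x) := by
    rintro x ⟨hfx, hgx⟩
    refine ⟨hfx.apply_right, ?_⟩
    have hb : f x ≠ b := fun h => hab (h ▸ hfx.apply_right)
    by_cases ha : f x = a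
    · rw [ha]
    · simpa [hg, Equiv.swap_apply_of_ne_of_ne ha hb] using hgx.apply_right
  have hpred := sameCycle_induction hwalk (y := f.symm a) SameCycle.rfl.symm_apply_right
    ⟨SameCycle.rfl, SameCycle.rfl⟩
  exact hcon (hpred.2.trans hlast)

theorem not_sameCycle_swap_mul_of_sameCycle (hne : a ≠ b) (hab : f.SameCycle a b) :
    ¬ (Equiv.swap a b * f).SameCycle a b := by
  classical
  have hex : ∃ n, (f ^ (n + 1)) a = b := by
    obtain ⟨n, hn⟩ := hab.exists_nat_pow_eq
    cases n with
    | zero => exact absurd (by simpa using hn) hne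
    | succ n => exact ⟨n, hn⟩
  let n := Nat.find hex
  have hn : (f ^ (n + 1)) a = b := Nat.find_spec hex
  have hmin : ∀ m < n, (f ^ (m + 1)) a ≠ b := fun m hm => Nat.find_min hex hm
  have hne_a : ∀ m, 0 < m → m ≤ n → (f ^ m) a ≠ a := by
    intro m hm hmn hma
    refine hmin (n - m) (by omega) ?_
    rw [← hn, show n + 1 = n - m + 1 + m by omega, pow_add f _ m, Equiv.Perm.mul_apply, hma]
  -- The `f`-walk from `a` to the predecessor of `b` is closed up by the swap.
  have hclosed : ∀ x, (∃ m ≤ n, x = (f ^ m) a) → ∃ m ≤ n, (Equiv.swap a b * f) x = (f ^ m) a := by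
    rintro x ⟨m, hm, rfl⟩
    rw [Equiv.Perm.mul_apply, ← Equiv.Perm.mul_apply f, ← pow_succ']
    rcases hm.lt_or_eq with hm | rfl
    · exact ⟨m + 1, hm,
        Equiv.swap_apply_of_ne_of_ne (hne_a _ (by omega) (by omega)) (hmin m hm)⟩
    · exact ⟨0, by omega, by simp [hn]⟩
  intro hcycle
  obtain ⟨m, hm, hb⟩ := sameCycle_induction hclosed hcycle ⟨0, by omega, by simp⟩
  cases m with
  | zero => exact hne (by simpa using hb.symm)
  | succ m => exact hmin m (by omega) hb.symm

theorem sameCycle_swap_mul_iff (hab : ¬ f.SameCycle a b) (x y : X) :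
    (Equiv.swap a b * f).SameCycle x y ↔ f.SameCycle x y ∨
      (f.SameCycle x a ∨ f.SameCycle x b) ∧ (f.SameCycle y a ∨ f.SameCycle y b) := by
  set g := Equiv.swap a b * f with hg
  have hab' : g.SameCycle a b := sameCycle_swap_mul_of_not_sameCycle hab
  have hcases : ∀ z, (f z = a ∨ f z = b) ∧ (g z = a ∨ g z = b) ∨ g z = f z := by
    intro z
    by_cases ha : f z = a
    · simp [hg, ha]
    by_cases hb : f z = b
    · simp [hg, hb]
    · simp [hg, Equiv.swap_apply_of_ne_of_ne ha hb]
  constructor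
  · refine fun h => sameCycle_induction (S := fun y => f.SameCycle x y ∨
      (f.SameCycle x a ∨ f.SameCycle x b) ∧ (f.SameCycle y a ∨ f.SameCycle y b)) (fun z hz => ?_) h
      (Or.inl SameCycle.rfl)
    rcases hcases z with ⟨hf, hgz⟩ | hgz
    · have hz' : f.SameCycle z a ∨ f.SameCycle z b :=
        hf.imp (fun h => (sameCycle_apply_self f z).trans (h.sameCycle f))
          fun h => (sameCycle_apply_self f z).trans (h.sameCycle f)
      exact Or.inr ⟨hz.elim (fun h => hz'.imp h.trans h.trans) And.left,
        hgz.imp (·.sameCycle f) (·.sameCycle f)⟩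
    · rw [hgz, sameCycle_apply_right, sameCycle_apply_left, sameCycle_apply_left]
      exact hz
  · have hsub : ∀ {u v}, f.SameCycle u v → g.SameCycle u v := by
      refine sameCycle_map id fun z => ?_
      rcases hcases z with ⟨hf, hgz⟩ | hgz
      · have hz := sameCycle_apply_self g z
        have hba := hab'.symm
        rcases hf with hf | hf <;> rcases hgz with hgz | hgz <;> rw [hgz] at hz <;>
          simp only [id, hf] <;> first | exact hz | exact hz.trans ‹_›
      · exact hgz ▸ sameCycle_apply_self g z
    have hsub' : ∀ {u}, f.SameCycle u a ∨ f.SameCycle u b → g.SameCycle u a :=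
      fun h => h.elim hsub fun h => (hsub h).trans hab'.symm
    rintro (h | ⟨hx, hy⟩)
    · exact hsub h
    · exact (hsub' hx).trans (hsub' hy).symm

end SameCycle

section NumOrbits

variable {X Y : Type} {f : Equiv.Perm X} {a b : X}

theorem numOrbits_eq_one (a : X) (ha : ∀ x, f.SameCycle x a) : numOrbits f = 1 := by
  have : Unique (Quotient (SameCycle.setoid f)) :=
    { default := Quotient.mk _ a
      uniq := by rintro ⟨x⟩; exact Quotient.sound (ha x) }
  exact Nat.card_unique

theorem numOrbits_one : numOrbits (1 : Equiv.Perm X) = Nat.card X :=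
  (Nat.card_eq_of_bijective (Quotient.mk (SameCycle.setoid 1))
    ⟨fun _ _ h => sameCycle_one.1 (Quotient.exact h), Quotient.mk_surjective⟩).symm

variable [Finite X]

theorem numOrbits_eq_of_retract [Finite Y] {g : Equiv.Perm Y} (i : Y → X) (r : X → Y)
    (hi : ∀ y, f.SameCycle (i y) (i (g y))) (hr : ∀ x, g.SameCycle (r x) (r (f x)))
    (hri : ∀ y, g.SameCycle (r (i y)) y) (hir : ∀ x, f.SameCycle (i (r x)) x) :
    numOrbits f = numOrbits g := by
  have hiff := sameCycle_iff_of_retract i r hi hr hir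
  refine Nat.card_eq_of_bijective
    (Quotient.map (sa := SameCycle.setoid f) (sb := SameCycle.setoid g) r
      fun x y => (hiff x y).1) ⟨?_, ?_⟩
  · rintro ⟨x⟩ ⟨y⟩ hxy
    exact Quotient.sound ((hiff x y).2 (Quotient.exact hxy))
  · rintro ⟨y⟩
    exact ⟨Quotient.mk (SameCycle.setoid f) (i y), Quotient.sound (hri y)⟩

variable [DecidableEq X]

theorem numOrbits_swap_mul_of_not_sameCycle (hab : ¬ f.SameCycle a b) :
    numOrbits (Equiv.swap a b * f) + 1 = numOrbits f := by
  classical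
  set g := Equiv.swap a b * f
  have hiff := sameCycle_swap_mul_iff hab
  let Q := Quotient (SameCycle.setoid f)
  let qa : Q := Quotient.mk (SameCycle.setoid f) a
  have hcard : Nat.card Q = Nat.card {c : Q // c ≠ qa} + 1 := by
    rw [← Finite.card_option, Nat.card_congr (Equiv.optionSubtypeNe qa)]
  -- The cycle of `a` joins that of `b`; the other ones do not change.
  have hbij : Nat.card {c : Q // c ≠ qa} = Nat.card (Quotient (SameCycle.setoid g)) := by
    refine Nat.card_eq_of_bijective (fun c => Quotient.map (sa := SameCycle.setoid f)
      (sb := SameCycle.setoid g) id (fun x y h => (hiff x y).2 (Or.inl h)) c.1) ⟨?_, ?_⟩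
    · rintro ⟨⟨x⟩, hx⟩ ⟨⟨y⟩, hy⟩ hxy
      have hxa : ¬ f.SameCycle x a := fun h => hx (Quotient.sound h)
      have hya : ¬ f.SameCycle y a := fun h => hy (Quotient.sound h)
      refine Subtype.ext (Quotient.sound ?_)
      rcases (hiff x y).1 (Quotient.exact hxy) with h | ⟨hxb, hyb⟩
      · exact h
      · exact (hxb.resolve_left hxa).trans (hyb.resolve_left hya).symm
    · rintro ⟨y⟩
      by_cases hy : f.SameCycle y a
      · refine ⟨⟨Quotient.mk (SameCycle.setoid f) b, fun h => hab ?_⟩, ?_⟩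
        · exact SameCycle.symm (Quotient.exact h)
        · exact Quotient.sound ((hiff _ _).2 (Or.inr ⟨Or.inr SameCycle.rfl, Or.inl hy⟩))
      · exact ⟨⟨Quotient.mk (SameCycle.setoid f) y, fun h => hy (Quotient.exact h)⟩, rfl⟩
  rw [numOrbits, numOrbits, ← hbij]
  exact hcard.symm

theorem numOrbits_swap_mul_of_sameCycle (hne : a ≠ b) (hab : f.SameCycle a b) :
    numOrbits (Equiv.swap a b * f) = numOrbits f + 1 := by
  have h := numOrbits_swap_mul_of_not_sameCycle (not_sameCycle_swap_mul_of_sameCycle hne hab)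
  rw [← mul_assoc, Equiv.swap_mul_self, one_mul] at h
  exact h.symm

end NumOrbits

end RotationSystem

/-! ## Noncrossing permutations -/

namespace RotationSystem

variable {X : Type*} {rk : X → ℕ} {π p : Equiv.Perm X} {I J : Set ℕ} {κ b : X}

/-- The elements whose rank lies in `I` form a union of cycles of `π`. -/
def PreservesRanks (rk : X → ℕ) (π : Equiv.Perm X) (I : Set ℕ) : Prop :=
  ∀ x, rk (π x) ∈ I ↔ rk x ∈ I

/-- The cycles of `π` are the blocks of a noncrossing partition (for the linear order given by the
injective rank `rk`), each of them run through in increasing order. -/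
def Noncrossing (rk : X → ℕ) (π : Equiv.Perm X) : Prop :=
  ∀ x, PreservesRanks rk π (Set.Ioo (rk x) (rk (π x))) ∧
    PreservesRanks rk π (Set.Icc (rk (π x)) (rk x))

/-- `p` is the cyclic predecessor for the linear order given by the rank `rk`, whose values are
`0, 1, …, |X| - 1`. -/
structure IsCyclicPred (rk : X → ℕ) (p : Equiv.Perm X) : Prop where
  inj : Function.Injective rk
  pred : ∀ x, rk x ≠ 0 → rk (p x) + 1 = rk x
  last : ∀ x, rk x = 0 → ∀ y, rk y ≤ rk (p x)

theorem PreservesRanks.sdiff (hI : PreservesRanks rk π I) (hJ : PreservesRanks rk π J) :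
    PreservesRanks rk π (I \ J) := fun x => by
  rw [Set.mem_sdiff, Set.mem_sdiff, hI x, hJ x]

theorem PreservesRanks.union (hI : PreservesRanks rk π I) (hJ : PreservesRanks rk π J) :
    PreservesRanks rk π (I ∪ J) := fun x => by
  rw [Set.mem_union, Set.mem_union, hI x, hJ x]

theorem Noncrossing.one : Noncrossing rk 1 := fun _ =>
  ⟨fun _ => Iff.rfl, fun _ => Iff.rfl⟩

theorem IsCyclicPred.sameCycle (hp : IsCyclicPred rk p) {x₀ : X} (h₀ : rk x₀ = 0) (x : X) :
    p.SameCycle x x₀ := by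
  induction hn : rk x generalizing x with
  | zero => rw [hp.inj (hn.trans h₀.symm)]
  | succ n ih =>
    have hpred := hp.pred x (by omega)
    exact (sameCycle_apply_self p x).trans (ih _ (by omega))

theorem swap_mul_apply_of_fixed [DecidableEq X]
    (hfix : ∀ x, rk κ ≤ rk x → π x = x) (hb : rk b < rk κ) :
    ∃ a, π a = b ∧ rk a < rk κ ∧ (Equiv.swap κ b * π) a = κ ∧ (Equiv.swap κ b * π) κ = b ∧
      ∀ x, x ≠ a → x ≠ κ → (Equiv.swap κ b * π) x = π x := by
  have hκ : π κ = κ := hfix κ le_rfl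
  obtain ⟨a, ha⟩ : ∃ a, π a = b := ⟨π.symm b, by simp⟩
  refine ⟨a, ha, ?_, by simp [ha], by simp [hκ], fun x hxa hxκ => ?_⟩
  · by_contra h
    rw [hfix a (by omega)] at ha
    rw [ha] at h
    omega
  · exact Equiv.swap_apply_of_ne_of_ne (fun h => hxκ (π.injective (h.trans hκ.symm)))
      fun h => hxa (π.injective (h.trans ha.symm))

theorem rank_apply_lt_of_fixed (hfix : ∀ x, rk κ ≤ rk x → π x = x) {x : X} (hx : rk x < rk κ) :
    rk (π x) < rk κ := by
  by_contra h
  rw [π.injective (hfix (π x) (by omega))] at h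
  omega

theorem sameCycle_mul_pred_of_preservesRanks (hp : IsCyclicPred rk p) (hπ : Noncrossing rk π)
    {x b : X} (hbx : rk b ≤ rk x) (hIco : PreservesRanks rk π (Set.Ico (rk b) (rk x))) :
    (π * p).SameCycle x b := by
  induction hn : rk x using Nat.strong_induction_on generalizing x with
  | _ n ih =>
    subst hn
    rcases hbx.eq_or_lt with hbx | hbx
    · rw [hp.inj hbx]
    · have hpred := hp.pred x (by omega)
      set y := p x
      have hπy : rk (π y) ∈ Set.Ico (rk b) (rk x) := (hIco y).2 ⟨by omega, by omega⟩
      have hIco' : PreservesRanks rk π (Set.Ico (rk b) (rk (π y))) := by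
        convert hIco.sdiff (hπ y).2 using 1
        ext n
        simp only [Set.mem_sdiff, Set.mem_Icc, Set.mem_Ico] at hπy ⊢
        omega
      exact (sameCycle_apply_self (π * p) x).trans (ih _ hπy.2 hπy.1 hIco' rfl)

section Finite

variable [Finite X]

theorem PreservesRanks.of_forall_imp (hI : ∀ x, rk x ∈ I → rk (π x) ∈ I) :
    PreservesRanks rk π I :=
  fun x => ⟨of_apply_of_forall_imp (S := fun x => rk x ∈ I) hI, hI x⟩

theorem PreservesRanks.mem_iff_of_sameCycle (hI : PreservesRanks rk π I) {x y : X}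
    (hxy : π.SameCycle x y) : rk x ∈ I ↔ rk y ∈ I :=
  sameCycle_induction (S := fun z => rk x ∈ I ↔ rk z ∈ I) (fun z hz => hz.trans (hI z).symm) hxy
    Iff.rfl

theorem preservesRanks_swap_mul_iff [DecidableEq X] (hκb : ¬ π.SameCycle κ b) :
    PreservesRanks rk (Equiv.swap κ b * π) I ↔ PreservesRanks rk π I ∧ (rk κ ∈ I ↔ rk b ∈ I) := by
  have hiff := sameCycle_swap_mul_iff hκb
  constructor
  · refine fun h => ⟨fun x => (h.mem_iff_of_sameCycle ?_).symm, h.mem_iff_of_sameCycle ?_⟩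
    · exact (hiff _ _).2 (Or.inl (sameCycle_apply_self π x))
    · exact sameCycle_swap_mul_of_not_sameCycle hκb
  · rintro ⟨h, hmem⟩ x
    have hκ_or_b : ∀ y, π.SameCycle y κ ∨ π.SameCycle y b → (rk y ∈ I ↔ rk κ ∈ I) := fun y hy =>
      hy.elim h.mem_iff_of_sameCycle fun hy => (h.mem_iff_of_sameCycle hy).trans hmem.symm
    rcases (hiff x _).1 (sameCycle_apply_self _ x) with hx | ⟨hx, hx'⟩
    · exact (h.mem_iff_of_sameCycle hx).symm
    · exact (hκ_or_b _ hx').trans (hκ_or_b _ hx).symm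

theorem preservesRanks_Icc_iff_Ico (hinj : Function.Injective rk) (hκ : π κ = κ)
    (hb : rk b ≤ rk κ) :
    PreservesRanks rk π (Set.Icc (rk b) (rk κ)) ↔ PreservesRanks rk π (Set.Ico (rk b) (rk κ)) := by
  have hsingleton : PreservesRanks rk π {rk κ} := by
    refine .of_forall_imp fun x hx => ?_
    rw [hinj hx, hκ]
    rfl
  constructor
  · intro h
    rw [← Set.Icc_sdiff_right]
    exact h.sdiff hsingleton
  · intro h
    rw [← Set.Ico_union_right hb]
    exact h.union hsingleton

theorem noncrossing_and_preservesRanks_of_swap_mul [DecidableEq X] (hinj : Function.Injective rk)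
    (hfix : ∀ x, rk κ ≤ rk x → π x = x) (hb : rk b < rk κ)
    (h : Noncrossing rk (Equiv.swap κ b * π)) :
    Noncrossing rk π ∧ PreservesRanks rk π (Set.Ico (rk b) (rk κ)) := by
  have hκ : π κ = κ := hfix κ le_rfl
  have hκb : ¬ π.SameCycle κ b := fun h => hb.ne (congrArg rk (h.eq_of_left hκ)).symm
  obtain ⟨a, ha, haκ, hga, hgκ, hg⟩ := swap_mul_apply_of_fixed hfix hb
  have hIco : PreservesRanks rk π (Set.Ico (rk b) (rk κ)) := by
    have h' := (h κ).2
    rw [hgκ, preservesRanks_swap_mul_iff hκb, preservesRanks_Icc_iff_Ico hinj hκ hb.le] at h'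
    exact h'.1
  have hba : rk b ≤ rk a := ((hIco a).1 (by rw [ha]; exact ⟨le_rfl, hb⟩)).1
  refine ⟨fun x => ?_, hIco⟩
  by_cases hxκ : x = κ
  · rw [hxκ, hκ, Set.Ioo_self, Set.Icc_self]
    refine ⟨fun _ => Iff.rfl, .of_forall_imp fun z hz => ?_⟩
    rw [hinj hz, hκ]
    rfl
  by_cases hxa : x = a
  · rw [hxa, ha, Set.Ioo_eq_empty (by omega)]
    refine ⟨fun _ => Iff.rfl, ?_⟩
    have h' := (h a).1
    rw [hga, preservesRanks_swap_mul_iff hκb] at h'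
    convert hIco.sdiff h'.1 using 1
    ext n
    simp only [Set.mem_sdiff, Set.mem_Icc, Set.mem_Ico, Set.mem_Ioo]
    omega
  · have h' := h x
    rw [hg x hxa hxκ, preservesRanks_swap_mul_iff hκb, preservesRanks_swap_mul_iff hκb] at h'
    exact ⟨h'.1.1, h'.2.1⟩

theorem Noncrossing.swap_mul [DecidableEq X] (hinj : Function.Injective rk)
    (hfix : ∀ x, rk κ ≤ rk x → π x = x) (hb : rk b < rk κ) (h : Noncrossing rk π)
    (hIco : PreservesRanks rk π (Set.Ico (rk b) (rk κ))) :
    Noncrossing rk (Equiv.swap κ b * π) := by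
  have hκ : π κ = κ := hfix κ le_rfl
  have hκb : ¬ π.SameCycle κ b := fun h => hb.ne (congrArg rk (h.eq_of_left hκ)).symm
  obtain ⟨a, ha, haκ, hga, hgκ, hg⟩ := swap_mul_apply_of_fixed hfix hb
  have hba : rk b ≤ rk a := ((hIco a).1 (by rw [ha]; exact ⟨le_rfl, hb⟩)).1
  intro x
  rw [preservesRanks_swap_mul_iff hκb, preservesRanks_swap_mul_iff hκb]
  by_cases hxκ : x = κ
  · rw [hxκ, hgκ, Set.Ioo_eq_empty (by omega), preservesRanks_Icc_iff_Ico hinj hκ hb.le]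
    refine ⟨⟨fun _ => Iff.rfl, Iff.rfl⟩, hIco, ?_⟩
    simp only [Set.mem_Icc]
    omega
  by_cases hxa : x = a
  · rw [hxa, hga, Set.Icc_eq_empty (by omega)]
    refine ⟨⟨?_, by simp only [Set.mem_Ioo]; omega⟩, fun _ => Iff.rfl, Iff.rfl⟩
    convert hIco.sdiff (h a).2 using 1
    ext n
    simp only [ha, Set.mem_sdiff, Set.mem_Icc, Set.mem_Ico, Set.mem_Ioo]
    omega
  · rw [hg x hxa hxκ]
    have hx := hIco x
    have hπx : rk (π x) ≠ rk b := fun h => hxa (π.injective ((hinj h).trans ha.symm))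
    have hxκ' : rk x ≠ rk κ := fun h => hxκ (hinj h)
    have hge : rk κ ≤ rk x → rk (π x) = rk x := fun hx => by rw [hfix x hx]
    have hlt : rk x < rk κ → rk (π x) < rk κ := rank_apply_lt_of_fixed hfix
    simp only [Set.mem_Ioo, Set.mem_Icc, Set.mem_Ico] at hx ⊢
    exact ⟨⟨(h x).1, by omega⟩, (h x).2, by omega⟩

-- Multiplication by the transposition inserts `κ` into the cycle of `b`, just before `b`.
theorem noncrossing_swap_mul_iff [DecidableEq X] (hinj : Function.Injective rk)
    (hfix : ∀ x, rk κ ≤ rk x → π x = x) (hb : rk b < rk κ) :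
    Noncrossing rk (Equiv.swap κ b * π) ↔
      Noncrossing rk π ∧ PreservesRanks rk π (Set.Ico (rk b) (rk κ)) :=
  ⟨noncrossing_and_preservesRanks_of_swap_mul hinj hfix hb,
    fun h => h.1.swap_mul hinj hfix hb h.2⟩

theorem preservesRanks_of_sameCycle_mul_pred (hp : IsCyclicPred rk p) (hπ : Noncrossing rk π)
    (hfix : ∀ x, rk κ ≤ rk x → π x = x) (h : (π * p).SameCycle κ b) :
    PreservesRanks rk π (Set.Ico (rk b) (rk κ)) := by
  -- The `π * p`-walk from `κ` visits only elements `x` for which `[x, κ)` is preserved.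
  refine sameCycle_induction (S := fun x => PreservesRanks rk π (Set.Ico (rk x) (rk κ)))
    (f := π * p) (fun x hx => ?_) h (by rw [Set.Ico_self]; exact fun _ => Iff.rfl)
  change PreservesRanks rk π (Set.Ico (rk (π (p x))) (rk κ))
  by_cases hκ : rk κ ≤ rk (p x)
  · rw [hfix _ hκ, Set.Ico_eq_empty (by omega)]
    exact fun _ => Iff.rfl
  · have hpred := hp.pred x fun h0 => hκ (hp.last x h0 κ)
    set y := p x
    have hlt : rk (π y) < rk κ := rank_apply_lt_of_fixed hfix (by omega)
    have hle : rk (π y) ≤ rk y := by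
      have hy := hx y
      simp only [Set.mem_Ico] at hy
      omega
    convert (hπ y).2.union hx using 1
    ext n
    simp only [Set.mem_union, Set.mem_Icc, Set.mem_Ico]
    omega

end Finite

section Genus

variable {X : Type} [Finite X] {rk : X → ℕ} {π p : Equiv.Perm X} {κ b : X}

-- The transposition joins two cycles of `π`, whereas it either cuts or joins cycles of `π * p`.
theorem numOrbits_add_swap_mul (hp : IsCyclicPred rk p) [DecidableEq X]
    (hfix : ∀ x, rk κ ≤ rk x → π x = x) (hb : rk b < rk κ)
    (hle : numOrbits π + numOrbits (π * p) ≤ Nat.card X + 1)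
    (heq : numOrbits π + numOrbits (π * p) = Nat.card X + 1 ↔ Noncrossing rk π) :
    numOrbits (Equiv.swap κ b * π) + numOrbits (Equiv.swap κ b * π * p) ≤ Nat.card X + 1 ∧
      (numOrbits (Equiv.swap κ b * π) + numOrbits (Equiv.swap κ b * π * p) = Nat.card X + 1 ↔
        Noncrossing rk (Equiv.swap κ b * π)) := by
  have hne : κ ≠ b := fun h => hb.ne (congrArg rk h).symm
  have hκb : ¬ π.SameCycle κ b := fun h => hne (h.eq_of_left (hfix κ le_rfl))
  have hcycles := numOrbits_swap_mul_of_not_sameCycle hκb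
  rw [noncrossing_swap_mul_iff hp.inj hfix hb, ← heq, mul_assoc]
  by_cases hface : (π * p).SameCycle κ b
  · have hcut := numOrbits_swap_mul_of_sameCycle hne hface
    refine ⟨by omega, fun h => ?_, fun h => by omega⟩
    have hmax : numOrbits π + numOrbits (π * p) = Nat.card X + 1 := by omega
    exact ⟨hmax, preservesRanks_of_sameCycle_mul_pred hp (heq.1 hmax) hfix hface⟩
  · have hjoin := numOrbits_swap_mul_of_not_sameCycle hface
    refine ⟨by omega, fun h => by omega, fun h => ?_⟩
    exact absurd (sameCycle_mul_pred_of_preservesRanks hp (heq.1 h.1) hb.le h.2) hface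

theorem numOrbits_add_numOrbits_mul_pred (hp : IsCyclicPred rk p) {x₀ : X} (h₀ : rk x₀ = 0)
    (k : ℕ) (π : Equiv.Perm X) (hπ : ∀ x, k ≤ rk x → π x = x) :
    numOrbits π + numOrbits (π * p) ≤ Nat.card X + 1 ∧
      (numOrbits π + numOrbits (π * p) = Nat.card X + 1 ↔ Noncrossing rk π) := by
  classical
  induction k generalizing π with
  | zero =>
    obtain rfl : π = 1 := Equiv.ext fun x => hπ x (Nat.zero_le _)
    rw [one_mul, numOrbits_one, numOrbits_eq_one x₀ (hp.sameCycle h₀)]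
    exact ⟨le_rfl, fun _ => .one, fun _ => rfl⟩
  | succ k ih =>
    by_cases hk : ∃ κ, rk κ = k ∧ π κ ≠ κ
    · obtain ⟨κ, rfl, hκ⟩ := hk
      have hb : rk (π κ) < rk κ := by
        have hne : rk (π κ) ≠ rk κ := fun h => hκ (hp.inj h)
        by_contra hlt
        exact hκ (π.injective (hπ (π κ) (by omega)))
      have hfix : ∀ x, rk κ ≤ rk x → (Equiv.swap κ (π κ) * π) x = x := by
        intro x hx
        by_cases hxκ : x = κ
        · simp [hxκ]
        · have hne : rk x ≠ rk κ := fun h => hxκ (hp.inj h)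
          rw [Equiv.Perm.mul_apply, hπ x (by omega)]
          exact Equiv.swap_apply_of_ne_of_ne hxκ fun h => by rw [h] at hx; omega
      have hstep := numOrbits_add_swap_mul hp hfix hb (ih _ hfix).1 (ih _ hfix).2
      rwa [← mul_assoc, Equiv.swap_mul_self, one_mul] at hstep
    · push Not at hk
      refine ih π fun x hx => ?_
      rcases hx.eq_or_lt with hx | hx
      · exact hk x hx.symm
      · exact hπ x hx

theorem numOrbits_add_eq_iff_noncrossing (hp : IsCyclicPred rk p) {x₀ : X} (h₀ : rk x₀ = 0) :
    numOrbits π + numOrbits (π * p) = Nat.card X + 1 ↔ Noncrossing rk π := by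
  obtain ⟨m, hm⟩ := (Set.finite_range rk).bddAbove
  refine (numOrbits_add_numOrbits_mul_pred hp h₀ (m + 1) π fun x hx => ?_).2
  have hx' := hm ⟨x, rfl⟩
  omega

end Genus

section Blocks

variable [Finite X]

theorem Noncrossing.apply_le_and_le_of_sameCycle (h : Noncrossing rk π) {x y : X}
    (hx : rk (π x) ≤ rk x) (hxy : π.SameCycle x y) : rk (π x) ≤ rk y ∧ rk y ≤ rk x :=
  ((h x).2.mem_iff_of_sameCycle hxy).1 ⟨hx, le_rfl⟩

theorem Noncrossing.not_between_of_sameCycle (h : Noncrossing rk π) {x y : X}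
    (hxy : π.SameCycle x y) : ¬ (rk x < rk y ∧ rk y < rk (π x)) :=
  fun hy => lt_irrefl _ (((h x).1.mem_iff_of_sameCycle hxy).2 hy).1

theorem Noncrossing.sameCycle_of_crossing (h : Noncrossing rk π) (hinj : Function.Injective rk)
    {a b c d : X} (hab : rk a < rk b) (hbc : rk b < rk c) (hcd : rk c < rk d)
    (hac : π.SameCycle a c) (hbd : π.SameCycle b d) : π.SameCycle a b := by
  by_contra hn
  -- In order to reach `c`, the cycle of `a` jumps over `b`, from some `x` to `π x`.
  obtain ⟨x, hax, hxb, hbx⟩ : ∃ x, π.SameCycle a x ∧ rk x < rk b ∧ rk b < rk (π x) := by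
    by_contra! hcon
    have hbelow := sameCycle_induction (S := fun x => π.SameCycle a x ∧ rk x < rk b) (fun x hx => by
      have hax : π.SameCycle a (π x) := hx.1.trans (sameCycle_apply_self _ _)
      exact ⟨hax, (hcon x hx.1 hx.2).lt_of_ne fun hxb => hn (hinj hxb ▸ hax)⟩) hac
      ⟨SameCycle.rfl, hab⟩
    omega
  have hd := ((h x).1.mem_iff_of_sameCycle hbd).1 ⟨hxb, hbx⟩
  exact h.not_between_of_sameCycle (hax.symm.trans hac) ⟨by omega, hcd.trans hd.2⟩

theorem Noncrossing.eq_of_sameCycle_iff (hinj : Function.Injective rk) {π' : Equiv.Perm X}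
    (h : Noncrossing rk π) (h' : Noncrossing rk π')
    (hs : ∀ x y, π.SameCycle x y ↔ π'.SameCycle x y) : π = π' := by
  refine Equiv.ext fun x => hinj ?_
  have hx' : π.SameCycle x (π' x) := (hs _ _).2 (sameCycle_apply_self π' x)
  have hx : π'.SameCycle x (π x) := (hs _ _).1 (sameCycle_apply_self π x)
  have hup := h.not_between_of_sameCycle hx'
  have hup' := h'.not_between_of_sameCycle hx
  rcases Nat.lt_or_ge (rk x) (rk (π x)) with hlt | hle
  · have hdown' : ¬ rk (π' x) ≤ rk x := fun hle' => by
      have := h'.apply_le_and_le_of_sameCycle hle' hx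
      omega
    omega
  · have hdown := h.apply_le_and_le_of_sameCycle hle hx'
    have hdown' := h'.apply_le_and_le_of_sameCycle hdown.2 hx
    omega

theorem Noncrossing.exists_last (h : Noncrossing rk π) (x : X) :
    ∃ y, π.SameCycle x y ∧ ∀ z, π.SameCycle x z → rk (π y) ≤ rk z ∧ rk z ≤ rk y := by
  obtain ⟨y, hy, hmax⟩ := Set.exists_max_image {z | π.SameCycle x z} rk (Set.toFinite _)
    ⟨x, SameCycle.rfl⟩
  exact ⟨y, hy, fun z hz => h.apply_le_and_le_of_sameCycle (hmax _ (SameCycle.apply_right hy))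
    (SameCycle.trans (SameCycle.symm hy) hz)⟩

variable {πQ : Equiv.Perm X} {Q : X → Prop}

theorem Noncrossing.of_eqOn (h : Noncrossing rk π) (hinj : Function.Injective rk)
    (hQ : ∀ x, Q x → πQ x = π x) (hnQ : ∀ x, ¬ Q x → πQ x = x) : Noncrossing rk πQ := by
  intro x
  by_cases hx : Q x
  · rw [hQ x hx]
    refine ⟨.of_forall_imp fun z hz => ?_, .of_forall_imp fun z hz => ?_⟩ <;> by_cases hzQ : Q z
    · rw [hQ z hzQ]; exact ((h x).1 z).2 hz
    · rwa [hnQ z hzQ]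
    · rw [hQ z hzQ]; exact ((h x).2 z).2 hz
    · rwa [hnQ z hzQ]
  · rw [hnQ x hx, Set.Ioo_self, Set.Icc_self]
    refine ⟨fun _ => Iff.rfl, .of_forall_imp fun z hz => ?_⟩
    rw [hinj hz, hnQ x hx]
    rfl

theorem Noncrossing.sameCycle_of_eqOn (hp : IsCyclicPred rk p) (h : Noncrossing rk π)
    (hQ : ∀ x, Q x → πQ x = π x) (hnQ : ∀ x, ¬ Q x → πQ x = x) (hπQ : ∀ x, Q x → Q (π x))
    {u v : X} (hu : ¬ Q u) (hv : ¬ Q v) (huv : π.SameCycle u v) : (πQ * p).SameCycle u v := by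
  wlog hlt : rk u < rk v generalizing u v with H
  · rcases Nat.lt_or_ge (rk v) (rk u) with hlt' | hle
    · exact (H hv hu huv.symm hlt').symm
    · rw [hp.inj (le_antisymm (not_lt.1 hlt) hle)]
  have hsucc : rk (p.symm u) = rk u + 1 := by
    by_cases h0 : rk (p.symm u) = 0
    · have := hp.last _ h0 v
      rw [Equiv.apply_symm_apply] at this
      omega
    · have := hp.pred _ h0
      rw [Equiv.apply_symm_apply] at this
      omega
  -- No cycle meets both the open interval `(u, v)` and its complement, except that of `u` and `v`.
  have hIco : PreservesRanks rk πQ (Set.Ico (rk (p.symm u)) (rk v)) := by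
    refine .of_forall_imp fun z hz => ?_
    by_cases hzQ : Q z
    · have hne_v : rk (π z) ≠ rk v := fun h => hv (hp.inj h ▸ hπQ z hzQ)
      have hup := (h z).1.mem_iff_of_sameCycle huv
      have hdown := (h z).2.mem_iff_of_sameCycle huv
      simp only [Set.mem_Ioo, Set.mem_Icc, Set.mem_Ico] at hup hdown hz ⊢
      rw [hQ z hzQ]
      omega
    · rwa [hnQ z hzQ]
  have hwalk := sameCycle_mul_pred_of_preservesRanks hp (h.of_eqOn hp.inj hQ hnQ) (by omega) hIco
  have hstep := sameCycle_apply_self (πQ * p) (p.symm u)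
  rw [Equiv.Perm.mul_apply, Equiv.apply_symm_apply, hnQ u hu] at hstep
  exact (hwalk.trans hstep).symm

end Blocks

end RotationSystem

/-! ## Addresses in plane trees -/

namespace PlaneTree

theorem exists_concat_prefix {α : Type*} {l m : List α} (h : l <+: m) (hne : m ≠ l) :
    ∃ i, l ++ [i] <+: m := by
  obtain ⟨r, rfl⟩ := h
  cases r with
  | nil => simp at hne
  | cons i r => exact ⟨i, r, by simp⟩

section Lex

variable {α : Type*} [LinearOrder α] {l m w : List α}

theorem append_strictMono (l : List α) : StrictMono (l ++ ·) := fun _ _ => List.append_left_lt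

theorem append_lt_append_iff (l : List α) {m n : List α} : l ++ m < l ++ n ↔ m < n :=
  (append_strictMono l).lt_iff_lt

theorem append_le_append_iff (l : List α) {m n : List α} : l ++ m ≤ l ++ n ↔ m ≤ n :=
  (append_strictMono l).le_iff_le

theorem lt_append_cons (l : List α) (i : α) (m : List α) : l < l ++ i :: m := by
  simpa using append_strictMono l (List.nil_lt_cons i m)

theorem lt_of_lt_of_not_prefix (h : l < w) (hw : ¬ l <+: w) (hm : l <+: m) : m < w := by
  obtain ⟨r, rfl⟩ := hm
  induction l generalizing w with
  | nil => exact absurd List.nil_prefix hw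
  | cons a l ih =>
    cases w with
    | nil => exact absurd h (List.not_lt_nil _)
    | cons b w =>
      rw [List.cons_lt_cons_iff] at h
      rw [List.cons_append, List.cons_lt_cons_iff]
      rcases h with hab | ⟨rfl, h⟩
      · exact Or.inl hab
      · exact Or.inr ⟨rfl, ih h (by simpa using hw)⟩

theorem le_of_prefix (h : l <+: m) : l ≤ m := by
  obtain ⟨r, rfl⟩ := h
  cases r with
  | nil => simp
  | cons i r => exact (lt_append_cons l i r).le

theorem prefix_of_le_of_le (hlw : l ≤ w) (hwm : w ≤ m) (hm : l <+: m) : l <+: w := by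
  rcases hlw.lt_or_eq with hlw | rfl
  · by_contra hw
    exact (lt_of_lt_of_not_prefix hlw hw hm).not_ge hwm
  · exact List.prefix_rfl

theorem lt_concat_of_prefix {i j : α} (hij : i < j) (h : l ++ [i] <+: m) : m < l ++ [j] := by
  obtain ⟨r, rfl⟩ := h
  rw [List.append_assoc, append_lt_append_iff]
  exact List.cons_lt_cons_iff.2 (Or.inl hij)

theorem concat_prefix_of_le_of_lt {l w : List ℕ} {i : ℕ} (hle : l ++ [i] ≤ w)
    (hlt : w < l ++ [i + 1]) : l ++ [i] <+: w := by
  obtain ⟨j, r, rfl⟩ : ∃ j, l ++ [j] <+: w :=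
    exists_concat_prefix
      (prefix_of_le_of_le ((lt_append_cons l i []).le.trans hle) hlt.le (List.prefix_append _ _))
      ((lt_append_cons l i []).trans_le hle).ne'
  rw [List.append_assoc, append_le_append_iff, ← not_lt, List.singleton_append,
    List.cons_lt_cons_iff] at hle
  rw [List.append_assoc, append_lt_append_iff, List.singleton_append, List.cons_lt_cons_iff] at hlt
  obtain rfl : i = j := by
    have hr : ¬ r < [] := List.not_lt_nil r
    simp only [hr, and_false, or_false] at hlt
    omega
  exact List.prefix_append _ _

end Lex

variable {α β : Type} {T : PlaneTree α} {l m : List ℕ}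

/-- The sub-tree at an address, if there is a node at that address. -/
def subtree? : PlaneTree α → List ℕ → Option (PlaneTree α)
  | t, [] => some t
  | node _ cs, i :: l => cs[i]?.bind fun t => subtree? t l

theorem subtree?_append (T : PlaneTree α) (l m : List ℕ) :
    T.subtree? (l ++ m) = (T.subtree? l).bind fun t => t.subtree? m := by
  induction l generalizing T with
  | nil => simp [subtree?]
  | cons i l ih =>
    obtain ⟨a, cs⟩ := T
    simp only [List.cons_append, subtree?, Option.bind_assoc, ih]

theorem mem_forestNodes {ts : List (PlaneTree α)} {i : ℕ} {x : List ℕ × α} :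
    x ∈ forestNodes i ts ↔ ∃ j t m, ts[j]? = some t ∧ (m, x.2) ∈ t.nodes ∧ x.1 = (i + j) :: m := by
  induction ts generalizing i with
  | nil => simp [forestNodes]
  | cons t ts ih =>
    rw [forestNodes, List.mem_append, ih]
    constructor
    · rintro (h | ⟨j, s, m, hs, hm, hx⟩)
      · obtain ⟨⟨m, a⟩, hz, rfl⟩ := List.mem_map.1 h
        exact ⟨0, t, m, by simp, hz, by simp⟩
      · exact ⟨j + 1, s, m, by simpa using hs, hm, by rw [hx]; congr 1; omega⟩
    · rintro ⟨_ | j, s, m, hs, hm, hx⟩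
      · obtain rfl : t = s := by simpa using hs
        exact Or.inl (List.mem_map.2 ⟨(m, x.2), hm, Prod.ext (by simp [hx]) rfl⟩)
      · exact Or.inr ⟨j, s, m, by simpa using hs, hm, by rw [hx]; congr 1; omega⟩

theorem mem_nodes_nil {a b : α} {cs : List (PlaneTree α)} :
    (([] : List ℕ), b) ∈ (node a cs).nodes ↔ b = a := by
  rw [nodes, List.mem_cons, mem_forestNodes]
  simp

theorem mem_nodes_cons {a b : α} {cs : List (PlaneTree α)} {i : ℕ} :
    (i :: l, b) ∈ (node a cs).nodes ↔ ∃ t, cs[i]? = some t ∧ (l, b) ∈ t.nodes := by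
  rw [nodes, List.mem_cons, mem_forestNodes]
  constructor
  · rintro (h | ⟨j, t, m, ht, hm, hl⟩)
    · simp at h
    · simp only [zero_add, List.cons.injEq] at hl
      obtain ⟨rfl, rfl⟩ := hl
      exact ⟨t, ht, hm⟩
  · rintro ⟨t, ht, hl⟩
    exact Or.inr ⟨i, t, l, ht, hl, by simp⟩

theorem mem_nodes_iff_subtree? {a : α} :
    (l, a) ∈ T.nodes ↔ ∃ cs, T.subtree? l = some (node a cs) := by
  induction l generalizing T with
  | nil =>
    obtain ⟨b, cs⟩ := T
    rw [mem_nodes_nil]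
    simp [subtree?, eq_comm]
  | cons i l ih =>
    obtain ⟨b, cs⟩ := T
    simp only [mem_nodes_cons, subtree?, Option.bind_eq_some_iff, ih]
    exact ⟨fun ⟨t, ht, cs', h⟩ => ⟨cs', t, ht, h⟩, fun ⟨cs', t, ht, h⟩ => ⟨t, ht, cs', h⟩⟩

/-- There is a node at the address `l`. -/
def Has (T : PlaneTree α) (l : List ℕ) : Prop := ∃ a, (l, a) ∈ T.nodes

theorem has_iff : T.Has l ↔ ∃ t, T.subtree? l = some t := by
  simp only [Has, mem_nodes_iff_subtree?]
  exact ⟨fun ⟨_, _, h⟩ => ⟨_, h⟩, fun ⟨⟨a, cs⟩, h⟩ => ⟨a, cs, h⟩⟩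

theorem has_nil (T : PlaneTree α) : T.Has [] := has_iff.2 ⟨T, by simp [subtree?]⟩

theorem Has.of_prefix (h : T.Has m) (hl : l <+: m) : T.Has l := by
  obtain ⟨r, rfl⟩ := hl
  obtain ⟨t, ht⟩ := has_iff.1 h
  rw [subtree?_append] at ht
  obtain ⟨s, hs, -⟩ := Option.bind_eq_some_iff.1 ht
  exact has_iff.2 ⟨s, hs⟩

theorem has_concat_iff {a : α} {cs : List (PlaneTree α)} (h : T.subtree? l = some (node a cs))
    {i : ℕ} : T.Has (l ++ [i]) ↔ i < cs.length := by
  simp [has_iff, subtree?_append, h, subtree?, ← Option.isSome_iff_exists]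

theorem exists_numChildren (T : PlaneTree α) (l : List ℕ) :
    ∃ k, ∀ i, T.Has (l ++ [i]) ↔ i < k := by
  rcases h : T.subtree? l with _ | ⟨a, cs⟩
  · exact ⟨0, by simp [has_iff, subtree?_append, h]⟩
  · exact ⟨cs.length, fun i => has_concat_iff h⟩

theorem Has.of_le {i j : ℕ} (h : T.Has (l ++ [j])) (hij : i ≤ j) : T.Has (l ++ [i]) := by
  obtain ⟨k, hk⟩ := T.exists_numChildren l
  rw [hk] at h ⊢
  omega

theorem Has.exists_last_child {j : ℕ} (h : T.Has (l ++ [j])) :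
    ∃ i, T.Has (l ++ [i]) ∧ ¬ T.Has (l ++ [i + 1]) := by
  obtain ⟨k, hk⟩ := T.exists_numChildren l
  refine ⟨k - 1, ?_⟩
  simp only [hk] at h ⊢
  omega

theorem nodup_nodes (T : PlaneTree α) : T.nodes.Nodup :=
  T.pairwise_nodes.imp fun h heq => h.ne (congrArg Prod.fst heq)

theorem eq_of_mem_nodes {a b : α} (ha : (l, a) ∈ T.nodes) (hb : (l, b) ∈ T.nodes) : a = b := by
  obtain ⟨cs, ha⟩ := mem_nodes_iff_subtree?.1 ha
  obtain ⟨cs', hb⟩ := mem_nodes_iff_subtree?.1 hb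
  rw [ha, Option.some.injEq, node.injEq] at hb
  exact hb.1

theorem has_map {f : α → β} : (T.map f).Has l ↔ T.Has l := by
  simp only [Has, nodes_map, List.mem_map, Prod.mk.injEq, Prod.exists]
  exact ⟨fun ⟨_, _, a, h, hl, _⟩ => ⟨a, hl ▸ h⟩, fun ⟨a, h⟩ => ⟨f a, l, a, h, rfl, rfl⟩⟩

mutual
theorem length_lt_length_nodes : ∀ (T : PlaneTree α), ∀ x ∈ T.nodes, x.1.length < T.nodes.length
  | node a cs => by
    intro x hx
    rw [nodes, List.mem_cons] at hx
    rw [nodes, List.length_cons]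
    rcases hx with rfl | hx
    · simp
    · exact Nat.lt_succ_of_le (length_le_length_forestNodes cs 0 x hx)
theorem length_le_length_forestNodes : ∀ (ts : List (PlaneTree α)) (i : ℕ),
    ∀ x ∈ forestNodes i ts, x.1.length ≤ (forestNodes i ts).length
  | [], _ => by simp [forestNodes]
  | t :: ts, i => by
    intro x hx
    rw [forestNodes, List.mem_append] at hx
    rw [forestNodes, List.length_append, List.length_map]
    rcases hx with hx | hx
    · obtain ⟨y, hy, rfl⟩ := List.mem_map.1 hx
      exact Nat.le_add_right_of_le (length_lt_length_nodes t y hy)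
    · exact Nat.le_add_left_of_le (length_le_length_forestNodes ts (i + 1) x hx)
end

end PlaneTree

/-! ## The rotation of a tree with plugs -/

namespace PlaneTree

section FormPerm

variable {ι α : Type*} [DecidableEq α]

theorem prod_map_formPerm_apply_of_notMem (F : ι → List α) (L : List ι) {x : α}
    (hx : ∀ i ∈ L, x ∉ F i) : (L.map fun i => (F i).formPerm).prod x = x := by
  induction L with
  | nil => simp
  | cons i L ih =>
    rw [List.map_cons, List.prod_cons, Equiv.Perm.mul_apply,
      ih fun j hj => hx j (List.mem_cons_of_mem _ hj),
      List.formPerm_apply_of_notMem (hx i List.mem_cons_self)]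

theorem prod_map_formPerm_apply_of_mem (F : ι → List α) (L : List ι) (hL : L.Nodup)
    (hF : ∀ i j x, x ∈ F i → x ∈ F j → i = j) {i : ι} (hi : i ∈ L) {x : α} (hx : x ∈ F i) :
    (L.map fun i => (F i).formPerm).prod x = (F i).formPerm x := by
  induction L with
  | nil => simp at hi
  | cons j L ih =>
    rw [List.nodup_cons] at hL
    rw [List.map_cons, List.prod_cons, Equiv.Perm.mul_apply]
    rcases List.mem_cons.1 hi with rfl | hi
    · rw [prod_map_formPerm_apply_of_notMem F L]
      exact fun k hk hxk => hL.1 (hF k i x hxk hx ▸ hk)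
    · rw [ih hL.2 hi, List.formPerm_apply_of_notMem]
      exact fun h => hL.1 (hF _ _ _ h (List.formPerm_apply_mem_of_mem hx) ▸ hi)

theorem formPerm_apply_of_append {A B : List α} {a b : α} (h : (A ++ a :: b :: B).Nodup) :
    (A ++ a :: b :: B).formPerm a = b := by
  simpa using List.formPerm_apply_lt_getElem _ h A.length (by simp)

end FormPerm

variable {T : PlaneTree ℕ} {l : List ℕ} {i : ℕ} {u : T.Node} {v w : T.Edge}

theorem Node.ext {u v : T.Node} (h : u.1.1 = v.1.1) : u = v :=
  Subtype.ext (Prod.ext h (eq_of_mem_nodes u.2 (h ▸ v.2)))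

theorem Node.has (u : T.Node) : T.Has u.1.1 := ⟨u.1.2, u.2⟩

theorem mem_nonRootNodes {x : List ℕ × ℕ} : x ∈ T.nonRootNodes ↔ x ∈ T.nodes ∧ x.1 ≠ [] := by
  simp [nonRootNodes]

theorem nodup_nonRootNodes : T.nonRootNodes.Nodup := T.nodup_nodes.filter _

/-- The lower end of an edge. -/
def Edge.toNode (v : T.Edge) : T.Node := ⟨v.1, (mem_nonRootNodes.1 v.2).1⟩

@[simp] theorem Edge.toNode_val (v : T.Edge) : v.toNode.1 = v.1 := rfl

theorem Edge.has (v : T.Edge) : T.Has v.1.1 := v.toNode.has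

theorem Edge.ne_nil (v : T.Edge) : v.1.1 ≠ [] := (mem_nonRootNodes.1 v.2).2

theorem Edge.ext (h : v.1.1 = w.1.1) : v = w :=
  Subtype.ext (congrArg (fun u : T.Node => u.1) (Node.ext (u := v.toNode) (v := w.toNode) h))

theorem Has.exists_node (h : T.Has l) : ∃ u : T.Node, u.1.1 = l := by
  obtain ⟨a, ha⟩ := h
  exact ⟨⟨(l, a), ha⟩, rfl⟩

theorem Has.exists_edge (h : T.Has l) (hl : l ≠ []) : ∃ v : T.Edge, v.1.1 = l := by
  obtain ⟨a, ha⟩ := h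
  exact ⟨⟨(l, a), mem_nonRootNodes.2 ⟨ha, hl⟩⟩, rfl⟩

theorem Has.exists_child (h : T.Has (l ++ [i])) : ∃ v : T.Edge, v.1.1 = l ++ [i] :=
  h.exists_edge (by simp)

theorem Node.eq_root_or_edge (u : T.Node) : u.1.1 = [] ∨ ∃ v : T.Edge, v.toNode = u :=
  or_iff_not_imp_left.2 fun h => ⟨⟨u.1, mem_nonRootNodes.2 ⟨u.2, h⟩⟩, rfl⟩

/-- The upper end of an edge. -/
noncomputable def Edge.parent (v : T.Edge) : T.Node :=
  (v.has.of_prefix (List.dropLast_prefix _)).exists_node.choose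

theorem Edge.parent_addr (v : T.Edge) : v.parent.1.1 = v.1.1.dropLast :=
  (v.has.of_prefix (List.dropLast_prefix _)).exists_node.choose_spec

theorem Edge.exists_eq_concat (v : T.Edge) : ∃ i, v.1.1 = v.parent.1.1 ++ [i] :=
  ⟨v.1.1.getLast v.ne_nil, by rw [v.parent_addr, List.dropLast_append_getLast]⟩

/-- The node to which a half-edge is attached. -/
noncomputable def owner (x : T.HalfEdge) : T.Node := if x.2 then x.1.parent else x.1.toNode

@[simp] theorem owner_false (v : T.Edge) : owner (v, false) = v.toNode := rfl

@[simp] theorem owner_true (v : T.Edge) : owner (v, true) = v.parent := rfl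

/-- The node to which a half-edge or a plug is attached. -/
noncomputable def dartOwner : T.Dart → T.Node := Sum.elim owner id

theorem mem_childEdges : v ∈ T.childEdges l ↔ v.1.1.dropLast = l := by
  simp [childEdges]

theorem pairwise_childEdges (l : List ℕ) :
    (T.childEdges l).Pairwise (fun v w => v.1.1 < w.1.1) := by
  refine List.Pairwise.filter _ ?_
  have h : T.nonRootNodes.Pairwise (fun x y => x.1 < y.1) := T.pairwise_nodes.filter _
  rwa [← List.attach_map_subtype_val T.nonRootNodes, List.pairwise_map] at h

theorem map_addr_childEdges {k : ℕ} (hk : ∀ i, T.Has (l ++ [i]) ↔ i < k) :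
    (T.childEdges l).map (fun v => v.1.1) = (List.range k).map (fun i => l ++ [i]) := by
  refine List.Pairwise.eq_of_mem_iff (r := (· < ·)) ?_ ?_ fun m => ?_
  · exact List.pairwise_map.2 (T.pairwise_childEdges l)
  · refine List.pairwise_map.2 (List.pairwise_lt_range.imp fun h => ?_)
    exact (append_lt_append_iff l).2 (List.cons_lt_cons_iff.2 (Or.inl h))
  · simp only [List.mem_map, mem_childEdges, List.mem_range, ← hk]
    constructor
    · rintro ⟨v, rfl, rfl⟩
      have hv := List.dropLast_append_getLast v.ne_nil
      exact ⟨v.1.1.getLast v.ne_nil, hv.symm ▸ v.has, hv⟩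
    · rintro ⟨i, hi, rfl⟩
      obtain ⟨v, hv⟩ := hi.exists_child
      exact ⟨v, by rw [hv, List.dropLast_concat], hv⟩

theorem getElem?_childEdges_eq_some_iff : (T.childEdges l)[i]? = some v ↔ v.1.1 = l ++ [i] := by
  obtain ⟨k, hk⟩ := T.exists_numChildren l
  have haddr : ((T.childEdges l)[i]?.map fun v => v.1.1) =
      if i < k then some (l ++ [i]) else none := by
    rw [← List.getElem?_map, map_addr_childEdges hk]
    split_ifs with hi <;> simp [hi]
  constructor
  · intro h
    simp only [h, Option.map_some] at haddr
    split_ifs at haddr with hi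
    exact Option.some.inj haddr
  · intro h
    rw [if_pos ((hk i).1 (h ▸ v.has)), Option.map_eq_some_iff] at haddr
    obtain ⟨w, hw, hwi⟩ := haddr
    rw [hw, Edge.ext (hwi.trans h.symm)]

theorem getElem?_childEdges_eq_none (hi : ¬ T.Has (l ++ [i])) : (T.childEdges l)[i]? = none :=
  Option.eq_none_iff_forall_ne_some.2 fun v hv =>
    hi (getElem?_childEdges_eq_some_iff.1 hv ▸ v.has)

theorem getLast?_childEdges (hw : w.1.1 = l ++ [i]) (hi : ¬ T.Has (l ++ [i + 1])) :
    (T.childEdges l).getLast? = some w := by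
  have hlt := List.getElem?_eq_some_iff.1 (getElem?_childEdges_eq_some_iff.2 hw)
  have hle := List.getElem?_eq_none_iff.1 (getElem?_childEdges_eq_none hi)
  have hlast : (T.childEdges l).length - 1 = i := by
    have := hlt.1
    omega
  rw [List.getLast?_eq_getElem?, hlast, getElem?_childEdges_eq_some_iff.2 hw]

theorem around_root (hu : u.1.1 = []) :
    T.around u = Sum.inr u :: (T.childEdges []).reverse.map (fun v => Sum.inl (v, true)) := by
  rw [around, dif_neg fun h => (mem_nonRootNodes.1 h).2 hu, hu, List.nil_append]

theorem around_edge (v : T.Edge) :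
    T.around v.toNode = Sum.inr v.toNode :: Sum.inl (v, false) ::
      (T.childEdges v.1.1).reverse.map (fun w => Sum.inl (w, true)) := by
  rw [around, dif_pos (show v.toNode.1 ∈ T.nonRootNodes from v.2)]
  rfl

theorem exists_around_eq (u : T.Node) : ∃ A, T.around u =
    Sum.inr u :: A ++ (T.childEdges u.1.1).reverse.map (fun v => Sum.inl (v, true)) := ⟨_, rfl⟩

theorem mem_around {d : T.Dart} : d ∈ T.around u ↔ dartOwner d = u := by
  rcases d with ⟨v, _ | _⟩ | w
  · suffices (∃ h : u.1 ∈ T.nonRootNodes, v = ⟨u.1, h⟩) ↔ v.toNode = u by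
      simpa [around, dartOwner, apply_dite (Sum.inl (v, false) ∈ ·)] using this
    constructor
    · rintro ⟨h, rfl⟩
      rfl
    · rintro rfl
      exact ⟨v.2, rfl⟩
  · have hparent : v.parent = u ↔ v.1.1.dropLast = u.1.1 := by
      rw [← v.parent_addr]
      exact ⟨fun h => h ▸ rfl, Node.ext⟩
    simp [around, dartOwner, mem_childEdges, hparent]
  · simp [around, dartOwner]

theorem nodup_around (u : T.Node) : (T.around u).Nodup := by
  have hchild : (T.childEdges u.1.1).Nodup :=
    (T.pairwise_childEdges _).imp fun h heq => h.ne (congrArg (fun v : T.Edge => v.1.1) heq)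
  have hmap : ((T.childEdges u.1.1).map fun v => (Sum.inl (v, true) : T.Dart)).Nodup :=
    hchild.map fun v w h => by simpa using h
  rw [around]
  split_ifs <;> simp [hmap]

theorem initialRotation_apply {d : T.Dart} (h : d ∈ T.around u) :
    T.initialRotation d = (T.around u).formPerm d :=
  prod_map_formPerm_apply_of_mem T.around _ (List.nodup_attach.2 T.nodup_nodes)
    (fun _ _ _ hi hj => (mem_around.1 hi).symm.trans (mem_around.1 hj)) (List.mem_attach _ _) h

theorem dartOwner_initialRotation (d : T.Dart) : dartOwner (T.initialRotation d) = dartOwner d := by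
  have hd := mem_around.2 (rfl : dartOwner d = dartOwner d)
  rw [initialRotation_apply hd]
  exact mem_around.1 (List.formPerm_apply_mem_of_mem hd)

theorem initialRotation_of_around_eq_append {A B : List T.Dart} {a b : T.Dart}
    (h : T.around u = A ++ a :: b :: B) : T.initialRotation a = b := by
  rw [initialRotation_apply (u := u) (by rw [h]; simp), h]
  exact formPerm_apply_of_append (h ▸ nodup_around u)

theorem initialRotation_of_around_eq_concat {A : List T.Dart} {a : T.Dart}
    (h : T.around u = Sum.inr u :: A ++ [a]) : T.initialRotation a = Sum.inr u := by
  rw [initialRotation_apply (u := u) (by rw [h]; simp), h]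
  simp

theorem initialRotation_plug (v : T.Edge) :
    T.initialRotation (Sum.inr v.toNode) = Sum.inl (v, false) :=
  initialRotation_of_around_eq_append (A := []) (around_edge v)

theorem initialRotation_plug_root (hu : u.1.1 = []) (hw : w.1.1 = [i]) (hi : ¬ T.Has [i + 1]) :
    T.initialRotation (Sum.inr u) = Sum.inl (w, true) := by
  obtain ⟨B, hB⟩ := List.getLast?_eq_some_iff.1 (getLast?_childEdges (l := []) hw hi)
  have h := around_root hu
  rw [hB, List.reverse_append] at h
  exact initialRotation_of_around_eq_append (A := []) h

theorem initialRotation_down (hw : w.1.1 = v.1.1 ++ [i]) (hi : ¬ T.Has (v.1.1 ++ [i + 1])) :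
    T.initialRotation (Sum.inl (v, false)) = Sum.inl (w, true) := by
  obtain ⟨B, hB⟩ := List.getLast?_eq_some_iff.1 (getLast?_childEdges hw hi)
  have h := around_edge v
  rw [hB, List.reverse_append] at h
  exact initialRotation_of_around_eq_append (A := [_]) h

theorem initialRotation_leaf (hv : ¬ T.Has (v.1.1 ++ [0])) :
    T.initialRotation (Sum.inl (v, false)) = Sum.inr v.toNode := by
  have h := around_edge v
  have hnil : T.childEdges v.1.1 = [] := by
    simpa using List.getElem?_eq_none_iff.1 (getElem?_childEdges_eq_none hv)
  rw [hnil] at h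
  exact initialRotation_of_around_eq_concat (A := []) h

theorem initialRotation_left (hv : v.1.1 = l ++ [i + 1]) (hw : w.1.1 = l ++ [i]) :
    T.initialRotation (Sum.inl (v, true)) = Sum.inl (w, true) := by
  obtain ⟨u, rfl⟩ := (v.has.of_prefix ⟨[i + 1], hv.symm⟩).exists_node
  obtain ⟨A, hA⟩ := exists_around_eq u
  obtain ⟨hi, hwi⟩ := List.getElem?_eq_some_iff.1 (getElem?_childEdges_eq_some_iff.2 hw)
  obtain ⟨hi', hvi⟩ := List.getElem?_eq_some_iff.1 (getElem?_childEdges_eq_some_iff.2 hv)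
  have hsplit := List.take_append_drop i (T.childEdges u.1.1)
  rw [List.drop_eq_getElem_cons hi, List.drop_eq_getElem_cons hi', hwi, hvi] at hsplit
  rw [← hsplit] at hA
  simp only [List.reverse_append, List.reverse_cons, List.map_append, List.append_assoc,
    List.map_cons, List.map_nil, List.singleton_append] at hA
  rw [← List.append_assoc] at hA
  exact initialRotation_of_around_eq_append hA

theorem initialRotation_up (hv : v.1.1 = u.1.1 ++ [0]) :
    T.initialRotation (Sum.inl (v, true)) = Sum.inr u := by
  obtain ⟨A, hA⟩ := exists_around_eq u
  have hhead := getElem?_childEdges_eq_some_iff.2 hv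
  rw [← List.head?_eq_getElem?, List.head?_eq_some_iff] at hhead
  obtain ⟨B, hB⟩ := hhead
  rw [hB, List.reverse_cons, List.map_append, ← List.append_assoc] at hA
  exact initialRotation_of_around_eq_concat hA

end PlaneTree

/-! ## Gluing the nodes of a tree along a permutation -/

namespace RotationSystem

/-- The cyclic predecessor for the order of an enumeration. -/
def cyclicPred {X : Type*} {n : ℕ} (e : Fin n ≃ X) : Equiv.Perm X :=
  e.symm.trans ((finRotate n).symm.trans e)

theorem isCyclicPred_cyclicPred {X : Type} {n : ℕ} (e : Fin n ≃ X) :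
    IsCyclicPred (fun x => (e.symm x).val) (cyclicPred e) := by
  cases n with
  | zero => exact ⟨fun x => (e.symm x).elim0, fun x => (e.symm x).elim0, fun x => (e.symm x).elim0⟩
  | succ m =>
    have hrotate : ∀ x, (e.symm x).val = if e.symm (cyclicPred e x) = Fin.last m then 0
        else (e.symm (cyclicPred e x)).val + 1 := fun x => by
      rw [← coe_finRotate]
      simp [cyclicPred]
    refine ⟨fun x y h => e.symm.injective (Fin.ext h), fun x hx => ?_, fun x hx y => ?_⟩
    · have hx' := hrotate x
      split_ifs at hx' with hlast
      · exact absurd hx' hx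
      · exact hx'.symm
    · have hx' := hrotate x
      split_ifs at hx' with hlast
      · simpa only [hlast, Fin.val_last] using (e.symm y).is_le
      · exact absurd (hx'.symm.trans hx) (Nat.succ_ne_zero _)

theorem sameCycle_of_sumCongr_one {X Y : Type*} [Finite X] [Finite Y] {f : Equiv.Perm X} {x y : X}
    (h : (Equiv.Perm.sumCongr f (1 : Equiv.Perm Y)).SameCycle (Sum.inl x) (Sum.inl y)) :
    f.SameCycle x y := by
  refine sameCycle_induction (S := fun d => Sum.elim (f.SameCycle x) (fun _ => False) d) ?_ h
    SameCycle.rfl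
  rintro (z | z) hz
  · exact SameCycle.trans hz (sameCycle_apply_self f z)
  · exact hz

end RotationSystem

open RotationSystem

namespace PlaneTree

variable {T : PlaneTree ℕ} {u z : T.Node} {v : T.Edge}

/-- The position of a node in prefix order. -/
def rank (u : T.Node) : ℕ := ((T.nodup_nodes.getEquiv).symm u).val

/-- The node before a given one in prefix order, cyclically. -/
def prevNode (T : PlaneTree ℕ) : Equiv.Perm T.Node := cyclicPred T.nodup_nodes.getEquiv

theorem isCyclicPred_prevNode : IsCyclicPred (rank (T := T)) T.prevNode :=
  isCyclicPred_cyclicPred _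

theorem rank_injective : Function.Injective (rank (T := T)) := isCyclicPred_prevNode.inj

theorem addr_lt_of_rank_lt (h : rank u < rank z) : u.1.1 < z.1.1 := by
  have hlt := List.pairwise_iff_getElem.1 T.pairwise_nodes _ _ (Fin.is_lt _) (Fin.is_lt _) h
  have hget : ∀ w : T.Node, T.nodes[((T.nodup_nodes.getEquiv).symm w).val] = w.1 := fun w =>
    congrArg Subtype.val (T.nodup_nodes.getEquiv.apply_symm_apply w)
  rwa [hget, hget] at hlt

theorem rank_lt_iff : rank u < rank z ↔ u.1.1 < z.1.1 := by
  refine ⟨addr_lt_of_rank_lt, fun h => ?_⟩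
  by_contra hrank
  rcases (not_lt.1 hrank).lt_or_eq with hlt | heq
  · exact lt_asymm h (addr_lt_of_rank_lt hlt)
  · exact h.ne (by rw [rank_injective heq])

theorem rank_le_iff : rank u ≤ rank z ↔ u.1.1 ≤ z.1.1 := by
  rw [← not_lt, ← not_lt, rank_lt_iff]

theorem prevNode_eq (h : z.1.1 < u.1.1) (hz : ∀ w : T.Node, w.1.1 < u.1.1 → w.1.1 ≤ z.1.1) :
    T.prevNode u = z := by
  simp only [← rank_lt_iff, ← rank_le_iff] at h hz
  have hpred := isCyclicPred_prevNode.pred u (by omega)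
  have hle := hz (T.prevNode u) (by omega)
  exact rank_injective (by omega)

theorem rank_root (hu : u.1.1 = []) : rank u = 0 := by
  by_contra h
  have hpred := isCyclicPred_prevNode.pred u h
  have hlt : rank (T.prevNode u) < rank u := by omega
  rw [rank_lt_iff, hu] at hlt
  simp at hlt

theorem prevNode_root (hu : u.1.1 = []) (hz : ∀ w : T.Node, w.1.1 ≤ z.1.1) :
    T.prevNode u = z :=
  Node.ext (le_antisymm (hz _)
    (rank_le_iff.1 (isCyclicPred_prevNode.last u (rank_root hu) z)))

/-- `z` is the last node, in prefix order, of the sub-tree at the address `l`. -/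
def IsLastBelow (l : List ℕ) (z : T.Node) : Prop :=
  l <+: z.1.1 ∧ ∀ w : T.Node, l <+: w.1.1 → w.1.1 ≤ z.1.1

theorem Has.exists_isLastBelow {l : List ℕ} (h : T.Has l) : ∃ z : T.Node, IsLastBelow l z := by
  obtain ⟨u, hu⟩ := h.exists_node
  obtain ⟨z, hz, hmax⟩ := Set.exists_max_image {w : T.Node | l <+: w.1.1} rank (Set.toFinite _)
    ⟨u, by change l <+: u.1.1; rw [hu]⟩
  exact ⟨z, hz, fun w hw => rank_le_iff.1 (hmax w hw)⟩

theorem IsLastBelow.eq {l : List ℕ} {z z' : T.Node} (h : IsLastBelow l z)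
    (h' : IsLastBelow l z') : z = z' :=
  Node.ext (le_antisymm (h'.2 z h.1) (h.2 z' h'.1))

theorem IsLastBelow.of_last_child {l : List ℕ} (h : IsLastBelow l z) {i : ℕ}
    (hi : T.Has (l ++ [i])) (hi' : ¬ T.Has (l ++ [i + 1])) : IsLastBelow (l ++ [i]) z := by
  refine ⟨?_, fun w hw => h.2 w ((List.prefix_append _ _).trans hw)⟩
  obtain ⟨c, hc⟩ := hi.exists_node
  have hcz : l ++ [i] ≤ z.1.1 := hc ▸ h.2 c (by rw [hc]; exact List.prefix_append _ _)
  have hne : z.1.1 ≠ l := by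
    intro heq
    exact absurd (heq ▸ hcz) (not_le.2 (lt_append_cons l i []))
  obtain ⟨j, hj⟩ := exists_concat_prefix h.1 hne
  have hj' : T.Has (l ++ [j]) := z.has.of_prefix hj
  rcases lt_trichotomy i j with hij | rfl | hij
  · exact absurd (hj'.of_le hij) hi'
  · exact hj
  · exact absurd (lt_concat_of_prefix hij hj) (not_lt.2 hcz)

theorem IsLastBelow.eq_of_leaf (h : IsLastBelow u.1.1 z) (hu : ¬ T.Has (u.1.1 ++ [0])) :
    z = u := by
  by_contra hne
  obtain ⟨j, hj⟩ := exists_concat_prefix h.1 fun h' => hne (Node.ext h')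
  exact hu ((z.has.of_prefix hj).of_le (Nat.zero_le j))

/-- The last node, in prefix order, of the sub-tree under an edge. -/
noncomputable def Edge.lastNode (v : T.Edge) : T.Node := v.has.exists_isLastBelow.choose

theorem Edge.isLastBelow_lastNode (v : T.Edge) : IsLastBelow v.1.1 v.lastNode :=
  v.has.exists_isLastBelow.choose_spec

theorem lastNode_of_last_child {w : T.Edge} {i : ℕ} (hw : w.1.1 = v.1.1 ++ [i])
    (hi : ¬ T.Has (v.1.1 ++ [i + 1])) : w.lastNode = v.lastNode :=
  w.isLastBelow_lastNode.eq
    (hw ▸ v.isLastBelow_lastNode.of_last_child (hw ▸ w.has) hi)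

theorem lastNode_of_leaf (hv : ¬ T.Has (v.1.1 ++ [0])) : v.lastNode = v.toNode :=
  v.isLastBelow_lastNode.eq_of_leaf (u := v.toNode) hv

theorem prevNode_root_eq_lastNode (hu : u.1.1 = []) {i : ℕ} (hv : v.1.1 = [i])
    (hi : ¬ T.Has [i + 1]) : T.prevNode u = v.lastNode := by
  obtain ⟨z, hz⟩ := T.has_nil.exists_isLastBelow
  rw [prevNode_root hu fun w => hz.2 w List.nil_prefix]
  have hz' : IsLastBelow [i] z := hz.of_last_child (hv ▸ v.has) hi
  exact IsLastBelow.eq (hv ▸ hz') v.isLastBelow_lastNode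

theorem prevNode_of_leftmost {p : T.Node} (h : u.1.1 = p.1.1 ++ [0]) : T.prevNode u = p := by
  refine prevNode_eq (by rw [h]; exact lt_append_cons _ _ _) fun w hw => ?_
  by_contra! hpw
  have hprefix : p.1.1 <+: w.1.1 :=
    prefix_of_le_of_le hpw.le hw.le (by rw [h]; exact List.prefix_append _ _)
  obtain ⟨j, r, hj⟩ := exists_concat_prefix hprefix hpw.ne'
  rw [h, ← hj, List.append_assoc, append_lt_append_iff] at hw
  simp [List.cons_lt_cons_iff] at hw

theorem prevNode_of_sibling {l : List ℕ} {i : ℕ} (h : u.1.1 = l ++ [i + 1])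
    (hv : v.1.1 = l ++ [i]) : T.prevNode u = v.lastNode := by
  have hz := v.isLastBelow_lastNode
  rw [hv] at hz
  refine prevNode_eq (by rw [h]; exact lt_concat_of_prefix (Nat.lt_succ_self i) hz.1)
    fun w hw => ?_
  by_contra! hlt
  rw [h] at hw
  have hprefix := concat_prefix_of_le_of_lt ((le_of_prefix hz.1).trans hlt.le) hw
  exact absurd (hz.2 w hprefix) (not_le.2 hlt)

theorem exists_initialRotation_plug (hT : T.Has [0]) (u : T.Node) :
    ∃ y, T.initialRotation (Sum.inr u) = Sum.inl y := by
  rcases u.eq_root_or_edge with h | ⟨v, rfl⟩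
  · obtain ⟨i, hi, hi'⟩ := Has.exists_last_child (l := []) hT
    obtain ⟨w, hw⟩ := hi.exists_child
    exact ⟨_, initialRotation_plug_root h hw hi'⟩
  · exact ⟨_, initialRotation_plug v⟩

/-- The half-edge that follows the plug of a node. -/
noncomputable def first (hT : T.Has [0]) (u : T.Node) : T.HalfEdge :=
  (exists_initialRotation_plug hT u).choose

theorem initialRotation_inr (hT : T.Has [0]) (u : T.Node) :
    T.initialRotation (Sum.inr u) = Sum.inl (first hT u) :=
  (exists_initialRotation_plug hT u).choose_spec

theorem first_toNode (hT : T.Has [0]) (v : T.Edge) : first hT v.toNode = (v, false) :=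
  Sum.inl_injective ((initialRotation_inr hT _).symm.trans (initialRotation_plug v))

theorem first_root (hT : T.Has [0]) (hu : u.1.1 = []) {i : ℕ} (hv : v.1.1 = [i])
    (hi : ¬ T.Has [i + 1]) : first hT u = (v, true) :=
  Sum.inl_injective ((initialRotation_inr hT _).symm.trans (initialRotation_plug_root hu hv hi))

theorem owner_first (hT : T.Has [0]) (u : T.Node) : owner (first hT u) = u := by
  have h := dartOwner_initialRotation (Sum.inr u : T.Dart)
  rwa [initialRotation_inr hT u] at h

theorem exists_initialRotation_eq_plug (hT : T.Has [0]) (u : T.Node) :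
    ∃ x, T.initialRotation (Sum.inl x) = Sum.inr u := by
  obtain ⟨d, hd⟩ := T.initialRotation.surjective (Sum.inr u)
  rcases d with x | w
  · exact ⟨x, hd⟩
  · rw [initialRotation_inr hT] at hd
    exact absurd hd Sum.inl_ne_inr

theorem owner_of_initialRotation_eq_plug {x : T.HalfEdge}
    (hx : T.initialRotation (Sum.inl x) = Sum.inr u) : owner x = u := by
  have h := dartOwner_initialRotation (Sum.inl x : T.Dart)
  rw [hx] at h
  exact h.symm

/-- The rotation `ρ` is obtained from the tree by merging the nodes along the cycles of `π` and
removing the plugs. -/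
structure IsGlued (π : Equiv.Perm T.Node) (ρ : Equiv.Perm T.HalfEdge) : Prop where
  inl : ∀ {x y}, T.initialRotation (Sum.inl x) = Sum.inl y → ρ x = y
  inr : ∀ {x u}, T.initialRotation (Sum.inl x) = Sum.inr u →
    T.initialRotation (Sum.inr (π u)) = Sum.inl (ρ x)

/-- The rotation `σ` of darts is obtained from the tree by merging the nodes along the cycles of `π`
and removing the plugs of the nodes in `Q`, which contains every node moved by `π`. -/
structure PartiallyGlued (π : Equiv.Perm T.Node) (Q : T.Node → Prop) (σ : Equiv.Perm T.Dart) :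
    Prop where
  fix : ∀ {u}, ¬ Q u → π u = u
  plug_mem : ∀ {u}, Q u → σ (Sum.inr u) = Sum.inr u
  plug_notMem : ∀ {u}, ¬ Q u → σ (Sum.inr u) = T.initialRotation (Sum.inr u)
  inl : ∀ {x y}, T.initialRotation (Sum.inl x) = Sum.inl y → σ (Sum.inl x) = Sum.inl y
  inr_mem : ∀ {x u}, T.initialRotation (Sum.inl x) = Sum.inr u → Q u →
    σ (Sum.inl x) = T.initialRotation (Sum.inr (π u))
  inr_notMem : ∀ {x u}, T.initialRotation (Sum.inl x) = Sum.inr u → ¬ Q u →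
    σ (Sum.inl x) = Sum.inr u

/-- The permutation of the darts whose cycles are the contours of the faces, a plug being its own
opposite. -/
abbrev contour (σ : Equiv.Perm T.Dart) : Equiv.Perm T.Dart := σ * Equiv.Perm.sumCongr T.flip 1

theorem flip_apply (v : T.Edge) (b : Bool) : T.flip (v, b) = (v, !b) := by simp [flip]

section Faces

variable {π : Equiv.Perm T.Node} {Q : T.Node → Prop} {σ : Equiv.Perm T.Dart}

theorem sameCycle_contour_inl (σ : Equiv.Perm T.Dart) (v : T.Edge) (b : Bool) :
    (contour σ).SameCycle (Sum.inl (v, b)) (σ (Sum.inl (v, !b))) := by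
  simpa [contour, flip_apply] using sameCycle_apply_self (contour σ) (Sum.inl (v, b))

theorem PartiallyGlued.sameCycle_contour_plug (h : PartiallyGlued π Q σ) (hT : T.Has [0])
    (hu : ¬ Q u) : (contour σ).SameCycle (Sum.inr u) (Sum.inl (first hT u)) := by
  simpa [contour, h.plug_notMem hu, initialRotation_inr hT] using
    sameCycle_apply_self (contour σ) (Sum.inr u)

theorem PartiallyGlued.sameCycle_contour_of_eq_plug (h : PartiallyGlued π Q σ) (hT : T.Has [0])
    {b : Bool} (hu : T.initialRotation (Sum.inl (v, !b)) = Sum.inr u) :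
    (contour σ).SameCycle (Sum.inl (v, b)) (Sum.inl (first hT (π u))) := by
  have hstep := sameCycle_contour_inl σ v b
  by_cases hQ : Q u
  · rwa [h.inr_mem hu hQ, initialRotation_inr hT] at hstep
  · rw [h.inr_notMem hu hQ] at hstep
    rw [h.fix hQ]
    exact hstep.trans (h.sameCycle_contour_plug hT hQ)

theorem PartiallyGlued.sameCycle_contour_lastNode (h : PartiallyGlued π Q σ) (hT : T.Has [0])
    (v : T.Edge) :
    (contour σ).SameCycle (Sum.inl (v, true)) (Sum.inl (first hT (π v.lastNode))) := by
  induction hn : v.lastNode.1.1.length - v.1.1.length using Nat.strong_induction_on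
    generalizing v with
  | _ n ih =>
  by_cases h0 : T.Has (v.1.1 ++ [0])
  · obtain ⟨i, hi, hi'⟩ := h0.exists_last_child
    obtain ⟨w, hw⟩ := hi.exists_child
    have hstep := sameCycle_contour_inl σ v true
    rw [Bool.not_true, h.inl (initialRotation_down hw hi')] at hstep
    have hlen := w.isLastBelow_lastNode.1.length_le
    have hlast := lastNode_of_last_child hw hi'
    rw [hlast] at hlen
    rw [← hlast]
    refine hstep.trans (ih _ ?_ w rfl)
    rw [hlast]
    simp only [hw, List.length_append, List.length_singleton] at hlen ⊢
    omega
  · rw [lastNode_of_leaf h0]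
    exact h.sameCycle_contour_of_eq_plug hT (initialRotation_leaf h0)

theorem PartiallyGlued.sameCycle_contour_first (h : PartiallyGlued π Q σ) (hT : T.Has [0])
    (u : T.Node) :
    (contour σ).SameCycle (Sum.inl (first hT u)) (Sum.inl (first hT (π (T.prevNode u)))) := by
  rcases u.eq_root_or_edge with hu | ⟨v, rfl⟩
  · obtain ⟨i, hi, hi'⟩ := Has.exists_last_child (l := []) hT
    obtain ⟨w, hw⟩ := hi.exists_child
    rw [prevNode_root_eq_lastNode hu hw hi', first_root hT hu hw hi']
    exact h.sameCycle_contour_lastNode hT w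
  · rw [first_toNode]
    obtain ⟨i, hi⟩ := v.exists_eq_concat
    cases i with
    | zero =>
      rw [prevNode_of_leftmost (p := v.parent) hi]
      exact h.sameCycle_contour_of_eq_plug hT (initialRotation_up hi)
    | succ i =>
      obtain ⟨w, hw⟩ := Has.exists_child ((hi ▸ v.has : T.Has _).of_le (Nat.le_succ i))
      have hstep := sameCycle_contour_inl σ v false
      rw [Bool.not_false, h.inl (initialRotation_left hi hw)] at hstep
      rw [prevNode_of_sibling (u := v.toNode) hi hw]
      exact hstep.trans (h.sameCycle_contour_lastNode hT w)

theorem PartiallyGlued.sameFace (h : PartiallyGlued π Q σ) (hT : T.Has [0]) {u v : T.Node}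
    (hu : ¬ Q u) (hv : ¬ Q v) (huv : (π * T.prevNode).SameCycle u v) : T.SameFace σ u v := by
  have hfirst : (contour σ).SameCycle (Sum.inl (first hT u)) (Sum.inl (first hT v)) :=
    sameCycle_induction (S := fun w => (contour σ).SameCycle (Sum.inl (first hT u))
      (Sum.inl (first hT w))) (fun w hw => hw.trans (h.sameCycle_contour_first hT w)) huv
      SameCycle.rfl
  exact ((h.sameCycle_contour_plug hT hu).trans hfirst).trans (h.sameCycle_contour_plug hT hv).symm

end Faces

section Glued

variable {π : Equiv.Perm T.Node} {ρ : Equiv.Perm T.HalfEdge}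

theorem IsGlued.partiallyGlued (h : IsGlued π ρ) :
    PartiallyGlued π (fun _ => True) (Equiv.Perm.sumCongr ρ 1) where
  fix h := absurd trivial h
  plug_mem _ := by simp
  plug_notMem h := absurd trivial h
  inl hx := by simp [h.inl hx]
  inr_mem hx _ := by simp [h.inr hx]
  inr_notMem _ h := absurd trivial h

theorem IsGlued.apply_eq_first (h : IsGlued π ρ) (hT : T.Has [0]) {x : T.HalfEdge}
    (hx : T.initialRotation (Sum.inl x) = Sum.inr u) : ρ x = first hT (π u) := by
  have hinr := h.inr hx
  rw [initialRotation_inr hT] at hinr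
  exact (Sum.inl_injective hinr).symm

theorem sameCycle_of_contour {x y : T.HalfEdge}
    (h : (contour (Equiv.Perm.sumCongr ρ 1)).SameCycle (Sum.inl x) (Sum.inl y)) :
    (ρ * T.flip).SameCycle x y := by
  rw [contour, Equiv.Perm.sumCongr_mul, one_mul] at h
  exact sameCycle_of_sumCongr_one h

/-- A node whose first half-edge lies in the same face as the given half-edge, whichever way the
tree is glued. -/
noncomputable def faceNode (x : T.HalfEdge) : T.Node :=
  if x.2 then T.prevNode.symm x.1.lastNode else x.1.toNode

theorem faceNode_false (v : T.Edge) : faceNode (v, false) = v.toNode := rfl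

theorem faceNode_true (v : T.Edge) : faceNode (v, true) = T.prevNode.symm v.lastNode := rfl

theorem faceNode_first (hT : T.Has [0]) (u : T.Node) : faceNode (first hT u) = u := by
  rcases u.eq_root_or_edge with hu | ⟨v, rfl⟩
  · obtain ⟨i, hi, hi'⟩ := Has.exists_last_child (l := []) hT
    obtain ⟨w, hw⟩ := hi.exists_child
    rw [first_root hT hu hw hi', faceNode_true, Equiv.symm_apply_eq,
      prevNode_root_eq_lastNode hu hw hi']
  · rw [first_toNode, faceNode_false]

theorem IsGlued.sameCycle_first_faceNode (h : IsGlued π ρ) (hT : T.Has [0]) (x : T.HalfEdge) :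
    (ρ * T.flip).SameCycle (first hT (faceNode x)) x := by
  obtain ⟨v, _ | _⟩ := x
  · rw [faceNode_false, first_toNode]
  · have hfirst := h.partiallyGlued.sameCycle_contour_first hT (faceNode (v, true))
    have hlast := h.partiallyGlued.sameCycle_contour_lastNode hT v
    rw [faceNode_true, Equiv.apply_symm_apply] at hfirst
    exact sameCycle_of_contour (hfirst.trans hlast.symm)

theorem IsGlued.sameCycle_faceNode_down (h : IsGlued π ρ) (hT : T.Has [0]) (v : T.Edge) :
    (π * T.prevNode).SameCycle (faceNode (v, true)) (faceNode (ρ (v, false))) := by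
  rw [faceNode_true]
  by_cases h0 : T.Has (v.1.1 ++ [0])
  · obtain ⟨i, hi, hi'⟩ := h0.exists_last_child
    obtain ⟨w, hw⟩ := hi.exists_child
    rw [h.inl (initialRotation_down hw hi'), faceNode_true, lastNode_of_last_child hw hi']
  · rw [h.apply_eq_first hT (initialRotation_leaf h0), faceNode_first]
    simpa [lastNode_of_leaf h0] using
      sameCycle_apply_self (π * T.prevNode) (T.prevNode.symm v.lastNode)

theorem IsGlued.sameCycle_faceNode_up (h : IsGlued π ρ) (hT : T.Has [0]) (v : T.Edge) :
    (π * T.prevNode).SameCycle (faceNode (v, false)) (faceNode (ρ (v, true))) := by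
  rw [faceNode_false]
  obtain ⟨i, hi⟩ := v.exists_eq_concat
  cases i with
  | zero =>
    rw [h.apply_eq_first hT (initialRotation_up hi), faceNode_first,
      ← prevNode_of_leftmost (u := v.toNode) hi]
    exact sameCycle_apply_self (π * T.prevNode) v.toNode
  | succ i =>
    obtain ⟨w, hw⟩ := Has.exists_child ((hi ▸ v.has : T.Has _).of_le (Nat.le_succ i))
    rw [h.inl (initialRotation_left hi hw), faceNode_true,
      ← prevNode_of_sibling (u := v.toNode) hi hw, Equiv.symm_apply_apply]

theorem IsGlued.numFaces (h : IsGlued π ρ) (hT : T.Has [0]) :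
    numOrbits (ρ * T.flip) = numOrbits (π * T.prevNode) := by
  refine numOrbits_eq_of_retract (first hT) faceNode
    (fun u => sameCycle_of_contour (h.partiallyGlued.sameCycle_contour_first hT u)) ?_
    (fun u => by rw [faceNode_first]) (h.sameCycle_first_faceNode hT)
  rintro ⟨v, _ | _⟩ <;> rw [Equiv.Perm.mul_apply, flip_apply]
  · exact h.sameCycle_faceNode_up hT v
  · exact h.sameCycle_faceNode_down hT v

theorem IsGlued.sameCycle_first_parent (h : IsGlued π ρ) (hT : T.Has [0]) {v : T.Edge} {i : ℕ}
    (hu : v.1.1 = u.1.1 ++ [i]) : ρ.SameCycle (first hT u) (v, true) := by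
  obtain ⟨k, hk⟩ := T.exists_numChildren u.1.1
  have hik : i < k := (hk i).1 (hu ▸ v.has)
  induction hn : k - i using Nat.strong_induction_on generalizing i v with
  | _ n ih =>
  by_cases hi : T.Has (u.1.1 ++ [i + 1])
  · obtain ⟨w, hw⟩ := hi.exists_child
    have hik' := (hk (i + 1)).1 hi
    refine (ih (k - (i + 1)) (by omega) hw hik' rfl).trans ?_
    rw [← h.inl (initialRotation_left hw hu)]
    exact sameCycle_apply_self _ _
  · rcases u.eq_root_or_edge with hroot | ⟨e, rfl⟩
    · rw [hroot] at hu hi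
      rw [first_root hT hroot hu hi]
    · rw [first_toNode, ← h.inl (initialRotation_down hu hi)]
      exact sameCycle_apply_self _ _

theorem IsGlued.sameCycle_first_owner (h : IsGlued π ρ) (hT : T.Has [0]) (x : T.HalfEdge) :
    ρ.SameCycle (first hT (owner x)) x := by
  obtain ⟨v, _ | _⟩ := x
  · rw [owner_false, first_toNode]
  · exact h.sameCycle_first_parent hT v.exists_eq_concat.choose_spec

theorem IsGlued.sameCycle_first (h : IsGlued π ρ) (hT : T.Has [0]) (u : T.Node) :
    ρ.SameCycle (first hT u) (first hT (π u)) := by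
  obtain ⟨x, hx⟩ := exists_initialRotation_eq_plug hT u
  have howner := h.sameCycle_first_owner hT x
  rw [owner_of_initialRotation_eq_plug hx] at howner
  rw [← h.apply_eq_first hT hx]
  exact howner.trans (sameCycle_apply_self _ _)

theorem IsGlued.sameCycle_owner (h : IsGlued π ρ) (hT : T.Has [0]) (x : T.HalfEdge) :
    π.SameCycle (owner x) (owner (ρ x)) := by
  rcases hx : T.initialRotation (Sum.inl x) with y | u
  · have howner := dartOwner_initialRotation (Sum.inl x : T.Dart)
    rw [hx] at howner
    rw [h.inl hx]
    exact Eq.sameCycle howner.symm _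
  · rw [h.apply_eq_first hT hx, owner_first, owner_of_initialRotation_eq_plug hx]
    exact sameCycle_apply_self _ _

theorem IsGlued.sameCycle_iff (h : IsGlued π ρ) (hT : T.Has [0]) (x y : T.HalfEdge) :
    ρ.SameCycle x y ↔ π.SameCycle (owner x) (owner y) :=
  sameCycle_iff_of_retract (first hT) owner (h.sameCycle_first hT) (h.sameCycle_owner hT)
    (h.sameCycle_first_owner hT) x y

theorem IsGlued.numVertices (h : IsGlued π ρ) (hT : T.Has [0]) : numOrbits ρ = numOrbits π :=
  numOrbits_eq_of_retract (first hT) owner (h.sameCycle_first hT) (h.sameCycle_owner hT)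
    (fun y => by rw [owner_first]) (h.sameCycle_first_owner hT)

theorem numOrbits_flip : numOrbits T.flip = Nat.card T.Edge := by
  rw [← numOrbits_one]
  refine numOrbits_eq_of_retract (fun v => (v, false)) Prod.fst (fun y => SameCycle.rfl)
    (fun ⟨v, b⟩ => by rw [flip_apply]) (fun y => by simp) ?_
  rintro ⟨v, _ | _⟩
  · exact SameCycle.rfl
  · simpa only [flip_apply, Bool.not_false] using sameCycle_apply_self T.flip (v, false)

theorem card_node (T : PlaneTree ℕ) : Nat.card T.Node = T.nodes.length := by
  rw [← Nat.card_congr T.nodup_nodes.getEquiv, Nat.card_fin]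

theorem card_edge_add_one (T : PlaneTree ℕ) : Nat.card T.Edge + 1 = T.nodes.length := by
  rw [← Nat.card_congr (nodup_nonRootNodes (T := T)).getEquiv, Nat.card_fin]
  cases T with
  | node a cs =>
    have h : (node a cs).nonRootNodes = forestNodes 0 cs := by
      rw [nonRootNodes, nodes, List.filter_cons]
      simp only [ne_eq, not_true_eq_false, decide_false, Bool.false_eq_true, if_false]
      refine List.filter_eq_self.2 fun x hx => ?_
      obtain ⟨j, l, h, -⟩ := (pairwise_forestNodes cs 0).2 x hx
      simp [h]
    rw [h, nodes, List.length_cons]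

theorem IsGlued.euler_iff_noncrossing (h : IsGlued π ρ) (hT : T.Has [0]) :
    numOrbits ρ + numOrbits (ρ * T.flip) = numOrbits T.flip + 2 ↔ Noncrossing rank π := by
  obtain ⟨u, hu⟩ := T.has_nil.exists_node
  rw [← numOrbits_add_eq_iff_noncrossing isCyclicPred_prevNode (rank_root hu),
    h.numVertices hT, h.numFaces hT, numOrbits_flip, card_node, ← card_edge_add_one]

end Glued

end PlaneTree

/-! ## Gluing the plugs of a sticky tree -/

namespace PlaneTree

section FormPerm

variable {X Y : Type*} [DecidableEq X] [DecidableEq Y] {L : List X} {x : X}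

theorem formPerm_map_apply {f : X → Y} (hf : Function.Injective f) (hL : L.Nodup) (hx : x ∈ L) :
    (L.map f).formPerm (f x) = f (L.formPerm x) := by
  obtain ⟨i, hi, rfl⟩ := List.getElem_of_mem hx
  rw [List.formPerm_apply_getElem L hL i hi]
  have hmap := List.formPerm_apply_getElem (L.map f) (hL.map hf) i (by simpa using hi)
  simpa only [List.getElem_map, List.length_map] using hmap

theorem formPerm_of_pairwise_lt {rk : X → ℕ} (hL : L.Pairwise fun x y => rk x < rk y)
    (hx : x ∈ L) :
    (rk x < rk (L.formPerm x) ∧ ∀ z ∈ L, ¬ (rk x < rk z ∧ rk z < rk (L.formPerm x))) ∨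
      ∀ z ∈ L, rk (L.formPerm x) ≤ rk z ∧ rk z ≤ rk x := by
  have hnodup : L.Nodup := hL.imp fun h h' => (h' ▸ h).false
  have hlt := List.pairwise_iff_getElem.1 hL
  have hle : ∀ i j (hi : i < L.length) (hj : j < L.length), i ≤ j → rk L[i] ≤ rk L[j] := by
    intro i j hi hj hij
    rcases hij.lt_or_eq with hij | rfl
    · exact (hlt i j hi hj hij).le
    · exact le_rfl
  obtain ⟨i, hi, rfl⟩ := List.getElem_of_mem hx
  rw [List.formPerm_apply_getElem L hnodup i hi]
  by_cases hi' : i + 1 < L.length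
  · left
    simp only [Nat.mod_eq_of_lt hi']
    refine ⟨hlt i (i + 1) hi hi' i.lt_succ_self, ?_⟩
    rintro z hz ⟨hiz, hzi⟩
    obtain ⟨j, hj, rfl⟩ := List.getElem_of_mem hz
    rcases Nat.lt_or_ge i j with hij | hji
    · exact (hle (i + 1) j hi' hj hij).not_gt hzi
    · exact (hle j i hj hi hji).not_gt hiz
  · right
    have h0 : (i + 1) % L.length = 0 := by rw [show i + 1 = L.length by omega, Nat.mod_self]
    simp only [h0]
    intro z hz
    obtain ⟨j, hj, rfl⟩ := List.getElem_of_mem hz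
    exact ⟨hle 0 j _ hj j.zero_le, hle j i hj hi (by omega)⟩

end FormPerm

variable {T : PlaneTree ℕ}

section MergePlugs

variable {σ : Equiv.Perm T.Dart} {ps : List T.Node} {p q : T.Node} {d : T.Dart}

theorem removePlug_self (σ : Equiv.Perm T.Dart) (p : T.Node) :
    T.removePlug σ p (Sum.inr p) = Sum.inr p := by
  simp [removePlug]

theorem removePlug_of_apply_eq (hd : σ d = Sum.inr p) :
    T.removePlug σ p d = σ (Sum.inr p) := by
  simp [removePlug, hd]

theorem removePlug_of_ne (hd : d ≠ Sum.inr p) (hσd : σ d ≠ Sum.inr p) :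
    T.removePlug σ p d = σ d :=
  Equiv.swap_apply_of_ne_of_ne hσd fun h => hd (σ.injective h)

theorem foldl_removePlug_of_ne (hd : ∀ p ∈ ps, d ≠ Sum.inr p) (hσd : ∀ p ∈ ps, σ d ≠ Sum.inr p) :
    ps.foldl T.removePlug σ d = σ d := by
  induction ps generalizing σ with
  | nil => rfl
  | cons p ps ih =>
    rw [List.forall_mem_cons] at hd hσd
    have hp : T.removePlug σ p d = σ d := removePlug_of_ne hd.1 hσd.1
    rw [List.foldl_cons, ih hd.2 (by rw [hp]; exact hσd.2), hp]

theorem foldl_removePlug_of_mem (hp : p ∈ ps) :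
    ps.foldl T.removePlug σ (Sum.inr p) = Sum.inr p := by
  induction ps generalizing σ with
  | nil => simp at hp
  | cons q ps ih =>
    rw [List.foldl_cons]
    by_cases hps : p ∈ ps
    · exact ih hps
    · obtain rfl : p = q := (List.mem_cons.1 hp).resolve_right hps
      have hne : ∀ r ∈ ps, (Sum.inr p : T.Dart) ≠ Sum.inr r :=
        fun r hr h => hps (Sum.inr_injective h ▸ hr)
      rw [foldl_removePlug_of_ne hne (by rwa [removePlug_self]), removePlug_self]

theorem foldl_removePlug_of_apply_eq (hd : ∀ p ∈ ps, d ≠ Sum.inr p) (hq : q ∈ ps)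
    (hdq : σ d = Sum.inr q) (hσq : ∀ p ∈ ps, σ (Sum.inr q) ≠ Sum.inr p) :
    ps.foldl T.removePlug σ d = σ (Sum.inr q) := by
  induction ps generalizing σ with
  | nil => simp at hq
  | cons p ps ih =>
    rw [List.forall_mem_cons] at hd hσq
    rw [List.foldl_cons]
    by_cases hqp : q = p
    · subst hqp
      have hq' := removePlug_of_apply_eq hdq
      rw [foldl_removePlug_of_ne hd.2 (by rw [hq']; exact hσq.2), hq']
    · have hinr : (Sum.inr q : T.Dart) ≠ Sum.inr p := fun h => hqp (Sum.inr_injective h)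
      have hσq' : T.removePlug σ p (Sum.inr q) = σ (Sum.inr q) := removePlug_of_ne hinr hσq.1
      have hσd' : T.removePlug σ p d = Sum.inr q :=
        (removePlug_of_ne hd.1 (by rwa [hdq])).trans hdq
      rw [ih hd.2 ((List.mem_cons.1 hq).resolve_left hqp) hσd' (by rw [hσq']; exact hσq.2), hσq']

theorem formPerm_map_inr_mul_of_ne (hσd : ∀ p ∈ ps, σ d ≠ Sum.inr p) :
    ((ps.map (Sum.inr : T.Node → T.Dart)).formPerm * σ) d = σ d :=
  List.formPerm_apply_of_notMem fun hm => by
    obtain ⟨p, hp, hpd⟩ := List.mem_map.1 hm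
    exact hσd p hp hpd.symm

theorem mergePlugs_of_ne (hd : ∀ p ∈ ps, d ≠ Sum.inr p) (hσd : ∀ p ∈ ps, σ d ≠ Sum.inr p) :
    T.mergePlugs σ ps d = σ d := by
  have hmul := formPerm_map_inr_mul_of_ne hσd
  rw [mergePlugs, foldl_removePlug_of_ne hd (by rwa [hmul]), hmul]

theorem mergePlugs_of_mem (hp : p ∈ ps) : T.mergePlugs σ ps (Sum.inr p) = Sum.inr p :=
  foldl_removePlug_of_mem hp

theorem mergePlugs_of_apply_eq (hps : ps.Nodup) (hd : ∀ p ∈ ps, d ≠ Sum.inr p) (hq : q ∈ ps)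
    (hdq : σ d = Sum.inr q) (hσ : ∀ p ∈ ps, ∀ r ∈ ps, σ (Sum.inr p) ≠ Sum.inr r) :
    T.mergePlugs σ ps d = σ (Sum.inr (ps.formPerm q)) := by
  have hq' : ps.formPerm q ∈ ps := List.formPerm_apply_mem_of_mem hq
  have hmul := formPerm_map_inr_mul_of_ne (hσ _ hq')
  rw [mergePlugs, foldl_removePlug_of_apply_eq hd hq' _ (by rw [hmul]; exact hσ _ hq'), hmul]
  rw [mul_apply, hdq, formPerm_map_apply Sum.inr_injective hps hq]

theorem PartiallyGlued.invariant {π : Equiv.Perm T.Node} {Q : T.Node → Prop}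
    (h : PartiallyGlued π Q σ) {u : T.Node} (hu : Q u) : Q (π u) := by
  by_contra hπu
  exact hπu ((π.injective (h.fix hπu)).symm ▸ hu)

theorem PartiallyGlued.mergePlugs {π : Equiv.Perm T.Node} {Q : T.Node → Prop}
    (h : PartiallyGlued π Q σ) (hT : T.Has [0]) (hps : ps.Nodup) (hQ : ∀ p ∈ ps, ¬ Q p) :
    PartiallyGlued (ps.formPerm * π) (fun v => Q v ∨ v ∈ ps) (T.mergePlugs σ ps) := by
  have hinl : ∀ x, ∀ p ∈ ps, (Sum.inl x : T.Dart) ≠ Sum.inr p := fun _ _ _ => Sum.inl_ne_inr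
  have hinr : ∀ {v}, v ∉ ps → ∀ p ∈ ps, (Sum.inr v : T.Dart) ≠ Sum.inr p :=
    fun hv p hp h => hv (Sum.inr_injective h ▸ hp)
  have hQps : ∀ {v}, Q v → v ∉ ps := fun hv hp => hQ _ hp hv
  have hfirst : ∀ u, ∀ p ∈ ps, T.initialRotation (Sum.inr u) ≠ Sum.inr p := fun u p _ => by
    rw [initialRotation_inr hT]
    exact Sum.inl_ne_inr
  refine ⟨fun {u} hu => ?_, fun {u} hu => ?_, fun {u} hu => ?_, fun {x y} hxy => ?_,
    fun {x u} hxu hu => ?_, fun {x u} hxu hu => ?_⟩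
  · rw [not_or] at hu
    rw [mul_apply, h.fix hu.1, List.formPerm_apply_of_notMem hu.2]
  · rcases hu with hu | hu
    · have hσu := h.plug_mem hu
      rw [mergePlugs_of_ne (hinr (hQps hu)) (by rw [hσu]; exact hinr (hQps hu)), hσu]
    · exact mergePlugs_of_mem hu
  · rw [not_or] at hu
    have hσu := h.plug_notMem hu.1
    rw [mergePlugs_of_ne (hinr hu.2) (by rw [hσu]; exact hfirst u), hσu]
  · have hσx := h.inl hxy
    rw [mergePlugs_of_ne (hinl x) (by rw [hσx]; exact hinl y), hσx]
  · rcases hu with hu | hu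
    · have hσx := h.inr_mem hxu hu
      rw [mergePlugs_of_ne (hinl x) (by rw [hσx]; exact hfirst _), hσx, mul_apply,
        List.formPerm_apply_of_notMem (hQps (h.invariant hu))]
    · have hplug : ∀ p ∈ ps, σ (Sum.inr p) = T.initialRotation (Sum.inr p) :=
        fun p hp => h.plug_notMem (hQ p hp)
      rw [mergePlugs_of_apply_eq hps (hinl x) hu (h.inr_notMem hxu (hQ u hu))
        (fun p hp => by rw [hplug p hp]; exact hfirst p), mul_apply, h.fix (hQ u hu),
        hplug _ (List.formPerm_apply_mem_of_mem hu)]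
  · rw [not_or] at hu
    have hσx := h.inr_notMem hxu hu.1
    rw [mergePlugs_of_ne (hinl x) (by rw [hσx]; exact hinr hu.2), hσx]

end MergePlugs

theorem pairwise_glueClass (u : T.Node) :
    (T.glueClass u).Pairwise (fun v w => rank v < rank w) := by
  simp only [rank_lt_iff]
  have h := T.pairwise_nodes
  rw [← List.attach_map_subtype_val T.nodes, List.pairwise_map] at h
  exact h.filter _

theorem nodup_glueClass (u : T.Node) : (T.glueClass u).Nodup :=
  (List.nodup_attach.2 T.nodup_nodes).filter _

theorem mem_glueClass {u v : T.Node} : v ∈ T.glueClass u ↔ u.1.1 <+: v.1.1 ∧ v.1.2 = u.1.2 := by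
  simp [glueClass]

theorem mem_gluingOrder {u : T.Node} : u ∈ T.gluingOrder ↔ u.1.2 = u.1.1.length := by
  simp only [gluingOrder, List.mem_flatMap, List.mem_range, List.mem_filter, List.mem_attach,
    true_and, decide_eq_true_eq]
  constructor
  · rintro ⟨d, -, rfl, hlabel⟩
    exact hlabel
  · exact fun h => ⟨u.1.1.length, T.length_lt_length_nodes _ u.2, rfl, h⟩

theorem nodup_gluingOrder : T.gluingOrder.Nodup := by
  rw [gluingOrder, List.nodup_flatMap]
  refine ⟨fun d _ => (List.nodup_attach.2 T.nodup_nodes).filter _, ?_⟩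
  refine List.nodup_range.imp fun {a b} hab => ?_
  rw [Function.onFun, List.disjoint_left]
  intro u ha hb
  simp only [List.mem_filter, decide_eq_true_eq] at ha hb
  exact hab (ha.2.1.symm.trans hb.2.1)

theorem IsSticky.exists_rep (hS : T.IsSticky) (v : T.Node) :
    ∃ u : T.Node, u.1.1 <+: v.1.1 ∧ u.1.1.length = v.1.2 ∧ u.1.2 = v.1.2 := by
  have hprefix : v.1.1.take v.1.2 <+: v.1.1 := List.take_prefix _ _
  obtain ⟨u, hu⟩ := (v.has.of_prefix hprefix).exists_node
  have hlength : u.1.1.length = v.1.2 := by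
    rw [hu, List.length_take, min_eq_left (hS.label_le_depth _ v.2)]
  rw [← hu] at hprefix
  refine ⟨u, hprefix, hlength, ?_⟩
  rcases (le_of_prefix hprefix).lt_or_eq with huv | huv
  · rw [← hlength]
    exact (hS.label_le_depth _ u.2).antisymm
      (hS.depth_le_of_before _ u.2 _ v.2 hprefix hlength.symm _ u.2 List.prefix_rfl huv)
  · rw [Node.ext huv]

/-- The ancestor `u` of `v` whose depth is the label of `v`: the two plugs are glued together when
the process reaches `u`. -/
noncomputable def IsSticky.rep (hS : T.IsSticky) (v : T.Node) : T.Node := (hS.exists_rep v).choose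

namespace IsSticky

variable (hS : T.IsSticky)

theorem rep_prefix (v : T.Node) : (hS.rep v).1.1 <+: v.1.1 :=
  (hS.exists_rep v).choose_spec.1

theorem rep_length (v : T.Node) : (hS.rep v).1.1.length = v.1.2 :=
  (hS.exists_rep v).choose_spec.2.1

theorem rep_label (v : T.Node) : (hS.rep v).1.2 = v.1.2 :=
  (hS.exists_rep v).choose_spec.2.2

theorem rep_label_eq_length (v : T.Node) : (hS.rep v).1.2 = (hS.rep v).1.1.length := by
  rw [hS.rep_label, hS.rep_length]

theorem rep_eq {u v : T.Node} (hprefix : u.1.1 <+: v.1.1) (hlength : u.1.1.length = v.1.2) :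
    hS.rep v = u := by
  have heq : (hS.rep v).1.1.length = u.1.1.length := (hS.rep_length v).trans hlength.symm
  exact Node.ext
    ((List.prefix_of_prefix_length_le (hS.rep_prefix v) hprefix heq.le).eq_of_length heq)

theorem rep_rep (v : T.Node) : hS.rep (hS.rep v) = hS.rep v :=
  hS.rep_eq List.prefix_rfl (hS.rep_label_eq_length v).symm

theorem mem_glueClass_iff {u v : T.Node} (hu : u.1.2 = u.1.1.length) :
    v ∈ T.glueClass u ↔ hS.rep v = u := by
  rw [mem_glueClass]
  constructor
  · rintro ⟨hprefix, hlabel⟩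
    exact hS.rep_eq hprefix (hlabel.trans hu).symm
  · rintro rfl
    exact ⟨hS.rep_prefix v, (hS.rep_label v).symm⟩

theorem mem_glueClass_rep_iff {u v : T.Node} :
    v ∈ T.glueClass (hS.rep u) ↔ hS.rep v = hS.rep u :=
  hS.mem_glueClass_iff (hS.rep_label_eq_length u)

theorem rep_formPerm (v : T.Node) :
    hS.rep ((T.glueClass (hS.rep v)).formPerm v) = hS.rep v :=
  hS.mem_glueClass_rep_iff.1 (List.formPerm_apply_mem_of_mem (hS.mem_glueClass_rep_iff.2 rfl))

/-- The next node in prefix order with the same `rep`, cyclically: the permutation of the nodes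
along which the gluings merge them. -/
noncomputable def perm : Equiv.Perm T.Node :=
  Equiv.ofBijective (fun v => (T.glueClass (hS.rep v)).formPerm v) <|
    Finite.injective_iff_bijective.1 fun v w hvw => by
      have hrep : hS.rep v = hS.rep w := by
        rw [← hS.rep_formPerm v, ← hS.rep_formPerm w]
        exact congrArg _ hvw
      simp only [hrep] at hvw
      exact (T.glueClass (hS.rep w)).formPerm.injective hvw

theorem perm_apply (v : T.Node) : hS.perm v = (T.glueClass (hS.rep v)).formPerm v := rfl

theorem rep_perm (v : T.Node) : hS.rep (hS.perm v) = hS.rep v := hS.rep_formPerm v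

theorem perm_lt_or_le (x : T.Node) :
    (rank x < rank (hS.perm x) ∧ ∀ z, hS.rep z = hS.rep x →
      ¬ (rank x < rank z ∧ rank z < rank (hS.perm x))) ∨
    ∀ z, hS.rep z = hS.rep x → rank (hS.perm x) ≤ rank z ∧ rank z ≤ rank x := by
  have h := formPerm_of_pairwise_lt (pairwise_glueClass (hS.rep x))
    (hS.mem_glueClass_rep_iff.2 rfl)
  simp only [hS.mem_glueClass_rep_iff] at h
  exact h

theorem rep_eq_of_crossing {a b c d : T.Node} (hab : rank a < rank b)
    (hbc : rank b < rank c) (hcd : rank c < rank d) (hac : hS.rep a = hS.rep c)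
    (hbd : hS.rep b = hS.rep d) : hS.rep a = hS.rep b := by
  rw [rank_lt_iff] at hab hbc hcd
  have hrepa : (hS.rep c).1.1 <+: a.1.1 := hac ▸ hS.rep_prefix a
  have hrepb : (hS.rep d).1.1 <+: b.1.1 := hbd ▸ hS.rep_prefix b
  have hdc : (hS.rep d).1.1 <+: c.1.1 :=
    prefix_of_le_of_le ((le_of_prefix hrepb).trans hbc.le) hcd.le (hS.rep_prefix d)
  have hcb : (hS.rep c).1.1 <+: b.1.1 :=
    prefix_of_le_of_le ((le_of_prefix hrepa).trans hab.le) hbc.le (hS.rep_prefix c)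
  have hle : (hS.rep d).1.1.length ≤ (hS.rep c).1.1.length := by
    rw [hS.rep_length c]
    exact hS.depth_le_of_before _ (hS.rep d).2 _ d.2 (hS.rep_prefix d) (hS.rep_length d).symm
      _ c.2 hdc hcd
  have hge : (hS.rep c).1.1.length ≤ (hS.rep d).1.1.length := by
    rw [← hbd, hS.rep_length b]
    exact hS.depth_le_of_before _ (hS.rep c).2 _ c.2 (hS.rep_prefix c) (hS.rep_length c).symm
      _ b.2 hcb hbc
  rw [hac, hbd]
  exact Node.ext ((List.prefix_of_prefix_length_le (hS.rep_prefix c) hdc hge).eq_of_length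
    (hge.antisymm hle))

theorem rank_perm_between {a b z : T.Node} (hab : hS.rep a = hS.rep b)
    (hza : hS.rep z ≠ hS.rep a) (haz : rank a < rank z) (hzb : rank z < rank b) :
    rank a < rank (hS.perm z) ∧ rank (hS.perm z) < rank b := by
  have hz := hS.rep_perm z
  have hne : ∀ {c}, hS.rep c = hS.rep a → rank c ≠ rank (hS.perm z) :=
    fun hc h => hza (by rw [← hz, ← rank_injective h, hc])
  constructor
  · refine (hne rfl).lt_or_gt.resolve_right fun hlt => hza ?_
    rw [← hz, hS.rep_eq_of_crossing hlt haz hzb hz hab]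
  · refine (hne hab.symm).lt_or_gt.resolve_left fun hlt => hza ?_
    exact (hS.rep_eq_of_crossing haz hzb hlt hab hz.symm).symm

theorem noncrossing_perm : Noncrossing rank hS.perm := by
  refine fun x => ⟨.of_forall_imp fun z hz => ?_, .of_forall_imp fun z hz => ?_⟩
  · rcases hS.perm_lt_or_le x with ⟨-, hgap⟩ | hle
    · exact hS.rank_perm_between (hS.rep_perm x).symm (fun h => hgap z h hz) hz.1 hz.2
    · exact absurd (hz.1.trans hz.2) (hle x rfl).1.not_gt
  · by_cases hzx : hS.rep z = hS.rep x
    · rcases hS.perm_lt_or_le x with ⟨hlt, -⟩ | hle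
      · exact absurd (hz.1.trans hz.2) hlt.not_ge
      · exact hle _ ((hS.rep_perm z).trans hzx)
    · have hne : ∀ {c}, hS.rep c = hS.rep x → rank z ≠ rank c :=
        fun hc h => hzx (by rw [rank_injective h, hc])
      have hx := hS.rep_perm x
      exact Set.Ioo_subset_Icc_self <| hS.rank_perm_between hx (hx.symm ▸ hzx)
        (hz.1.lt_of_ne' (hne hx)) (hz.2.lt_of_ne (hne rfl))

theorem perm_eq_rep {x : T.Node} (hx : ∀ z, hS.rep z = hS.rep x → rank (hS.perm x) ≤ rank z) :
    hS.perm x = hS.rep x := by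
  refine rank_injective ((hx _ (hS.rep_rep x)).antisymm (rank_le_iff.2 (le_of_prefix ?_)))
  rw [← hS.rep_perm]
  exact hS.rep_prefix _

theorem rep_eq_of_sameCycle {x y : T.Node} (h : hS.perm.SameCycle x y) : hS.rep x = hS.rep y :=
  sameCycle_induction (S := fun z => hS.rep x = hS.rep z)
    (fun z hz => hz.trans (hS.rep_perm z).symm) h rfl

theorem sameCycle_rep (x : T.Node) : hS.perm.SameCycle x (hS.rep x) := by
  obtain ⟨y, hxy, hy⟩ := hS.noncrossing_perm.exists_last x
  have hxy' : hS.perm.SameCycle x (hS.perm y) := hxy.trans (sameCycle_apply_self _ _)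
  rcases hS.perm_lt_or_le y with hlt | hle
  · exact absurd hlt.1 (hy _ hxy').2.not_gt
  · rwa [hS.rep_eq_of_sameCycle hxy, ← hS.perm_eq_rep fun z hz => (hle z hz).1]

theorem sameCycle_perm_iff (x y : T.Node) : hS.perm.SameCycle x y ↔ hS.rep x = hS.rep y :=
  ⟨hS.rep_eq_of_sameCycle, fun h => (hS.sameCycle_rep x).trans (h ▸ (hS.sameCycle_rep y).symm)⟩

theorem perm_prefix_or_lt (x : T.Node) : (hS.perm x).1.1 <+: x.1.1 ∨ x.1.1 < (hS.perm x).1.1 := by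
  rcases hS.perm_lt_or_le x with hlt | hle
  · exact Or.inr (rank_lt_iff.1 hlt.1)
  · rw [hS.perm_eq_rep fun z hz => (hle z hz).1]
    exact Or.inl (hS.rep_prefix x)

/-- `σ` is the rotation after the gluings of the classes of `hS.perm` contained in `Q`. -/
def GluedOn (Q : T.Node → Prop) (σ : Equiv.Perm T.Dart) : Prop :=
  ∃ πQ : Equiv.Perm T.Node, (∀ x, Q x → πQ x = hS.perm x) ∧ PartiallyGlued πQ Q σ

theorem gluedOn_initialRotation : hS.GluedOn (fun _ => False) T.initialRotation :=
  ⟨1, fun _ h => h.elim, fun _ => rfl, fun h => h.elim, fun _ => rfl, fun h => h,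
    fun _ h => h.elim, fun h _ => h⟩

theorem gluedOn_glue (hT : T.Has [0]) {Q : T.Node → Prop} {σ : Equiv.Perm T.Dart}
    (h : hS.GluedOn Q σ) {u : T.Node} (hu : u.1.2 = u.1.1.length)
    (hQu : ∀ v, hS.rep v = u → ¬ Q v) :
    ∃ σ', T.glue σ u = some σ' ∧ hS.GluedOn (fun v => Q v ∨ hS.rep v = u) σ' := by
  obtain ⟨πQ, hπQ, hG⟩ := h
  have hmem : ∀ {v}, v ∈ T.glueClass u ↔ hS.rep v = u := hS.mem_glueClass_iff hu
  have hsameFace : ∀ p ∈ T.glueClass u, ∀ q ∈ T.glueClass u, T.SameFace σ p q := by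
    intro p hp q hq
    rw [hmem] at hp hq
    exact hG.sameFace hT (hQu p hp) (hQu q hq) <|
      hS.noncrossing_perm.sameCycle_of_eqOn isCyclicPred_prevNode hπQ (fun x hx => hG.fix hx)
        (fun x hx => hπQ x hx ▸ hG.invariant hx) (hQu p hp) (hQu q hq)
        ((hS.sameCycle_perm_iff p q).2 (hp.trans hq.symm))
  refine ⟨_, if_pos hsameFace, (T.glueClass u).formPerm * πQ, ?_, ?_⟩
  · rintro x (hx | rfl)
    · rw [mul_apply, List.formPerm_apply_of_notMem fun hm => hQu _ (hmem.1 hm) (hG.invariant hx),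
        hπQ x hx]
    · rw [mul_apply, hG.fix (hQu x rfl), hS.perm_apply]
  · simpa only [hmem] using hG.mergePlugs hT (nodup_glueClass u) fun p hp => hQu p (hmem.1 hp)

theorem gluedOn_foldlM (hT : T.Has [0]) {L : List T.Node} (hL : L.Nodup)
    (hlabel : ∀ u ∈ L, u.1.2 = u.1.1.length) {Q : T.Node → Prop} {σ : Equiv.Perm T.Dart}
    (h : hS.GluedOn Q σ) (hQL : ∀ v, hS.rep v ∈ L → ¬ Q v) :
    ∃ σ', L.foldlM T.glue σ = some σ' ∧ hS.GluedOn (fun v => Q v ∨ hS.rep v ∈ L) σ' := by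
  induction L generalizing Q σ with
  | nil => exact ⟨σ, rfl, by simpa using h⟩
  | cons u L ih =>
    rw [List.nodup_cons] at hL
    rw [List.forall_mem_cons] at hlabel
    obtain ⟨σ₁, hσ₁, h₁⟩ := hS.gluedOn_glue hT h hlabel.1
      fun v hv => hQL v (hv ▸ List.mem_cons_self)
    have hQL₁ : ∀ v, hS.rep v ∈ L → ¬ (Q v ∨ hS.rep v = u) := by
      rintro v hv (hQv | rfl)
      · exact hQL v (List.mem_cons_of_mem _ hv) hQv
      · exact hL.1 hv
    obtain ⟨σ₂, hσ₂, h₂⟩ := ih hL.2 hlabel.2 h₁ hQL₁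
    refine ⟨σ₂, ?_, by simpa only [List.mem_cons, or_assoc] using h₂⟩
    rw [List.foldlM_cons, hσ₁]
    exact hσ₂

theorem exists_finalRotation (hT : T.Has [0]) :
    ∃ σ, T.finalRotation = some σ ∧ PartiallyGlued hS.perm (fun _ => True) σ := by
  obtain ⟨σ, hσ, πQ, hπQ, hG⟩ := hS.gluedOn_foldlM hT nodup_gluingOrder
    (fun u hu => mem_gluingOrder.1 hu) hS.gluedOn_initialRotation (fun _ _ h => h)
  simp only [mem_gluingOrder, hS.rep_label_eq_length, or_true, true_imp_iff] at hπQ hG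
  obtain rfl : πQ = hS.perm := Equiv.ext hπQ
  exact ⟨σ, hσ, hG⟩

theorem treeToMap_eq (hT : T.Has [0]) :
    ∃ (ρ : Equiv.Perm T.HalfEdge) (v : T.Edge) (i : ℕ), IsGlued hS.perm ρ ∧ v.1.1 = [i] ∧
      ¬ T.Has [i + 1] ∧ treeToMap T = some ⟦T.toRotationSystem ρ (v, true)⟧ := by
  obtain ⟨σ, hσ, hG⟩ := hS.exists_finalRotation hT
  obtain ⟨i, hi, hi'⟩ := Has.exists_last_child (l := []) hT
  obtain ⟨v, hv⟩ := hi.exists_child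
  have hinl : ∀ x, ∃ y, σ (Sum.inl x) = Sum.inl y := by
    intro x
    rcases hx : T.initialRotation (Sum.inl x) with y | u
    · exact ⟨y, hG.inl hx⟩
    · exact ⟨_, (hG.inr_mem hx trivial).trans (initialRotation_inr hT _)⟩
  have hleft : ∀ x : T.HalfEdge, (σ (Sum.inl x)).isLeft := by
    intro x
    obtain ⟨y, hy⟩ := hinl x
    rw [hy, Sum.isLeft_inl]
  have hρ : ∀ x, Sum.inl (T.restrictRotation σ hleft x) = σ (Sum.inl x) := fun x =>
    Sum.inl_getLeft _ (hleft x)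
  refine ⟨T.restrictRotation σ hleft, v, i, ⟨fun {x y} hx => ?_, fun {x u} hx => ?_⟩, hv, hi', ?_⟩
  · exact Sum.inl_injective ((hρ x).trans (hG.inl hx))
  · rw [hρ, hG.inr_mem hx trivial]
  · rw [treeToMap, hσ, Option.bind_some, getLast?_childEdges hv hi', Option.bind_some,
      dif_pos hleft]

end IsSticky

end PlaneTree

/-! ## The exploration as a relation -/

namespace PlaneTree

variable {α β : Type}

theorem forest_induction {P : List (PlaneTree α) → Prop} (nil : P [])
    (cons : ∀ a cs ts, P cs → P ts → P (node a cs :: ts)) : ∀ ts, P ts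
  | [] => nil
  | node a cs :: ts => cons a cs ts (forest_induction nil cons cs) (forest_induction nil cons ts)

theorem mapForest_append (f : α → β) (ts ss : List (PlaneTree α)) :
    mapForest f (ts ++ ss) = mapForest f ts ++ mapForest f ss := by
  induction ts with
  | nil => simp [mapForest]
  | cons t ts ih => simp [mapForest, ih]

theorem mirrorForest_append (ts ss : List (PlaneTree α)) :
    mirrorForest (ts ++ ss) = mirrorForest ss ++ mirrorForest ts := by
  induction ts with
  | nil => simp [mirrorForest]
  | cons t ts ih => simp [mirrorForest, ih]

theorem length_mirrorForest (ts : List (PlaneTree α)) : (mirrorForest ts).length = ts.length := by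
  induction ts with
  | nil => simp [mirrorForest]
  | cons t ts ih => simp [mirrorForest, ih]

theorem mirrorForest_mirrorForest (ts : List (PlaneTree α)) :
    mirrorForest (mirrorForest ts) = ts := by
  induction ts using forest_induction with
  | nil => simp [mirrorForest]
  | cons a cs ts ihcs ihts =>
    simp only [mirrorForest, mirrorForest_append, mirror, ihcs, ihts, List.nil_append,
      List.singleton_append]

theorem mirror_mirror (T : PlaneTree α) : T.mirror.mirror = T := by
  cases T with
  | node a cs => simp only [mirror, mirrorForest_mirrorForest]

theorem mapForest_mirrorForest (f : α → β) (ts : List (PlaneTree α)) :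
    mapForest f (mirrorForest ts) = mirrorForest (mapForest f ts) := by
  induction ts using forest_induction with
  | nil => simp [mirrorForest, mapForest]
  | cons a cs ts ihcs ihts =>
    simp only [mirrorForest, mapForest_append, mapForest, mirror, map, ihcs, ihts]

theorem map_mirror (f : α → β) (T : PlaneTree α) : T.mirror.map f = (T.map f).mirror := by
  cases T with
  | node a cs => simp only [mirror, map, mapForest_mirrorForest]

theorem forestNodes_append (i : ℕ) (ts ss : List (PlaneTree α)) :
    forestNodes i (ts ++ ss) = forestNodes i ts ++ forestNodes (i + ts.length) ss := by
  induction ts generalizing i with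
  | nil => simp [forestNodes]
  | cons t ts ih =>
    simp only [List.cons_append, forestNodes, ih, List.append_assoc, List.length_cons]
    congr 3
    omega

/-- The node at the address `l` of the mirrored forest carries `x`.  An exploration lists its trees
from right to left, whereas addresses count from the left. -/
def ForestAt (F : List (PlaneTree α)) (l : List ℕ) (x : α) : Prop :=
  (l, x) ∈ forestNodes 0 (mirrorForest F)

section ForestAt

variable {F cs ts : List (PlaneTree α)} {l m : List ℕ} {i : ℕ} {b x y : α}

theorem not_forestAt_nil : ¬ ForestAt [] l x := by
  simp [ForestAt, mirrorForest, forestNodes]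

theorem forestAt_cons : ForestAt (node b cs :: ts) l x ↔
    ForestAt ts l x ∨ (l = [ts.length] ∧ x = b) ∨ ∃ m, l = ts.length :: m ∧ ForestAt cs m x := by
  simp only [ForestAt, mirrorForest, forestNodes_append, forestNodes, mirror, nodes,
    List.mem_append, length_mirrorForest, List.append_nil, List.map_cons, List.mem_cons,
    List.mem_map, Prod.mk.injEq, zero_add, Prod.exists]
  refine or_congr Iff.rfl (or_congr Iff.rfl ⟨?_, ?_⟩)
  · rintro ⟨m, y, h, hl, rfl⟩; exact ⟨m, hl.symm, h⟩
  · rintro ⟨m, hl, h⟩; exact ⟨m, x, h, hl.symm, rfl⟩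

theorem ForestAt.exists_cons (h : ForestAt F l x) : ∃ i m, l = i :: m ∧ i < F.length := by
  obtain ⟨j, t, m, hj, -, hl⟩ := mem_forestNodes.1 h
  refine ⟨j, m, by simpa using hl, ?_⟩
  rw [← length_mirrorForest]
  exact (List.getElem?_eq_some_iff.1 hj).1

theorem ForestAt.ne_nil (h : ForestAt F l x) : l ≠ [] := by
  obtain ⟨i, m, rfl, -⟩ := h.exists_cons
  exact List.cons_ne_nil i m

theorem ForestAt.lt_length (h : ForestAt F (i :: m) x) : i < F.length := by
  obtain ⟨j, m', hl, hj⟩ := h.exists_cons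
  rwa [(List.cons.inj hl).1]

theorem ForestAt.unique (hx : ForestAt F l x) (hy : ForestAt F l y) : x = y := by
  have mem_nodes {z : α} (h : ForestAt F l z) : (l, z) ∈ (node x F).mirror.nodes := by
    rw [mirror, nodes]; exact List.mem_cons_of_mem _ h
  exact eq_of_mem_nodes (mem_nodes hx) (mem_nodes hy)

theorem exists_forestAt_singleton (hi : i < F.length) : ∃ x, ForestAt F [i] x := by
  have hlen : i < (mirrorForest F).length := by rwa [length_mirrorForest]
  obtain ⟨⟨c, ds⟩, ht⟩ : ∃ t, (mirrorForest F)[i]? = some t := ⟨_, List.getElem?_eq_getElem hlen⟩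
  exact ⟨c, mem_forestNodes.2 ⟨i, _, [], ht, mem_nodes_nil.2 rfl, by simp⟩⟩

theorem exists_forestAt_singleton_iff : (∃ x, ForestAt F [i] x) ↔ i < F.length :=
  ⟨fun ⟨_, h⟩ => h.lt_length, exists_forestAt_singleton⟩

theorem forestAt_cons_of_lt (hi : i < ts.length) :
    ForestAt (node b cs :: ts) (i :: m) x ↔ ForestAt ts (i :: m) x := by
  rw [forestAt_cons, or_iff_left]
  rintro (⟨h, -⟩ | ⟨m', h, -⟩)
  all_goals exact hi.ne (List.cons.inj h).1

theorem forestAt_cons_length_cons (hm : m ≠ []) :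
    ForestAt (node b cs :: ts) (ts.length :: m) x ↔ ForestAt cs m x := by
  rw [forestAt_cons, or_iff_right fun h => lt_irrefl _ h.lt_length]
  simp [hm]

theorem forestAt_cons_length :
    ForestAt (node b cs :: ts) [ts.length] x ↔ x = b := by
  rw [forestAt_cons, or_iff_right fun h => lt_irrefl _ h.lt_length, or_iff_left, and_iff_right rfl]
  rintro ⟨m, hm, h⟩
  exact h.ne_nil (List.cons.inj hm).2.symm

end ForestAt

end PlaneTree

open PlaneTree

/-- The loop of the exploration leads from the set `V` of visited half-edges and the half-edge `h`
to the set `V'` and the half-edge `e`, exploring the trees of `F`. -/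
inductive Explores {D : Type} [DecidableEq D] (σ τ : Equiv.Perm D) :
    Finset D → D → List (PlaneTree D) → Finset D → D → Prop
  | nil (V : Finset D) (h : D) : Explores σ τ V h [] V h
  | cons {V V₁ V₂ : Finset D} {h e₁ e₂ : D} {cs ts : List (PlaneTree D)} (hV : h ∉ V)
      (below : Explores σ τ (insert h (insert (τ h) V)) (σ (τ h)) cs V₁ e₁) (he : e₁ ∈ V₁)
      (next : Explores σ τ V₁ (σ h) ts V₂ e₂) : Explores σ τ V h (node (τ h) cs :: ts) V₂ e₂

section Explores

variable {D : Type} {σ τ : Equiv.Perm D} {F cs ts : List (PlaneTree D)} {l m : List ℕ} {i : ℕ}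
  {a b c h x : D}

/-- `x` is one of the halves of the edge that is explored at the node `l` of the forest `F`. -/
def ExploredAt (τ : Equiv.Perm D) (F : List (PlaneTree D)) (l : List ℕ) (x : D) : Prop :=
  ∃ b, ForestAt F l b ∧ (x = b ∨ x = τ b)

theorem not_exploredAt_nil : ¬ ExploredAt τ [] l x := fun ⟨_, h, _⟩ => not_forestAt_nil h

theorem exploredAt_cons (hτ : Function.Involutive τ) : ExploredAt τ (node (τ h) cs :: ts) l x ↔
    ExploredAt τ ts l x ∨ (l = [ts.length] ∧ (x = h ∨ x = τ h)) ∨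
      ∃ m, l = ts.length :: m ∧ ExploredAt τ cs m x := by
  simp only [ExploredAt, forestAt_cons, or_and_right, exists_or, and_assoc, exists_and_left,
    exists_eq_left, hτ h, or_comm (a := x = h)]
  grind

namespace Explores

variable [DecidableEq D] {V V' V₁ V₂ : Finset D} {e : D}

theorem append {h₁ h₂ : D} {G : List (PlaneTree D)} (hF : Explores σ τ V h F V₁ h₁)
    (hG : Explores σ τ V₁ h₁ G V₂ h₂) : Explores σ τ V h (F ++ G) V₂ h₂ := by
  induction hF with
  | nil => exact hG
  | cons hV below he _ _ ih => exact .cons hV below he (ih hG)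

theorem explore_eq [Fintype D] (hE : Explores σ τ V h F V' e) (he : e ∈ V') :
    explore σ τ V h = (F, V') := by
  induction hE with
  | nil => exact explore_of_mem σ τ he
  | cons hV _ he₁ _ ihcs ihts => rw [explore_of_notMem σ τ hV, ihcs he₁, ihts he]

theorem mem_iff (hE : Explores σ τ V h F V' e) (hτ : Function.Involutive τ) :
    x ∈ V' ↔ x ∈ V ∨ ∃ l, ExploredAt τ F l x := by
  induction hE with
  | nil => simp [not_exploredAt_nil]
  | cons _ _ _ _ ihcs ihts =>
    rw [ihts, ihcs, Finset.mem_insert, Finset.mem_insert]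
    simp only [exploredAt_cons hτ, exists_or, exists_eq_left, exists_comm (β := _)]
    grind

theorem closed (hE : Explores σ τ V h F V' e) (hτ : Function.Involutive τ)
    (hV : ∀ x ∈ V, τ x ∈ V) (hx : x ∈ V') : τ x ∈ V' := by
  rw [hE.mem_iff hτ] at hx ⊢
  rcases hx with hx | ⟨l, b, hb, rfl | rfl⟩
  · exact Or.inl (hV x hx)
  · exact Or.inr ⟨l, x, hb, Or.inr rfl⟩
  · exact Or.inr ⟨l, b, hb, Or.inl (hτ b)⟩

theorem closed_insert (hτ : Function.Involutive τ) (hV : ∀ x ∈ V, τ x ∈ V) :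
    ∀ x ∈ insert h (insert (τ h) V), τ x ∈ insert h (insert (τ h) V) := by
  simp only [Finset.mem_insert]
  rintro x (rfl | rfl | hx)
  · exact Or.inr (Or.inl rfl)
  · exact Or.inl (hτ h)
  · exact Or.inr (Or.inr (hV x hx))

theorem notMem_of_exploredAt (hE : Explores σ τ V h F V' e) (hτ : Function.Involutive τ)
    (hV : ∀ x ∈ V, τ x ∈ V) (hx : ExploredAt τ F l x) : x ∉ V := by
  induction hE generalizing l with
  | nil => exact (not_exploredAt_nil hx).elim
  | @cons V _ _ h _ _ _ _ hh below _ _ ihcs ihts =>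
    have hV₀ := closed_insert (h := h) hτ hV
    rcases (exploredAt_cons hτ).1 hx with hx | ⟨-, rfl | rfl⟩ | ⟨m, -, hx⟩
    · intro hxV
      exact ihts (fun _ => below.closed hτ hV₀) hx ((below.mem_iff hτ).2 (by simp [hxV]))
    · exact hh
    · exact fun hτh => hh (hτ h ▸ hV (τ h) hτh)
    · intro hxV
      exact ihcs hV₀ hx (by simp [hxV])

theorem eq_of_exploredAt (hE : Explores σ τ V h F V' e) (hτ : Function.Involutive τ)
    (hV : ∀ x ∈ V, τ x ∈ V) (hl : ExploredAt τ F l x) (hm : ExploredAt τ F m x) : l = m := by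
  induction hE generalizing l m with
  | nil => exact (not_exploredAt_nil hl).elim
  | @cons V V₁ _ h _ _ _ _ _ below _ next ihcs ihts =>
    have hV₀ := closed_insert (h := h) hτ hV
    have hV₁ : ∀ x ∈ V₁, τ x ∈ V₁ := fun _ => below.closed hτ hV₀
    have notMem_of_next {k} := next.notMem_of_exploredAt (x := x) (l := k) hτ hV₁
    have notMem_of_below {k} := below.notMem_of_exploredAt (x := x) (l := k) hτ hV₀
    simp only [below.mem_iff hτ, Finset.mem_insert] at notMem_of_next notMem_of_below
    rcases (exploredAt_cons hτ).1 hl with hl | ⟨rfl, hl⟩ | ⟨l, rfl, hl⟩ <;>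
      rcases (exploredAt_cons hτ).1 hm with hm | ⟨rfl, hm⟩ | ⟨m, rfl, hm⟩
    · exact ihts hV₁ hl hm
    all_goals grind

-- The loop at a node turns clockwise, from the half-edge `h` after the edge to the parent to the
-- end `e`, so the children are met from right to left.
theorem apply_last_child (hE : Explores σ τ V h F V' e) (hτ : Function.Involutive τ)
    (hb : ForestAt F [i] b) (hi : i + 1 = F.length) : τ b = h := by
  cases hE with
  | nil => exact (not_forestAt_nil hb).elim
  | cons =>
    rw [List.length_cons, Nat.add_right_cancel_iff] at hi
    rw [hi, forestAt_cons_length] at hb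
    rw [hb, hτ]

theorem apply_left_sibling (hE : Explores σ τ V h F V' e) (hτ : Function.Involutive τ)
    (hb : ForestAt F [i + 1] b) (hc : ForestAt F [i] c) : τ c = σ (τ b) := by
  induction hE with
  | nil => exact (not_forestAt_nil hb).elim
  | cons _ _ _ next _ ih =>
    rcases (Nat.lt_succ_iff.1 hb.lt_length).lt_or_eq with hi | hi
    · rw [forestAt_cons_of_lt hi] at hb
      rw [forestAt_cons_of_lt (Nat.lt_of_succ_lt hi)] at hc
      exact ih hb hc
    · rw [hi, forestAt_cons_length] at hb
      rw [forestAt_cons_of_lt (hi ▸ Nat.lt_succ_self i)] at hc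
      rw [hb, hτ, next.apply_last_child hτ hc hi]

theorem end_eq (hE : Explores σ τ V h F V' e) (hτ : Function.Involutive τ)
    (hb : ForestAt F [0] b) : e = σ (τ b) := by
  induction hE with
  | nil => exact (not_forestAt_nil hb).elim
  | @cons _ _ _ _ _ _ _ ts _ _ _ next _ ih =>
    rcases ts.length.eq_zero_or_pos with hts | hts
    · obtain rfl := List.length_eq_zero_iff.1 hts
      rw [show 0 = [].length from rfl, forestAt_cons_length] at hb
      cases next
      rw [hb, hτ]
    · exact ih ((forestAt_cons_of_lt hts).1 hb)

end Explores

theorem exists_explores [Fintype D] [DecidableEq D] (V : Finset D) (h : D) :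
    ∃ e ∈ (explore σ τ V h).2, Explores σ τ V h (explore σ τ V h).1 (explore σ τ V h).2 e := by
  induction hn : Vᶜ.card using Nat.strong_induction_on generalizing V h with
  | _ n ih =>
    by_cases hV : h ∈ V
    · rw [explore_of_mem σ τ hV]
      exact ⟨h, hV, .nil V h⟩
    · set W := insert h (insert (τ h) V) with hW
      have card_lt {U : Finset D} (hU : W ⊆ U) : Uᶜ.card < n := by
        refine hn ▸ Finset.card_lt_card (Finset.compl_ssubset_compl.2 ?_)
        exact ⟨fun x hx => hU (by simp [hW, hx]), fun hUV => hV (hUV (hU (by simp [hW])))⟩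
      obtain ⟨e₁, he₁, below⟩ := ih _ (card_lt subset_rfl) W (σ (τ h)) rfl
      obtain ⟨e₂, he₂, next⟩ := ih _ (card_lt (subset_explore σ τ W _)) _ (σ h) rfl
      rw [explore_of_notMem σ τ hV]
      exact ⟨e₂, he₂, .cons hV below he₁ next⟩

/-- The half-edge `e` has been visited before the loop at the node `l` ends. -/
def VisitedBelow (τ : Equiv.Perm D) (V : Finset D) (F : List (PlaneTree D)) (l : List ℕ) (e : D) :
    Prop :=
  e ∈ V ∨ ∃ m, ExploredAt τ F m e ∧ (l ≤ m ∨ m <+: l)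

namespace Explores

variable [DecidableEq D] {V V' V₁ V₂ : Finset D} {e : D}

theorem visitedBelow_of_below (hτ : Function.Involutive τ)
    (hx : VisitedBelow τ (insert h (insert (τ h) V)) cs m x) :
    VisitedBelow τ V (node (τ h) cs :: ts) (ts.length :: m) x := by
  simp only [VisitedBelow, exploredAt_cons hτ, Finset.mem_insert] at hx ⊢
  rcases hx with (hx | hx | hx) | ⟨m', hx, hm⟩
  · exact Or.inr ⟨_, Or.inr (Or.inl ⟨rfl, Or.inl hx⟩), Or.inr (by simp)⟩
  · exact Or.inr ⟨_, Or.inr (Or.inl ⟨rfl, Or.inr hx⟩), Or.inr (by simp)⟩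
  · exact Or.inl hx
  · refine Or.inr ⟨_, Or.inr (Or.inr ⟨m', rfl, hx⟩), ?_⟩
    exact hm.imp (append_le_append_iff [ts.length]).2 (by simp)

theorem visitedBelow_of_next (below : Explores σ τ (insert h (insert (τ h) V)) a cs V₁ e)
    (hτ : Function.Involutive τ) (hi : i < ts.length) (hx : VisitedBelow τ V₁ ts (i :: m) x) :
    VisitedBelow τ V (node (τ h) cs :: ts) (i :: m) x := by
  have hlt (m' : List ℕ) : i :: m ≤ ts.length :: m' := (List.cons_lt_cons_iff.2 (Or.inl hi)).le
  simp only [VisitedBelow, exploredAt_cons hτ, below.mem_iff hτ, Finset.mem_insert] at hx ⊢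
  rcases hx with ((hx | hx | hx) | ⟨m', hx⟩) | ⟨m', hx, hm⟩
  · exact Or.inr ⟨_, Or.inr (Or.inl ⟨rfl, Or.inl hx⟩), Or.inl (hlt _)⟩
  · exact Or.inr ⟨_, Or.inr (Or.inl ⟨rfl, Or.inr hx⟩), Or.inl (hlt _)⟩
  · exact Or.inl hx
  · exact Or.inr ⟨_, Or.inr (Or.inr ⟨m', rfl, hx⟩), Or.inl (hlt _)⟩
  · exact Or.inr ⟨m', Or.inl hx, hm⟩

theorem visitedBelow_nil (hE : Explores σ τ V h F V' e) (hτ : Function.Involutive τ)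
    (hx : x ∈ V') : VisitedBelow τ V F [] x :=
  ((hE.mem_iff hτ).1 hx).imp_right fun ⟨l, hl⟩ => ⟨l, hl, Or.inl (le_of_prefix l.nil_prefix)⟩

theorem exists_below (hE : Explores σ τ V h F V' e) (hτ : Function.Involutive τ)
    (ha : ForestAt F l a) :
    ∃ W cs W' e', Explores σ τ W (σ a) cs W' e' ∧ VisitedBelow τ V F l e' ∧
      ∀ i b, ForestAt F (l ++ [i]) b ↔ ForestAt cs [i] b := by
  induction hE generalizing l with
  | nil => exact (not_forestAt_nil ha).elim
  | @cons V V₁ _ h e₁ _ cs ts _ below he₁ _ ihcs ihts =>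
    rcases forestAt_cons.1 ha with ha | ⟨rfl, rfl⟩ | ⟨m, rfl, hm⟩
    · obtain ⟨j, m, rfl, hj⟩ := ha.exists_cons
      obtain ⟨W, ds, W', e', hE, he', hds⟩ := ihts ha
      exact ⟨W, ds, W', e', hE, visitedBelow_of_next below hτ hj he',
        fun i b => (forestAt_cons_of_lt hj).trans (hds i b)⟩
    · exact ⟨_, cs, V₁, e₁, below, visitedBelow_of_below hτ (below.visitedBelow_nil hτ he₁),
        fun i b => forestAt_cons_length_cons (by simp)⟩
    · obtain ⟨W, ds, W', e', hE, he', hds⟩ := ihcs hm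
      exact ⟨W, ds, W', e', hE, visitedBelow_of_below hτ he',
        fun i b => (forestAt_cons_length_cons (by simp)).trans (hds i b)⟩

end Explores

end Explores

/-! ## The exploration of a glued tree -/

namespace PlaneTree

section WithAddr

variable {α : Type}

mutual
/-- The tree in which each node carries also its address, preceded by `pre`. -/
def withAddr (pre : List ℕ) : PlaneTree α → PlaneTree (List ℕ × α)
  | node a cs => node (pre, a) (withAddrForest pre 0 cs)
/-- The same for the forest of the sub-trees of the node at the address `pre`, from the `i`-th. -/
def withAddrForest (pre : List ℕ) : ℕ → List (PlaneTree α) → List (PlaneTree (List ℕ × α))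
  | _, [] => []
  | i, t :: ts => withAddr (pre ++ [i]) t :: withAddrForest pre (i + 1) ts
end

theorem mapForest_snd_withAddrForest (pre : List ℕ) (i : ℕ) (ts : List (PlaneTree α)) :
    mapForest Prod.snd (withAddrForest pre i ts) = ts := by
  induction ts using forest_induction generalizing pre i with
  | nil => rw [withAddrForest, mapForest]
  | cons a cs ts ihcs ihts => rw [withAddrForest, withAddr, mapForest, map, ihcs, ihts]

theorem map_snd_withAddr (pre : List ℕ) (T : PlaneTree α) : (T.withAddr pre).map Prod.snd = T := by
  cases T with
  | node a cs => rw [withAddr, map, mapForest_snd_withAddrForest]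

theorem forestNodes_withAddrForest (pre : List ℕ) (i : ℕ) (ts : List (PlaneTree α)) :
    forestNodes i (withAddrForest pre i ts) =
      (forestNodes i ts).map fun x => (x.1, (pre ++ x.1, x.2)) := by
  induction ts using forest_induction generalizing pre i with
  | nil => simp only [withAddrForest, forestNodes, List.map_nil]
  | cons a cs ts ihcs ihts =>
    simp only [withAddrForest, withAddr, forestNodes, nodes, ihcs, ihts, List.map_cons,
      List.map_append, List.map_map, Function.comp_def, List.append_assoc, List.singleton_append]

theorem nodes_withAddr (pre : List ℕ) (T : PlaneTree α) :
    (T.withAddr pre).nodes = T.nodes.map fun x => (x.1, (pre ++ x.1, x.2)) := by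
  cases T with
  | node a cs => simp [withAddr, nodes, forestNodes_withAddrForest]

end WithAddr

section FirstVisit

variable {α : Type} {p : α → Bool}

theorem ForestAt.exists_mem_forestNodes {F : List (PlaneTree α)} {l : List ℕ} {x : α}
    (h : ForestAt F l x) (i : ℕ) : ∃ m, (m, x) ∈ forestNodes i F := by
  induction F using forest_induction generalizing l i with
  | nil => exact (not_forestAt_nil h).elim
  | cons a cs ts ihcs ihts =>
    simp only [forestNodes, nodes, List.mem_append, List.mem_map, List.mem_cons, Prod.mk.injEq]
    rcases forestAt_cons.1 h with h | ⟨-, rfl⟩ | ⟨m, -, h⟩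
    · exact (ihts h (i + 1)).imp fun _ => Or.inr
    · exact ⟨[i], Or.inl ⟨([], x), Or.inl rfl, rfl, rfl⟩⟩
    · obtain ⟨m', hm'⟩ := ihcs h 0
      exact ⟨i :: m', Or.inl ⟨(m', x), Or.inr hm', rfl, rfl⟩⟩

theorem find?_forestNodes_mirrorForest {F : List (PlaneTree α)}
    (hF : ∀ x ∈ forestNodes 0 F, p x.2 = false) :
    (forestNodes 0 (mirrorForest F)).find? (fun x => p x.2) = none := by
  refine List.find?_eq_none.2 fun ⟨l, x⟩ hx => ?_
  obtain ⟨m, hm⟩ := ForestAt.exists_mem_forestNodes (F := F) hx 0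
  simp [hF _ hm]

theorem nodes_mirror_node_append (b : α) (F G : List (PlaneTree α)) (t : PlaneTree α) :
    (node b (F ++ t :: G)).mirror.nodes = ([], b) :: (forestNodes 0 (mirrorForest G) ++
      (t.mirror.nodes.map (fun x => (G.length :: x.1, x.2)) ++
        forestNodes (G.length + 1) (mirrorForest F))) := by
  simp only [mirror, nodes, mirrorForest_append, mirrorForest, forestNodes_append,
    List.append_assoc, length_mirrorForest, List.length_singleton, forestNodes, List.append_nil,
    zero_add]

theorem find?_nodes_mirror {T : PlaneTree α} {l : List ℕ} {a : α} (ha : (l, a) ∈ T.nodes)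
    (hp : p a = true) (hbelow : ∀ m b, (m, b) ∈ T.nodes → p b = true → l <+: m) :
    (T.mirror.nodes.find? fun x => p x.2).map (fun x => x.1.length) = some l.length := by
  induction l generalizing T with
  | nil =>
    obtain ⟨b, cs⟩ := T
    obtain rfl := mem_nodes_nil.1 ha
    simp [mirror, nodes, hp]
  | cons i l ih =>
    obtain ⟨b, cs⟩ := T
    obtain ⟨t, ht, hat⟩ := mem_nodes_cons.1 ha
    have hb : p b = false := by
      by_contra h
      exact absurd (hbelow [] b (mem_nodes_nil.2 rfl) (by simpa using h)) (by simp)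
    have hright : ∀ x ∈ forestNodes 0 (cs.drop (i + 1)), p x.2 = false := by
      intro x hx
      by_contra h
      obtain ⟨j, s, m, hs, hm, -⟩ := mem_forestNodes.1 hx
      rw [List.getElem?_drop] at hs
      have hij := (List.cons_prefix_cons.1
        (hbelow _ _ (mem_nodes_cons.2 ⟨s, hs, hm⟩) (by simpa using h))).1
      omega
    obtain ⟨y, hy, hyl⟩ := Option.map_eq_some_iff.1 <| ih hat fun m c hm hc =>
      (List.cons_prefix_cons.1 (hbelow _ c (mem_nodes_cons.2 ⟨t, ht, hm⟩) hc)).2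
    obtain ⟨hi, rfl⟩ := List.getElem?_eq_some_iff.1 ht
    have hcs : cs = cs.take i ++ cs[i] :: cs.drop (i + 1) := by
      rw [List.getElem_cons_drop, List.take_append_drop]
    rw [hcs, nodes_mirror_node_append, List.find?_cons_of_neg (by simp [hb]), List.find?_append,
      find?_forestNodes_mirrorForest hright, Option.none_or, List.find?_append, List.find?_map,
      Function.comp_def, hy]
    simp [hyl]

theorem vertexLabel_eq (M : RotationSystem) {x b : M.D} {l : List ℕ}
    (hb : (l, b) ∈ M.searchTree.mirror.nodes) (hbx : M.σ.SameCycle b x)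
    (hmin : ∀ m c, (m, c) ∈ M.searchTree.mirror.nodes → M.σ.SameCycle c x → l <+: m) :
    M.vertexLabel x = l.length := by
  have hfind := find?_nodes_mirror (p := fun y => decide (M.σ.SameCycle y x)) hb
    (decide_eq_true hbx) fun m c hm hc => hmin m c hm (of_decide_eq_true hc)
  rw [mirror_mirror] at hfind
  rw [vertexLabel, hfind, Option.getD_some]

end FirstVisit

variable {T : PlaneTree ℕ} {π : Equiv.Perm T.Node} {ρ : Equiv.Perm T.HalfEdge} {l : List ℕ}
  {i k : ℕ} {v w : T.Edge} {x : T.HalfEdge}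

/-- Every node is sent by `π` to one of its ancestors, to itself, or to a later node in prefix
order.  For a gluing along `π` this says that, when the loop of the exploration has run through the
children of a node, it meets next a half-edge that has been visited. -/
def Advances (π : Equiv.Perm T.Node) : Prop :=
  ∀ u : T.Node, (π u).1.1 <+: u.1.1 ∨ u.1.1 < (π u).1.1

/-- `v` is the right-most edge of the root node. -/
def Edge.IsRightmost (v : T.Edge) : Prop := ∃ i, v.1.1 = [i] ∧ ¬ T.Has [i + 1]

theorem Edge.has_zero (v : T.Edge) : T.Has [0] := by
  obtain ⟨j, hj⟩ := exists_concat_prefix List.nil_prefix v.ne_nil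
  exact Has.of_le (l := []) (v.has.of_prefix hj) j.zero_le

open Classical in
/-- The half-edges visited when, at the node `l`, the children from the `i`-th on have been
explored. -/
noncomputable def visited (T : PlaneTree ℕ) (l : List ℕ) (i : ℕ) : Finset T.HalfEdge :=
  Finset.univ.filter fun x => x.1.1.1 <+: l ∨ l ++ [i] ≤ x.1.1.1

/-- `x` is the half-edge to be inspected when, at the node `l`, the children from the `i`-th on have
been explored: the next child edge if there is one, and otherwise the first half-edge after the plug
to which the plug of `l` is glued. -/
def Inspects (π : Equiv.Perm T.Node) (l : List ℕ) : ℕ → T.HalfEdge → Prop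
  | 0, x => ∀ u : T.Node, u.1.1 = l → T.initialRotation (Sum.inr (π u)) = Sum.inl x
  | i + 1, x => ∀ w : T.Edge, w.1.1 = l ++ [i] → x = (w, true)

theorem mem_visited : x ∈ T.visited l i ↔ x.1.1.1 <+: l ∨ l ++ [i] ≤ x.1.1.1 := by
  simp [visited]

theorem concat_zero_le_of_lt {l m : List ℕ} (h : l < m) : l ++ [0] ≤ m := by
  by_cases hp : l <+: m
  · obtain ⟨j, r, rfl⟩ := exists_concat_prefix hp h.ne'
    rw [List.append_assoc, append_le_append_iff, ← not_lt]
    simp [List.cons_lt_cons_iff]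
  · exact (lt_of_lt_of_not_prefix h hp (List.prefix_append _ _)).le

theorem visited_concat_zero (l : List ℕ) (i : ℕ) : T.visited (l ++ [i]) 0 = T.visited l i := by
  have hle (m : List ℕ) : l ++ [i] ++ [0] ≤ m ↔ l ++ [i] < m :=
    ⟨(lt_append_cons _ 0 []).trans_le, concat_zero_le_of_lt⟩
  ext x
  rw [mem_visited, mem_visited, hle, List.prefix_concat_iff, le_iff_eq_or_lt,
    eq_comm (a := l ++ [i])]
  tauto

theorem visited_nil_of_forall_has (hk : ∀ j, T.Has [j] → j < k) : T.visited [] k = ∅ := by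
  ext x
  rw [mem_visited, List.nil_append]
  refine iff_of_false ?_ (Finset.notMem_empty x)
  rintro (h | h)
  · exact x.1.ne_nil (List.prefix_nil.1 h)
  · obtain ⟨j, hj⟩ := exists_concat_prefix List.nil_prefix x.1.ne_nil
    have hjk := hk j (x.1.has.of_prefix hj)
    exact absurd (lt_concat_of_prefix (l := []) hjk hj) (not_lt.2 h)

theorem mem_visited_nil_zero (x : T.HalfEdge) : x ∈ T.visited [] 0 :=
  mem_visited.2 <| Or.inr <| concat_zero_le_of_lt <|
    lt_of_le_of_ne (not_lt.1 (List.not_lt_nil _)) x.1.ne_nil.symm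

theorem notMem_visited_succ (hw : w.1.1 = l ++ [i]) : (w, true) ∉ T.visited l (i + 1) := by
  rw [mem_visited, hw]
  rintro (h | h)
  · simpa using h.length_le
  · exact absurd (lt_concat_of_prefix i.lt_succ_self List.prefix_rfl) (not_lt.2 h)

theorem insert_visited (hw : w.1.1 = l ++ [i]) (hk : ∀ j, T.Has (l ++ [i] ++ [j]) ↔ j < k) :
    insert (w, true) (insert (T.flip (w, true)) (T.visited l (i + 1))) =
      T.visited (l ++ [i]) k := by
  have hle : ∀ v : T.Edge, l ++ [i + 1] ≤ v.1.1 ↔ l ++ [i] ++ [k] ≤ v.1.1 := by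
    intro v
    refine ⟨(lt_concat_of_prefix i.lt_succ_self (List.prefix_append _ _)).le.trans, fun h => ?_⟩
    by_contra hlt
    have hiv : l ++ [i] < v.1.1 := (lt_append_cons _ k []).trans_le h
    obtain ⟨j, hj⟩ := exists_concat_prefix
      (concat_prefix_of_le_of_lt hiv.le (not_le.1 hlt)) hiv.ne'
    exact absurd (lt_concat_of_prefix ((hk j).1 (v.has.of_prefix hj)) hj) (not_lt.2 h)
  have heq (v : T.Edge) : v.1.1 = l ++ [i] ↔ v = w :=
    ⟨fun h => Edge.ext (h.trans hw.symm), (· ▸ hw)⟩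
  ext ⟨v, b⟩
  simp only [Finset.mem_insert, mem_visited, flip_apply, List.prefix_concat_iff, heq, hle,
    Prod.mk.injEq]
  cases b <;> simp [or_assoc]

theorem Inspects.mem_visited (hπ : Advances π) (hx : Inspects π w.1.1 0 x) :
    x ∈ T.visited w.1.1 0 := by
  have hx := hx w.toNode rfl
  have hadv := hπ w.toNode
  rw [PlaneTree.mem_visited]
  rcases (π w.toNode).eq_root_or_edge with hroot | ⟨v, hv⟩
  · obtain ⟨k, hk, hlast⟩ := Has.exists_last_child (l := []) w.has_zero
    obtain ⟨c, hc⟩ := hk.exists_child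
    rw [initialRotation_plug_root hroot hc hlast] at hx
    obtain rfl := Sum.inl_injective hx
    obtain ⟨j, m, hjm⟩ := List.exists_cons_of_ne_nil w.ne_nil
    have hj : T.Has ([] ++ [j]) := w.has.of_prefix (by simp [hjm])
    have hjk : j ≤ k := by
      by_contra! hlt
      exact hlast (hj.of_le hlt)
    rw [hc, List.nil_append, hjm]
    rcases hjk.lt_or_eq with hjk | rfl
    · exact Or.inr (concat_zero_le_of_lt (List.cons_lt_cons_iff.2 (Or.inl hjk)))
    · exact Or.inl (by simp)
  · rw [← hv, initialRotation_plug] at hx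
    obtain rfl := Sum.inl_injective hx
    rw [← hv] at hadv
    exact hadv.imp_right concat_zero_le_of_lt

theorem IsGlued.inspects_down (h : IsGlued π ρ) (hk : ∀ j, T.Has (w.1.1 ++ [j]) ↔ j < k) :
    Inspects π w.1.1 k (ρ (w, false)) := by
  cases k with
  | zero =>
    intro u hu
    obtain rfl : u = w.toNode := Node.ext hu
    exact h.inr (initialRotation_leaf (by simp [hk]))
  | succ k => exact fun c hc => h.inl (initialRotation_down hc (by simp [hk]))

theorem IsGlued.inspects_up (h : IsGlued π ρ) (hw : w.1.1 = l ++ [i]) :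
    Inspects π l i (ρ (w, true)) := by
  cases i with
  | zero => exact fun u hu => h.inr (initialRotation_up (hw.trans (by rw [hu])))
  | succ i => exact fun c hc => h.inl (initialRotation_left hw hc)

theorem exists_explores_glued (h : IsGlued π ρ) (hπ : Advances π) {b : ℕ}
    {ds ts : List (PlaneTree ℕ)} (hl : T.subtree? l = some (node b (ds ++ ts)))
    (hx : Inspects π l (ds ++ ts).length x) :
    ∃ F y, Explores ρ T.flip (T.visited l (ds ++ ts).length) x F (T.visited l ds.length) y ∧
      Inspects π l ds.length y ∧
      mapForest (fun x => (owner x).1) F = mirrorForest (withAddrForest l ds.length ts) := by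
  induction ts using forest_induction generalizing l b ds x with
  | nil =>
    rw [List.append_nil] at hx ⊢
    exact ⟨[], x, .nil _ _, hx, by simp only [mapForest, withAddrForest, mirrorForest]⟩
  | cons a cs ts ihcs ihts =>
    have hli : T.subtree? (l ++ [ds.length]) = some (node a cs) := by
      simp [subtree?_append, hl, subtree?]
    have ha : (l ++ [ds.length], a) ∈ T.nodes := mem_nodes_iff_subtree?.2 ⟨cs, hli⟩
    obtain ⟨w, hw⟩ := Has.exists_child ⟨a, ha⟩
    have hwa : w.1 = (l ++ [ds.length], a) := Prod.ext hw (eq_of_mem_nodes w.toNode.2 (hw ▸ ha))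
    have happend : ds ++ node a cs :: ts = ds ++ [node a cs] ++ ts := by simp
    rw [happend] at hl hx ⊢
    obtain ⟨F, y, hF, hy, hFm⟩ := ihts hl hx
    rw [List.length_append (as := ds), List.length_singleton] at hF hy hFm
    obtain rfl := hy w hw
    have hk := fun j => has_concat_iff hli (i := j)
    obtain ⟨G, z, hG, hz, hGm⟩ := ihcs (ds := []) hli (hw ▸ h.inspects_down (by rwa [hw]))
    have hz := (hw ▸ hz : Inspects π w.1.1 0 z).mem_visited hπ
    rw [hw, visited_concat_zero] at hz
    rw [List.nil_append, ← insert_visited hw hk, List.length_nil, visited_concat_zero] at hG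
    have hstep := Explores.cons (notMem_visited_succ hw) hG hz (.nil _ _)
    refine ⟨_, _, hF.append hstep, h.inspects_up hw, ?_⟩
    rw [mapForest_append, hFm, withAddrForest, mirrorForest, withAddr, mirror]
    rw [List.length_nil] at hGm
    rw [← hGm, mapForest, mapForest, map, flip_apply, Bool.not_true, owner_false, Edge.toNode_val,
      hwa]

/-- The node of `T` to which a half-edge of the map glued from `T` is attached. -/
noncomputable def nodeOf (ρ : Equiv.Perm T.HalfEdge) (r : T.HalfEdge)
    (x : (T.toRotationSystem ρ r).D) : T.Node := owner (T := T) x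

theorem Edge.IsRightmost.addr_owner (hv : v.IsRightmost) : (owner (v, true)).1.1 = [] := by
  obtain ⟨i, hi, -⟩ := hv
  rw [owner_true, v.parent_addr, hi, List.dropLast_singleton]

theorem Edge.IsRightmost.inspects (hv : v.IsRightmost) (hk : ∀ j, T.Has [j] ↔ j < k) :
    Inspects π [] k (v, true) := by
  obtain ⟨i, hi, hlast⟩ := hv
  obtain rfl : k = i + 1 := by
    have hik := (hk i).1 (hi ▸ v.has)
    rw [hk] at hlast
    omega
  intro w hw
  rw [Edge.ext (hw.trans hi.symm)]

theorem map_nodeOf_searchTree (h : IsGlued π ρ) (hπ : Advances π) (hv : v.IsRightmost) :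
    (T.toRotationSystem ρ (v, true)).searchTree.mirror.map (fun x => (nodeOf ρ (v, true) x).1) =
      T.withAddr [] := by
  obtain ⟨a, cs, hT⟩ : ∃ a cs, T = node a cs := by
    cases T with
    | node a cs => exact ⟨a, cs, rfl⟩
  have hcs : T.subtree? [] = some (node a ([] ++ cs)) := by rw [subtree?, hT, List.nil_append]
  have hk := fun j => has_concat_iff hcs (i := j)
  obtain ⟨F, y, hF, -, hFm⟩ := exists_explores_glued h hπ hcs (hv.inspects hk)
  rw [visited_nil_of_forall_has fun j => (hk j).1] at hF
  have hsearch : (explore ρ T.flip ∅ (v, true)).1 = F := by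
    rw [hF.explore_eq (mem_visited_nil_zero y)]
  have hroot : (owner (v, true)).1 = ([], a) :=
    Prod.ext hv.addr_owner (eq_of_mem_nodes (hv.addr_owner ▸ (owner (v, true)).2)
      (mem_nodes_iff_subtree?.2 ⟨_, hcs⟩))
  have hmap : (T.toRotationSystem ρ (v, true)).searchTree.map (fun x => (nodeOf ρ (v, true) x).1) =
      node ([], a) (mirrorForest (withAddrForest [] 0 cs)) := by
    rw [← hroot, ← List.length_nil, ← hFm, ← hsearch]
    rfl
  rw [map_mirror, hmap, mirror, mirrorForest_mirrorForest, hT, withAddr]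

theorem addr_nodeOf (h : IsGlued π ρ) (hπ : Advances π) (hv : v.IsRightmost) {m : List ℕ}
    {b : (T.toRotationSystem ρ (v, true)).D}
    (hb : (m, b) ∈ (T.toRotationSystem ρ (v, true)).searchTree.mirror.nodes) :
    (nodeOf ρ (v, true) b).1.1 = m := by
  have hmem := List.mem_map_of_mem (f := fun x => (x.1, (nodeOf ρ (v, true) x.2).1)) hb
  rw [← nodes_map (fun x => (nodeOf ρ (v, true) x).1), map_nodeOf_searchTree h hπ hv,
    nodes_withAddr] at hmem
  obtain ⟨y, -, hy⟩ := List.mem_map.1 hmem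
  simp only [List.nil_append, Prod.mk.injEq] at hy
  rw [← hy.2, ← hy.1]

theorem exists_mem_nodes_searchTree (h : IsGlued π ρ) (hπ : Advances π) (hv : v.IsRightmost)
    (u : T.Node) : ∃ b : (T.toRotationSystem ρ (v, true)).D,
      (u.1.1, b) ∈ (T.toRotationSystem ρ (v, true)).searchTree.mirror.nodes ∧
        nodeOf ρ (v, true) b = u := by
  have hu : (T.withAddr []).Has u.1.1 := by
    rw [← has_map, map_snd_withAddr]
    exact u.has
  rw [← map_nodeOf_searchTree h hπ hv, has_map] at hu
  obtain ⟨b, hb⟩ := hu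
  exact ⟨b, hb, Node.ext (addr_nodeOf h hπ hv hb)⟩

theorem vertexLabel_glued (h : IsGlued π ρ) (hπ : Advances π) (hv : v.IsRightmost) {u : T.Node}
    (hu : π.SameCycle u (owner x)) (hmin : ∀ w, π.SameCycle w (owner x) → u.1.1 <+: w.1.1) :
    (T.toRotationSystem ρ (v, true)).vertexLabel x = u.1.1.length := by
  have hT := v.has_zero
  obtain ⟨b, hb, rfl⟩ := exists_mem_nodes_searchTree h hπ hv u
  refine vertexLabel_eq _ hb ((h.sameCycle_iff hT b x).2 hu) fun m c hm hc => ?_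
  rw [← addr_nodeOf h hπ hv hm]
  exact hmin _ ((h.sameCycle_iff hT c x).1 hc)

end PlaneTree

/-! ## Every connected map is a glued tree -/

namespace PlaneTree

variable {T : PlaneTree ℕ}

theorem exists_isGlued (hT : T.Has [0]) {ρ : Equiv.Perm T.HalfEdge}
    (hρ : ∀ {x y}, T.initialRotation (Sum.inl x) = Sum.inl y → ρ x = y) :
    ∃ π : Equiv.Perm T.Node, IsGlued π ρ := by
  choose x hx using exists_initialRotation_eq_plug hT
  have hpred (u : T.Node) : ∃ w, T.initialRotation (Sum.inr w) = Sum.inl (ρ (x u)) := by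
    rcases h : T.initialRotation.symm (Sum.inl (ρ (x u))) with y | w
    · rw [Equiv.symm_apply_eq, eq_comm] at h
      have hux := hx u
      rw [← ρ.injective (hρ h), h] at hux
      simp at hux
    · exact ⟨w, by rw [← h, Equiv.apply_symm_apply]⟩
  choose f hf using hpred
  have hinj : Function.Injective f := by
    intro u w huw
    have hu := hf u
    rw [huw, hf w] at hu
    have hxu := hx u
    rw [← ρ.injective (Sum.inl_injective hu), hx w] at hxu
    exact (Sum.inr_injective hxu).symm
  refine ⟨Equiv.ofBijective f (Finite.injective_iff_bijective.1 hinj), hρ, fun {y u} hy => ?_⟩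
  obtain rfl : y = x u := Sum.inl_injective (T.initialRotation.injective (hy.trans (hx u).symm))
  exact hf u

theorem exists_isRightmost (hT : T.Has [0]) : ∃ v : T.Edge, v.IsRightmost := by
  obtain ⟨i, hi, hlast⟩ := Has.exists_last_child (l := []) hT
  obtain ⟨v, hv⟩ := hi.exists_child
  exact ⟨v, i, hv, hlast⟩

end PlaneTree

namespace RotationSystem

variable {M : RotationSystem}

theorem ConnectedBy.iff_of_forall {A : Set M.D} {S : M.D → Prop} (hA : M.ConnectedBy A)
    (hσ : ∀ a, S a → S (M.σ a)) (hτ : ∀ a ∈ A, S a ↔ S (M.τ a)) (x y : M.D) : S x ↔ S y := by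
  induction hA x y with
  | rel a b h =>
    rcases h with h | ⟨ha, rfl⟩
    · exact ⟨sameCycle_induction hσ h, sameCycle_induction hσ h.symm⟩
    · exact hτ a ha
  | refl a => exact Iff.rfl
  | symm a b _ ih => exact ih.symm
  | trans a b c _ _ ihab ihbc => exact ihab.trans ihbc

/-- The trees hanging from the root of the exploration tree, in the order of their exploration. -/
def searchForest (M : RotationSystem) : List (PlaneTree M.D) := (explore M.σ M.τ ∅ M.root).1

theorem labelledTree_eq (M : RotationSystem) :
    M.labelledTree = M.searchTree.mirror.map M.vertexLabel := by
  rw [labelledTree, PlaneTree.map_mirror]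

theorem has_labelledTree_iff {l : List ℕ} (hl : l ≠ []) :
    M.labelledTree.Has l ↔ ∃ a, ForestAt M.searchForest l a := by
  rw [labelledTree_eq, has_map]
  simp [Has, searchTree, searchForest, mirror, nodes, ForestAt, hl]

theorem exists_carried (v : M.labelledTree.Edge) : ∃ a, ForestAt M.searchForest v.1.1 a :=
  (has_labelledTree_iff v.ne_nil).1 v.has

/-- The half-edge of the map carried by the lower end of an edge of the exploration tree. -/
noncomputable def carried (v : M.labelledTree.Edge) : M.D := (exists_carried v).choose

theorem forestAt_carried (v : M.labelledTree.Edge) : ForestAt M.searchForest v.1.1 (carried v) :=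
  (exists_carried v).choose_spec

/-- The half-edge of the map that gave rise to a half-edge of its exploration tree. -/
noncomputable def dart : M.labelledTree.HalfEdge → M.D
  | (v, false) => carried v
  | (v, true) => M.τ (carried v)

theorem dart_flip (x : M.labelledTree.HalfEdge) : dart (M.labelledTree.flip x) = M.τ (dart x) := by
  obtain ⟨v, _ | _⟩ := x
  · rfl
  · exact (M.τ_τ _).symm

theorem exploredAt_dart (x : M.labelledTree.HalfEdge) :
    ExploredAt M.τ M.searchForest x.1.1.1 (dart x) := by
  obtain ⟨v, _ | _⟩ := x
  · exact ⟨_, forestAt_carried v, Or.inl rfl⟩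
  · exact ⟨_, forestAt_carried v, Or.inr rfl⟩

theorem exists_dart_eq {l : List ℕ} {a : M.D} (ha : ExploredAt M.τ M.searchForest l a) :
    ∃ x : M.labelledTree.HalfEdge, x.1.1.1 = l ∧ dart x = a := by
  obtain ⟨b, hb, h⟩ := ha
  obtain ⟨v, rfl⟩ := ((has_labelledTree_iff hb.ne_nil).2 ⟨b, hb⟩).exists_edge hb.ne_nil
  obtain rfl := (forestAt_carried v).unique hb
  rcases h with rfl | rfl
  · exact ⟨(v, false), rfl, rfl⟩
  · exact ⟨(v, true), rfl, rfl⟩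

theorem exists_explores_searchForest (M : RotationSystem) :
    ∃ V e, Explores M.σ M.τ ∅ M.root M.searchForest V e ∧ e ∈ V := by
  obtain ⟨e, he, hE⟩ := exists_explores (σ := M.σ) (τ := M.τ) ∅ M.root
  exact ⟨_, e, hE, he⟩

theorem dart_injective : Function.Injective (dart (M := M)) := by
  obtain ⟨V, e, hE, -⟩ := M.exists_explores_searchForest
  intro x y hxy
  have hedge : x.1 = y.1 := Edge.ext <| hE.eq_of_exploredAt M.τ_τ (by simp)
    (exploredAt_dart x) (hxy ▸ exploredAt_dart y)
  obtain ⟨v, b⟩ := x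
  obtain ⟨w, b'⟩ := y
  obtain rfl : v = w := hedge
  cases b <;> cases b' <;> first | rfl | exact (M.τ_ne _ hxy).elim | exact (M.τ_ne _ hxy.symm).elim

theorem has_zero_labelledTree (M : RotationSystem) : M.labelledTree.Has [0] := by
  obtain ⟨V, e, hE, he⟩ := M.exists_explores_searchForest
  obtain h | ⟨l, hl⟩ := (hE.mem_iff M.τ_τ).1 he
  · exact (Finset.notMem_empty e h).elim
  · obtain ⟨x, -, -⟩ := exists_dart_eq hl
    exact x.1.has_zero

theorem exists_dart_eq_of_visitedBelow {l : List ℕ} {a : M.D}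
    (ha : VisitedBelow M.τ ∅ M.searchForest l a) :
    ∃ x : M.labelledTree.HalfEdge, dart x = a ∧ (l ≤ x.1.1.1 ∨ x.1.1.1 <+: l) := by
  obtain h | ⟨m, hm, hl⟩ := ha
  · exact (Finset.notMem_empty a h).elim
  · obtain ⟨x, rfl, hx⟩ := exists_dart_eq hm
    exact ⟨x, hx, hl⟩

theorem exists_loop (u : M.labelledTree.Node) :
    ∃ W h cs W' e, Explores M.σ M.τ W h cs W' e ∧
      (∃ x : M.labelledTree.HalfEdge, dart x = e ∧ (u.1.1 ≤ x.1.1.1 ∨ x.1.1.1 <+: u.1.1)) ∧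
      (∀ i b, ForestAt M.searchForest (u.1.1 ++ [i]) b ↔ ForestAt cs [i] b) ∧
      ∀ v : M.labelledTree.Edge, v.toNode = u → h = M.σ (carried v) := by
  obtain ⟨V, e, hE, he⟩ := M.exists_explores_searchForest
  rcases u.eq_root_or_edge with hu | ⟨v, rfl⟩
  · rw [hu]
    refine ⟨_, _, _, _, _, hE, exists_dart_eq_of_visitedBelow (hE.visitedBelow_nil M.τ_τ he),
      fun _ _ => Iff.rfl, ?_⟩
    rintro v rfl
    exact (v.ne_nil hu).elim
  · obtain ⟨W, cs, W', e', hcs, he', hat⟩ := hE.exists_below M.τ_τ (forestAt_carried v)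
    refine ⟨W, _, cs, W', e', hcs, exists_dart_eq_of_visitedBelow he', hat, fun w hw => ?_⟩
    rw [Edge.ext (congrArg (fun u : M.labelledTree.Node => u.1.1) hw)]

theorem σ_dart_down (v : M.labelledTree.Edge) :
    ∃ y, M.σ (dart (v, false)) = dart y ∧
      (M.labelledTree.initialRotation (Sum.inl (v, false)) = Sum.inl y ∨
        M.labelledTree.initialRotation (Sum.inl (v, false)) = Sum.inr v.toNode ∧
          (v.1.1 ≤ y.1.1.1 ∨ y.1.1.1 <+: v.1.1)) := by
  obtain ⟨W, h, cs, W', e, hE, ⟨y, hye, hy⟩, hat, hh⟩ := exists_loop v.toNode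
  obtain rfl := hh v rfl
  have hchild (i : ℕ) : M.labelledTree.Has (v.1.1 ++ [i]) ↔ i < cs.length := by
    rw [has_labelledTree_iff (by simp), ← exists_forestAt_singleton_iff]
    exact exists_congr (hat i)
  rcases cs.length.eq_zero_or_pos with hcs | hcs
  · refine ⟨y, ?_, Or.inr ⟨initialRotation_leaf (by rw [hchild]; omega), hy⟩⟩
    obtain rfl := List.length_eq_zero_iff.1 hcs
    cases hE
    exact hye.symm
  · obtain ⟨w, hw⟩ := ((hchild (cs.length - 1)).2 (by omega)).exists_child
    refine ⟨(w, true), ?_, Or.inl (initialRotation_down hw (by rw [hchild]; omega))⟩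
    exact (hE.apply_last_child M.τ_τ ((hat _ _).1 (hw ▸ forestAt_carried w)) (by omega)).symm

theorem σ_dart_up (v : M.labelledTree.Edge) :
    ∃ y, M.σ (dart (v, true)) = dart y ∧
      (M.labelledTree.initialRotation (Sum.inl (v, true)) = Sum.inl y ∨
        M.labelledTree.initialRotation (Sum.inl (v, true)) = Sum.inr v.parent ∧
          (v.parent.1.1 ≤ y.1.1.1 ∨ y.1.1.1 <+: v.parent.1.1)) := by
  obtain ⟨W, h, cs, W', e, hE, ⟨y, rfl, hy⟩, hat, -⟩ := exists_loop v.parent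
  obtain ⟨i, hi⟩ := v.exists_eq_concat
  have hv := (hat i _).1 (hi ▸ forestAt_carried v)
  cases i with
  | zero => exact ⟨y, (hE.end_eq M.τ_τ hv).symm, Or.inr ⟨initialRotation_up hi, hy⟩⟩
  | succ i =>
    obtain ⟨w, hw⟩ := Has.exists_child ((hi ▸ v.has : M.labelledTree.Has _).of_le i.le_succ)
    exact ⟨(w, true),
      (hE.apply_left_sibling M.τ_τ hv ((hat i _).1 (hw ▸ forestAt_carried w))).symm,
      Or.inl (initialRotation_left hi hw)⟩

theorem exists_σ_dart_eq (x : M.labelledTree.HalfEdge) :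
    ∃ y, M.σ (dart x) = dart y ∧
      (M.labelledTree.initialRotation (Sum.inl x) = Sum.inl y ∨
        ∃ u, M.labelledTree.initialRotation (Sum.inl x) = Sum.inr u ∧
          (u.1.1 ≤ y.1.1.1 ∨ y.1.1.1 <+: u.1.1)) := by
  obtain ⟨v, _ | _⟩ := x
  · obtain ⟨y, hy, h⟩ := σ_dart_down v
    exact ⟨y, hy, h.imp_right fun h => ⟨_, h⟩⟩
  · obtain ⟨y, hy, h⟩ := σ_dart_up v
    exact ⟨y, hy, h.imp_right fun h => ⟨_, h⟩⟩

theorem dart_rightmost {v : M.labelledTree.Edge} (hv : v.IsRightmost) :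
    dart (v, true) = M.root := by
  obtain ⟨V, e, hE, -⟩ := M.exists_explores_searchForest
  obtain ⟨i, hi, hlast⟩ := hv
  have hat := hi ▸ forestAt_carried v
  rw [has_labelledTree_iff (by simp), exists_forestAt_singleton_iff] at hlast
  have := hat.lt_length
  exact hE.apply_last_child M.τ_τ hat (by omega)

theorem dart_surjective (hM : M.ConnectedBy Set.univ) : Function.Surjective (dart (M := M)) := by
  have hσ (a : M.D) (ha : a ∈ Set.range (dart (M := M))) : M.σ a ∈ Set.range (dart (M := M)) := by
    obtain ⟨x, rfl⟩ := ha
    obtain ⟨y, hy, -⟩ := exists_σ_dart_eq x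
    exact ⟨y, hy.symm⟩
  have hτ (a : M.D) (ha : a ∈ Set.range (dart (M := M))) : M.τ a ∈ Set.range (dart (M := M)) := by
    obtain ⟨x, rfl⟩ := ha
    exact ⟨_, dart_flip x⟩
  obtain ⟨v, hv⟩ := exists_isRightmost M.has_zero_labelledTree
  exact fun a => (hM.iff_of_forall hσ (fun a _ => ⟨hτ a, fun h => M.τ_τ a ▸ hτ _ h⟩) _ a).1
    ⟨_, dart_rightmost hv⟩

theorem advances_of_isGlued {π : Equiv.Perm M.labelledTree.Node}
    {ρ : Equiv.Perm M.labelledTree.HalfEdge} (h : IsGlued π ρ)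
    (hρ : ∀ x, dart (ρ x) = M.σ (dart x)) : Advances π := by
  intro u
  rcases (π u).eq_root_or_edge with hroot | ⟨w, hw⟩
  · exact Or.inl (hroot ▸ List.nil_prefix)
  obtain ⟨x, hx⟩ := exists_initialRotation_eq_plug M.has_zero_labelledTree u
  have hxw : ρ x = (w, false) := by
    have hplug := h.inr hx
    rw [← hw, initialRotation_plug] at hplug
    exact (Sum.inl_injective hplug).symm
  obtain ⟨y, hy, hxy | ⟨u', hu', huy⟩⟩ := exists_σ_dart_eq x
  · rw [hx] at hxy; simp at hxy
  obtain rfl : u = u' := Sum.inr_injective (hx.symm.trans hu')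
  obtain rfl : y = (w, false) := dart_injective (by rw [← hy, ← hρ, hxw])
  rw [← hw, Edge.toNode_val]
  rcases huy with huy | huy
  · exact huy.lt_or_eq.symm.imp (fun heq => by rw [heq]) id
  · exact Or.inl huy

theorem exists_glued_iso (hM : M.ConnectedBy Set.univ) :
    ∃ (π : Equiv.Perm M.labelledTree.Node) (ρ : Equiv.Perm M.labelledTree.HalfEdge)
      (v : M.labelledTree.Edge), IsGlued π ρ ∧ Advances π ∧ v.IsRightmost ∧
      Iso (M.labelledTree.toRotationSystem ρ (v, true)) M := by
  let E : M.labelledTree.HalfEdge ≃ M.D :=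
    Equiv.ofBijective dart ⟨dart_injective, dart_surjective hM⟩
  let ρ : Equiv.Perm M.labelledTree.HalfEdge := (E.trans M.σ).trans E.symm
  have hρ (x : M.labelledTree.HalfEdge) : E (ρ x) = M.σ (E x) := E.apply_symm_apply _
  have hlocal {x y} (hxy : M.labelledTree.initialRotation (Sum.inl x) = Sum.inl y) : ρ x = y := by
    obtain ⟨z, hz, hxz | ⟨u, hu, -⟩⟩ := exists_σ_dart_eq x
    · obtain rfl : y = z := Sum.inl_injective (hxy.symm.trans hxz)
      exact dart_injective ((hρ x).trans hz)
    · rw [hxy] at hu; simp at hu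
  obtain ⟨π, hπ⟩ := exists_isGlued M.has_zero_labelledTree hlocal
  obtain ⟨v, hv⟩ := exists_isRightmost M.has_zero_labelledTree
  exact ⟨π, ρ, v, hπ, advances_of_isGlued hπ hρ, hv, E, hρ, dart_flip, dart_rightmost hv⟩

end RotationSystem

/-! ## Isomorphic maps -/

namespace RotationSystem

section Equiv

variable {X Y : Type} [Finite X] [Finite Y] {f : Equiv.Perm X} {g : Equiv.Perm Y}

theorem sameCycle_iff_of_equiv (e : X ≃ Y) (h : ∀ x, e (f x) = g (e x)) (x x' : X) :
    f.SameCycle x x' ↔ g.SameCycle (e x) (e x') := by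
  refine sameCycle_iff_of_retract e.symm e (fun y => ?_) (fun x => ?_)
    (fun x => by rw [e.symm_apply_apply]) x x'
  · have hy : e.symm (g y) = f (e.symm y) := by
      rw [Equiv.symm_apply_eq, h, Equiv.apply_symm_apply]
    exact hy ▸ sameCycle_apply_self _ _
  · exact h x ▸ sameCycle_apply_self _ _

theorem numOrbits_eq_of_equiv (e : X ≃ Y) (h : ∀ x, e (f x) = g (e x)) :
    numOrbits f = numOrbits g :=
  Nat.card_congr (Quotient.congr e (sameCycle_iff_of_equiv e h))

end Equiv

variable {M M' : RotationSystem}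

theorem Iso.numEdges_eq (h : Iso M M') : M.numEdges = M'.numEdges := by
  obtain ⟨e, -, hτ, -⟩ := h
  exact numOrbits_eq_of_equiv e hτ

theorem ConnectedBy.preimage {e : M.D ≃ M'.D} (hσ : ∀ h, e (M.σ h) = M'.σ (e h))
    (hτ : ∀ h, e (M.τ h) = M'.τ (e h)) {A : Set M'.D} (hA : M'.ConnectedBy A) :
    M.ConnectedBy (e ⁻¹' A) := by
  intro x y
  suffices h : ∀ a b, Relation.EqvGen (fun a b => M'.σ.SameCycle a b ∨ (a ∈ A ∧ b = M'.τ a)) a b →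
      Relation.EqvGen (fun a b => M.σ.SameCycle a b ∨ (a ∈ e ⁻¹' A ∧ b = M.τ a))
        (e.symm a) (e.symm b) by
    simpa only [e.symm_apply_apply] using h _ _ (hA (e x) (e y))
  intro a b hab
  induction hab with
  | rel a b h =>
    refine Relation.EqvGen.rel _ _ ?_
    rcases h with h | ⟨ha, rfl⟩
    · exact Or.inl ((sameCycle_iff_of_equiv e hσ _ _).2 (by simpa using h))
    · exact Or.inr ⟨by simpa using ha, by rw [Equiv.symm_apply_eq, hτ, Equiv.apply_symm_apply]⟩
  | refl a => exact Relation.EqvGen.refl _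
  | symm a b _ ih => exact ih.symm
  | trans a b c _ _ ihab ihbc => exact ihab.trans _ _ _ ihbc

theorem Iso.isBridgelessPlanarMap (h : Iso M M') (hM : M'.IsBridgelessPlanarMap) :
    M.IsBridgelessPlanarMap := by
  obtain ⟨e, hσ, hτ, -⟩ := h
  refine ⟨⟨hM.connected.preimage hσ hτ, ?_⟩, fun x hx => hx ?_⟩
  · have hvertices : M.numVertices = M'.numVertices := numOrbits_eq_of_equiv e hσ
    have hedges : M.numEdges = M'.numEdges := numOrbits_eq_of_equiv e hτ
    have hfaces : M.numFaces = M'.numFaces := numOrbits_eq_of_equiv e fun x => by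
      rw [Equiv.Perm.mul_apply, Equiv.Perm.mul_apply, hσ, hτ]
    rw [hvertices, hedges, hfaces]
    exact hM.euler
  · convert (not_not.1 (hM.bridgeless (e x))).preimage hσ hτ using 1
    ext y
    simp [← hτ]

end RotationSystem

/-! ## Sticky trees and bridgeless planar maps -/

namespace PlaneTree

variable {T : PlaneTree ℕ} {π : Equiv.Perm T.Node} {ρ : Equiv.Perm T.HalfEdge} {v : T.Edge}

theorem IsGlued.unique {ρ' : Equiv.Perm T.HalfEdge} (h : IsGlued π ρ) (h' : IsGlued π ρ') :
    ρ = ρ' := by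
  refine Equiv.ext fun x => ?_
  rcases hx : T.initialRotation (Sum.inl x) with y | u
  · rw [h.inl hx, h'.inl hx]
  · exact Sum.inl_injective ((h.inr hx).symm.trans (h'.inr hx))

theorem numEdges_toRotationSystem (r : T.HalfEdge) :
    (T.toRotationSystem ρ r).numEdges = T.numEdges := by
  have hflip : (T.toRotationSystem ρ r).numEdges = Nat.card T.Edge := numOrbits_flip
  rw [hflip, PlaneTree.numEdges, ← card_edge_add_one, Nat.add_sub_cancel]

/-- The nodes `u` and `w` are glued together by `π`, or an edge of `E` leads from `u` up to `w`. -/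
def Linked (π : Equiv.Perm T.Node) (E : Set T.Edge) (u w : T.Node) : Prop :=
  π.SameCycle u w ∨ ∃ v ∈ E, v.toNode = u ∧ v.parent = w

theorem IsGlued.connectedBy_of_linked (h : IsGlued π ρ) (hT : T.Has [0]) (r : T.HalfEdge)
    {A : Set T.HalfEdge} {E : Set T.Edge} (hE : ∀ w ∈ E, (w, false) ∈ A) {o : T.Node}
    (ho : ∀ u, Relation.EqvGen (Linked π E) u o) : (T.toRotationSystem ρ r).ConnectedBy A := by
  let R : T.HalfEdge → T.HalfEdge → Prop :=
    Relation.EqvGen (fun a b => ρ.SameCycle a b ∨ (a ∈ A ∧ b = T.flip a))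
  have htrans {a b c} (hab : R a b) (hbc : R b c) : R a c := hab.trans _ _ _ hbc
  have hcycle {a b} (hab : π.SameCycle (owner a) (owner b)) : R a b :=
    Relation.EqvGen.rel _ _ (Or.inl ((h.sameCycle_iff hT _ _).2 hab))
  have hnodes {u w} (huw : Relation.EqvGen (Linked π E) u w) : R (first hT u) (first hT w) := by
    induction huw with
    | rel u w huw =>
      rcases huw with huw | ⟨v, hv, rfl, rfl⟩
      · exact hcycle (by rwa [owner_first, owner_first])
      · have hflip : R (v, false) (v, true) := Relation.EqvGen.rel _ _ (Or.inr ⟨hE v hv, rfl⟩)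
        exact htrans (hcycle (by rw [owner_first, owner_false]))
          (htrans hflip (hcycle (by rw [owner_first, owner_true])))
    | refl u => exact Relation.EqvGen.refl _
    | symm u w _ ih => exact ih.symm
    | trans u w t _ _ ihuw ihwt => exact htrans ihuw ihwt
  have hroot (x : T.HalfEdge) : R x (first hT o) :=
    htrans (hcycle (by rw [owner_first])) (hnodes (ho (owner x)))
  exact fun x y => htrans (hroot x) (hroot y).symm

theorem eqvGen_linked_of_prefix {E : Set T.Edge} {t u : T.Node} (htu : t.1.1 <+: u.1.1)
    (hE : ∀ w : T.Edge, w.1.1 <+: u.1.1 → ¬ w.1.1 <+: t.1.1 → w ∈ E) :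
    Relation.EqvGen (Linked π E) u t := by
  induction hn : u.1.1.length generalizing u with
  | zero =>
    rw [List.length_eq_zero_iff] at hn
    rw [hn, List.prefix_nil] at htu
    rw [Node.ext (hn.trans htu.symm)]
    exact Relation.EqvGen.refl _
  | succ n ih =>
    rcases u.eq_root_or_edge with hu | ⟨w, rfl⟩
    · simp [hu] at hn
    obtain ⟨i, hi⟩ := w.exists_eq_concat
    rw [Edge.toNode_val, hi] at htu hn
    rw [List.length_append, List.length_singleton, Nat.add_right_cancel_iff] at hn
    rcases List.prefix_concat_iff.1 htu with htw | htw
    · rw [Node.ext (htw.trans hi.symm : t.1.1 = w.toNode.1.1)]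
      exact Relation.EqvGen.refl _
    · have hparent : w.parent.1.1 <+: w.1.1 := ⟨_, hi.symm⟩
      have hw : w ∈ E := hE w List.prefix_rfl fun hwt => by
        simpa [hi] using hwt.length_le.trans htw.length_le
      have hlink : Linked π E w.toNode w.parent := Or.inr ⟨w, hw, rfl, rfl⟩
      exact (Relation.EqvGen.rel _ _ hlink).trans _ _ _
        (ih htw (fun w' hw' => hE w' (hw'.trans hparent)) hn)

-- Without the edge above `v`, the sub-tree at `v` is still attached to the rest: by (2), it has a
-- node that is glued to a node above `v`.
theorem IsSticky.connectedBy (hS : T.IsSticky) (hT : T.Has [0]) (hG : IsGlued hS.perm ρ)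
    (r : T.HalfEdge) (v : T.Edge) {A : Set T.HalfEdge}
    (hA : ∀ w : T.Edge, w ≠ v → (w, false) ∈ A) : (T.toRotationSystem ρ r).ConnectedBy A := by
  obtain ⟨o, ho⟩ := T.has_nil.exists_node
  have outside (u : T.Node) (hu : ¬ v.1.1 <+: u.1.1) :
      Relation.EqvGen (Linked hS.perm {v}ᶜ) u o := by
    refine eqvGen_linked_of_prefix (by simp [ho]) ?_
    rintro w hw - rfl
    exact hu hw
  have inside (u : T.Node) (hu : v.1.1 <+: u.1.1) :
      Relation.EqvGen (Linked hS.perm {v}ᶜ) u v.toNode := by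
    refine eqvGen_linked_of_prefix hu ?_
    rintro w - hw rfl
    exact hw List.prefix_rfl
  have reconnect : Relation.EqvGen (Linked hS.perm {v}ᶜ) v.toNode o := by
    obtain ⟨z, hz, hvz, hlt⟩ := hS.exists_label_lt _ v.toNode.2 (List.length_pos_iff.2 v.ne_nil)
    have hrep : Linked hS.perm {v}ᶜ ⟨z, hz⟩ (hS.rep ⟨z, hz⟩) := Or.inl (hS.sameCycle_rep _)
    refine (inside ⟨z, hz⟩ hvz).symm.trans _ _ _ ((Relation.EqvGen.rel _ _ hrep).trans _ _ _
      (outside _ fun h => ?_))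
    have hle := h.length_le
    rw [hS.rep_length] at hle
    exact hlt.not_ge hle
  refine hG.connectedBy_of_linked hT r hA (o := o) fun u => ?_
  by_cases hu : v.1.1 <+: u.1.1
  · exact (inside u hu).trans _ _ _ reconnect
  · exact outside u hu

theorem IsSticky.isBridgelessPlanarMap (hS : T.IsSticky) (hT : T.Has [0])
    (hG : IsGlued hS.perm ρ) (r : T.HalfEdge) :
    (T.toRotationSystem ρ r).IsBridgelessPlanarMap := by
  refine ⟨⟨hS.connectedBy hT hG r r.1 fun _ _ => Set.mem_univ _, ?_⟩, ?_⟩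
  · exact (hG.euler_iff_noncrossing hT).2 hS.noncrossing_perm
  · rintro ⟨v, b⟩ h
    refine h (hS.connectedBy hT hG r v fun w hw => ?_)
    change ((w, false) : T.HalfEdge) ∉ ({(v, b), T.flip (v, b)} : Set T.HalfEdge)
    simp [flip_apply, hw]

theorem IsSticky.labelledTree_eq (hS : T.IsSticky) (hG : IsGlued hS.perm ρ)
    (hv : v.IsRightmost) : (T.toRotationSystem ρ (v, true)).labelledTree = T := by
  have hlabel : (T.toRotationSystem ρ (v, true)).vertexLabel =
      Prod.snd ∘ fun x => (nodeOf ρ (v, true) x).1 := by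
    funext x
    refine (vertexLabel_glued hG hS.perm_prefix_or_lt hv (x := x)
      (u := hS.rep (nodeOf ρ (v, true) x)) (hS.sameCycle_rep _).symm fun w hw => ?_).trans
      (hS.rep_length _)
    have hrep : hS.rep w = hS.rep (nodeOf ρ (v, true) x) := (hS.sameCycle_perm_iff _ _).1 hw
    rw [← hrep]
    exact hS.rep_prefix w
  rw [RotationSystem.labelledTree_eq, hlabel, ← map_map,
    map_nodeOf_searchTree hG hS.perm_prefix_or_lt hv, map_snd_withAddr]

/-! ## Recovering the gluing from the labels -/

theorem exists_top (hnc : Noncrossing rank π) (hπ : Advances π) (u : T.Node) :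
    ∃ t : T.Node, π.SameCycle t u ∧ ∀ w, π.SameCycle w u → t.1.1 <+: w.1.1 := by
  obtain ⟨y, hy, hlast⟩ := hnc.exists_last u
  have hcycle : π.SameCycle u (π y) := hy.trans (sameCycle_apply_self _ _)
  have hprefix : (π y).1.1 <+: y.1.1 :=
    (hπ y).resolve_right (rank_le_iff.1 (hlast _ hcycle).2).not_gt
  refine ⟨π y, hcycle.symm, fun w hw => ?_⟩
  have hw := hlast w hw.symm
  exact prefix_of_le_of_le (rank_le_iff.1 hw.1) (rank_le_iff.1 hw.2) hprefix

/-- Every cycle of `π` has a common ancestor `top u` of its nodes among them, and its depth is the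
label of all of them: `T` is labelled as if by the exploration of the map in which the nodes of
each cycle are glued together. -/
structure LabelledByTop (π : Equiv.Perm T.Node) (top : T.Node → T.Node) : Prop where
  sameCycle_top : ∀ u, π.SameCycle (top u) u
  top_prefix : ∀ u w, π.SameCycle w u → (top u).1.1 <+: w.1.1
  label_eq : ∀ u, u.1.2 = (top u).1.1.length

theorem exists_labelledByTop (hnc : Noncrossing rank π) (hπ : Advances π) (hG : IsGlued π ρ)
    (hv : v.IsRightmost) (hL : (T.toRotationSystem ρ (v, true)).labelledTree = T) :
    ∃ top, LabelledByTop π top := by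
  choose top hcycle hprefix using exists_top hnc hπ
  refine ⟨top, hcycle, hprefix, fun u => ?_⟩
  have hu : u.1 ∈ (T.toRotationSystem ρ (v, true)).labelledTree.nodes := hL.symm ▸ u.2
  rw [RotationSystem.labelledTree_eq, nodes_map] at hu
  obtain ⟨⟨l, b⟩, hb, hbu⟩ := List.mem_map.1 hu
  obtain rfl : nodeOf ρ (v, true) b = u :=
    Node.ext ((addr_nodeOf hG hπ hv hb).trans (congrArg Prod.fst hbu))
  exact (congrArg Prod.snd hbu).symm.trans
    (vertexLabel_glued hG hπ hv (hcycle _) (hprefix _))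

namespace LabelledByTop

variable {top : T.Node → T.Node} (h : LabelledByTop π top)
include h

theorem top_prefix_self (u : T.Node) : (top u).1.1 <+: u.1.1 := h.top_prefix u u SameCycle.rfl

theorem top_eq_of_sameCycle {u w : T.Node} (huw : π.SameCycle u w) : top u = top w := by
  have hle := h.top_prefix u (top w) ((h.sameCycle_top w).trans huw.symm)
  have hge := h.top_prefix w (top u) ((h.sameCycle_top u).trans huw)
  exact Node.ext (hle.eq_of_length (le_antisymm hle.length_le hge.length_le))

theorem sameCycle_iff (u w : T.Node) : π.SameCycle u w ↔ top u = top w :=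
  ⟨h.top_eq_of_sameCycle, fun htop =>
    (h.sameCycle_top u).symm.trans (htop ▸ h.sameCycle_top w)⟩

theorem label_le_depth (u : T.Node) : u.1.2 ≤ u.1.1.length :=
  (h.label_eq u).trans_le (h.top_prefix_self u).length_le

-- Otherwise no node below the edge `v` is glued to a node above it, and `v` is a bridge.
theorem exists_label_lt (hT : T.Has [0]) (hG : IsGlued π ρ) {r : T.HalfEdge} (v : T.Edge)
    (hv : ¬ (T.toRotationSystem ρ r).IsBridge (v, false)) :
    ∃ w : T.Node, v.1.1 <+: w.1.1 ∧ w.1.2 < v.1.1.length := by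
  by_contra! hlabel
  let Below (a : T.HalfEdge) : Prop := v.1.1 <+: (owner a).1.1
  have hσ (a : T.HalfEdge) (ha : Below a) : Below (ρ a) := by
    have hcycle := (hG.sameCycle_iff hT _ _).1 (sameCycle_apply_self ρ a)
    have htop : v.1.1 <+: (top (owner a)).1.1 := List.prefix_of_prefix_length_le ha
      (h.top_prefix_self _) (h.label_eq (owner a) ▸ hlabel _ ha)
    exact htop.trans (h.top_prefix _ _ hcycle.symm)
  have hτ (w : T.Edge) (hw : w ≠ v) : v.1.1 <+: w.toNode.1.1 ↔ v.1.1 <+: w.parent.1.1 := by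
    obtain ⟨j, hj⟩ := w.exists_eq_concat
    rw [Edge.toNode_val, hj, List.prefix_concat_iff, or_iff_right]
    exact fun hvw => hw (Edge.ext (hj.trans hvw.symm))
  have hconnected := not_not.1 hv
  have hiff : Below (v, false) ↔ Below (v, true) := hconnected.iff_of_forall hσ ?_ _ _
  · have hprefix : v.1.1 <+: v.parent.1.1 := hiff.1 List.prefix_rfl
    obtain ⟨j, hj⟩ := v.exists_eq_concat
    have hlength := congrArg List.length hj
    rw [List.length_append, List.length_singleton] at hlength
    have hle := hprefix.length_le
    omega
  · rintro ⟨w, b⟩ ha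
    have hw : w ≠ v := by
      rintro rfl
      cases b
      · exact ha (Or.inl rfl)
      · exact ha (Or.inr rfl)
    cases b
    · exact hτ w hw
    · exact (hτ w hw).symm

-- If `w` had a smaller label, then `top w`, `u`, `w`, `v` would come in this order, and the cycle
-- containing `top w` and `w` would cross the one containing `u` and `v`.
theorem depth_le_of_before (hnc : Noncrossing rank π) {u v w : T.Node} (huv : u.1.1 <+: v.1.1)
    (hlabel : v.1.2 = u.1.1.length) (huw : u.1.1 <+: w.1.1) (hwv : w.1.1 < v.1.1) :
    u.1.1.length ≤ w.1.2 := by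
  by_contra! hlt
  rw [h.label_eq w] at hlt
  have hlength : (top v).1.1.length = u.1.1.length := (h.label_eq v).symm.trans hlabel
  have htopv : top v = u := Node.ext
    ((List.prefix_of_prefix_length_le (h.top_prefix_self v) huv hlength.le).eq_of_length hlength)
  have hcycle : π.SameCycle u v := htopv ▸ h.sameCycle_top v
  have htopu : top u = u := (h.top_eq_of_sameCycle hcycle).trans htopv
  have hne : top w ≠ u := fun heq => (heq ▸ hlt).false
  have htopw : (top w).1.1 <+: u.1.1 :=
    List.prefix_of_prefix_length_le (h.top_prefix_self w) huw hlt.le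
  have hwu : (top w).1.1 < u.1.1 := (le_of_prefix htopw).lt_of_ne fun heq => hne (Node.ext heq)
  have huw' : u.1.1 < w.1.1 := (le_of_prefix huw).lt_of_ne fun heq =>
    hne ((congrArg top (Node.ext heq)).symm.trans htopu)
  have hcross := hnc.sameCycle_of_crossing rank_injective (rank_lt_iff.2 hwu)
    (rank_lt_iff.2 huw') (rank_lt_iff.2 hwv) (h.sameCycle_top w) hcycle
  exact hne (((h.top_eq_of_sameCycle (h.sameCycle_top w)).symm.trans
    (h.top_eq_of_sameCycle hcross)).trans htopu)

theorem isSticky (hnc : Noncrossing rank π) (hT : T.Has [0]) (hG : IsGlued π ρ) {r : T.HalfEdge}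
    (hB : ∀ x, ¬ (T.toRotationSystem ρ r).IsBridge x) : T.IsSticky where
  label_le_depth u hu := h.label_le_depth ⟨u, hu⟩
  exists_label_lt u hu hpos := by
    let v : T.Edge := ⟨u, mem_nonRootNodes.2 ⟨hu, List.length_pos_iff.1 hpos⟩⟩
    obtain ⟨w, hvw, hw⟩ := h.exists_label_lt hT hG v (hB (v, false))
    exact ⟨w.1, w.2, hvw, hw⟩
  depth_le_of_before u hu v hv huv hlabel w hw huw hwv :=
    h.depth_le_of_before (u := ⟨u, hu⟩) (v := ⟨v, hv⟩) (w := ⟨w, hw⟩) hnc huv hlabel huw hwv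

theorem perm_eq (hnc : Noncrossing rank π) (hS : T.IsSticky) : hS.perm = π := by
  have hrep (u : T.Node) : hS.rep u = top u :=
    hS.rep_eq (h.top_prefix_self u) (h.label_eq u).symm
  refine hS.noncrossing_perm.eq_of_sameCycle_iff rank_injective hnc fun x y => ?_
  rw [hS.sameCycle_perm_iff, hrep, hrep, h.sameCycle_iff]

end LabelledByTop

theorem exists_isSticky_perm_eq (hπ : Advances π) (hG : IsGlued π ρ) (hv : v.IsRightmost)
    (hB : (T.toRotationSystem ρ (v, true)).IsBridgelessPlanarMap)
    (hL : (T.toRotationSystem ρ (v, true)).labelledTree = T) :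
    ∃ hS : T.IsSticky, hS.perm = π := by
  have hnc : Noncrossing rank π := (hG.euler_iff_noncrossing v.has_zero).1 hB.euler
  obtain ⟨top, htop⟩ := exists_labelledByTop hnc hπ hG hv hL
  have hS : T.IsSticky := htop.isSticky hnc v.has_zero hG hB.bridgeless
  exact ⟨hS, htop.perm_eq hnc hS⟩

/-! ## The bijection -/

theorem Edge.IsRightmost.unique {w : T.Edge} (hv : v.IsRightmost) (hw : w.IsRightmost) :
    v = w := by
  obtain ⟨i, hi, hlasti⟩ := hv
  obtain ⟨j, hj, hlastj⟩ := hw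
  refine Edge.ext (hi.trans (Eq.trans ?_ hj.symm))
  have hvi : T.Has ([] ++ [i]) := hi ▸ v.has
  have hwj : T.Has ([] ++ [j]) := hj ▸ w.has
  rcases lt_trichotomy i j with hij | rfl | hij
  · exact absurd (hwj.of_le hij) hlasti
  · rfl
  · exact absurd (hvi.of_le hij) hlastj

theorem has_zero_of_numEdges_pos (h : 0 < T.numEdges) : T.Has [0] := by
  rw [PlaneTree.numEdges, ← card_edge_add_one, Nat.add_sub_cancel] at h
  obtain ⟨v⟩ := (Nat.card_pos_iff.1 h).1
  exact v.has_zero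

theorem exists_map_of_mem_stickyTrees {n : ℕ} (hn : 1 ≤ n) (hT : T ∈ stickyTrees n) :
    ∃ B ∈ bridgelessMaps n, treeToMap T = some B ∧ mapToTree B = T := by
  obtain ⟨hS, rfl⟩ := hT
  have hzero := has_zero_of_numEdges_pos hn
  obtain ⟨ρ, v, i, hG, hv, hlast, hmap⟩ := hS.treeToMap_eq hzero
  exact ⟨_, ⟨_, hS.isBridgelessPlanarMap hzero hG (v, true), numEdges_toRotationSystem _, rfl⟩,
    hmap, hS.labelledTree_eq hG ⟨i, hv, hlast⟩⟩

theorem mapToTree_mem_stickyTrees {n : ℕ} {B : RootedMap} (hB : B ∈ bridgelessMaps n) :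
    mapToTree B ∈ stickyTrees n ∧ treeToMap (mapToTree B) = some B := by
  obtain ⟨M, hM, rfl, rfl⟩ := hB
  change M.labelledTree ∈ stickyTrees _ ∧ treeToMap M.labelledTree = _
  obtain ⟨π, ρ, v, hG, hπ, hv, hiso⟩ := M.exists_glued_iso hM.connected
  obtain ⟨hS, rfl⟩ := exists_isSticky_perm_eq hπ hG hv (hiso.isBridgelessPlanarMap hM)
    (RotationSystem.labelledTree_eq_of_iso hiso)
  refine ⟨⟨hS, (numEdges_toRotationSystem _).symm.trans hiso.numEdges_eq⟩, ?_⟩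
  obtain ⟨ρ', v', i, hG', hv', hlast, hmap⟩ := hS.treeToMap_eq v.has_zero
  rw [hmap, hG'.unique hG, Edge.IsRightmost.unique ⟨i, hv', hlast⟩ hv]
  exact congrArg some (Quotient.sound hiso)

end PlaneTree

theorem mainTheorem1 (n : ℕ) (hn : 1 ≤ n) :
    Set.BijOn mapToTree (bridgelessMaps n) (stickyTrees n) ∧
      (∀ T ∈ stickyTrees n, ∃ B ∈ bridgelessMaps n, treeToMap T = some B) ∧
      (∀ B ∈ bridgelessMaps n, treeToMap (mapToTree B) = some B) ∧
      (∀ T ∈ stickyTrees n, ∀ B, treeToMap T = some B → mapToTree B = T) := by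
  have hmem (B) (hB : B ∈ bridgelessMaps n) : mapToTree B ∈ stickyTrees n :=
    (mapToTree_mem_stickyTrees hB).1
  have hleft (B) (hB : B ∈ bridgelessMaps n) : treeToMap (mapToTree B) = some B :=
    (mapToTree_mem_stickyTrees hB).2
  have hright (T) (hT : T ∈ stickyTrees n) := exists_map_of_mem_stickyTrees hn hT
  refine ⟨⟨hmem, fun B hB B' hB' h => ?_, fun T hT => ?_⟩, fun T hT => ?_, hleft,
    fun T hT B hB => ?_⟩
  · exact Option.some.inj ((hleft B hB).symm.trans ((congrArg treeToMap h).trans (hleft B' hB')))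
  · obtain ⟨B, hB, -, hBT⟩ := hright T hT
    exact ⟨B, hB, hBT⟩
  · obtain ⟨B, hB, hTB, -⟩ := hright T hT
    exact ⟨B, hB, hTB⟩
  · obtain ⟨B', -, hTB', hB'T⟩ := hright T hT
    obtain rfl : B = B' := Option.some.inj (hB.symm.trans hTB')
    exact hB'T
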